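/- **Setting.** Consider the system in innovation form $x(t+1)=Ax(t)+Bu(t)+Ke(t)$, $y(t)=Cx(t)+Du(t)+e(t)$, $t\in\mathbb Z$, with $x(t)\in\mathbb R^n$, $u(t)\in\mathbb R^m$, $y(t),e(t)\in\mathbb R^p$, on a probability space. All eigenvalues of $A$ and of $A-KC$ have modulus $<1$. The input $u$ is wide-sense stationary and its sample second moments $\frac1N\sum_{k<N}u_a(i+k)u_b(j+k)$ converge in probability to $\mathbb E[u_a(i)u_b(j)]$. The variables $e(t)$ are square integrable and identically distributed, and, conditionally on the whole input process and on $e(s)$, $s<t$ (open loop), $e(t)$ has mean zero and variance $\Lambda$. The state has second moments bounded uniformly in $t\in\mathbb Z$. For a signal $w$ let $W_{[t_0,t_1],N}$ be the block Hankel matrix whose column $j$ ($0\le j<N$) is $\frac1{\sqrt N}$ times the stack of $w(t_0+j),\dots,w(t_1+j)$, and $W_{t_0}=W_{[t_0,t_0],N}$. For a past horizon $\rho$ and a future horizon $T$ put $U_P=U_{[0,\rho-1],N}$, $Y_P=Y_{[0,\rho-1],N}$, $Z_P=[U_P^\top\ Y_P^\top]^\top$, $U_F=U_{[\rho,\rho+T-1],N}$,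 $Y_F=Y_{[\rho,\rho+T-1],N}$. Let $\Pi_A[B]=BA^\top(AA^\top)^\dagger A$, $\hat Y_F=\Pi_{Z_P,U_F}[Y_F]$ and $\hat X_\rho=\Pi_{Z_P,U_F}[X_\rho]$, the projections on the row span of $Z_P$ and $U_F$ together. Let $\Gamma=[C;CA;\dots;CA^{T-1}]$; let $\mathcal H_d$ be the block lower triangular Toeplitz matrix with $D$ on the diagonal and $CA^{k-l-1}B$ in block $(k,l)$ for $l<k$; and let $\mathcal C=[\Phi_\rho\cdots\Phi_1\ \Psi_\rho\cdots\Psi_1]$ with $\Phi_k=(A-KC)^{k-1}(B-KD)$ and $\Psi_k=(A-KC)^{k-1}K$. For $\alpha\in\mathbb R^N$ put $$\hat x^d(t)=\hat X_\rho\alpha,\qquad z_{init}=Z_P\alpha,\qquad u_f=U_F\alpha .$$ All asymptotics are for $N\to\infty$ with $T$ fixed. The vectors $\alpha=\alpha_N\in\mathbb R^N$ depend on $N$, and may depend on the data unless stated otherwise; norms of vectors are Euclidean. **Theorem (output/data relation).** 1. For every fixed $\rho$ and all $\alpha_N$ with $\|\alpha_N\|=O_P(1)$, $$\hat Y_F\alpha=\Gamma\hat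 x^d(t)+\mathcal H_du_f+O_P(1/\sqrt N).$$ 2. For every (possibly data-dependent) choice of $\rho=\rho_N$ with $\|(A-KC)^{\rho_N}\|=o_P(1/\sqrt N)$ and all $\alpha_N$ with $\|\alpha_N\|=O_P(1)$, $$\hat x^d(t)=\mathcal C z_{init}+o_P(1/\sqrt N).$$ 3. Assume in addition that $\Lambda>0$, that $u$ has a spectral density matrix that is bounded and bounded away from zero, that $u$ and $e$ have finite fourth moments, and that the mean square errors of the sample second moments of $u$ are at most $c/N$ uniformly in the times $i,j$. Let the nonrandom $\rho_N$ satisfy $\rho_N^3=O(N)$. Let $\alpha_N$ be nonrandom with $\|\alpha_N\|=O(1)$, or such that $z_{init}$ and $u_f$ are prescribed nonrandom vectors of bounded norm, or more generally such that, with probability tending to $1$, $[z_{init};u_f]=[Z_P;U_F]\,a_N+v_N$ with nonrandom $a_N,v_N$ of bounded norm. Then $$\hat Y_F\alpha=\Gamma\hat x^d(t)+\mathcal H_du_f+O_P(1/\sqrt N).$$ If moreover $\|(A-KC)^{\rho_N}\|=o(1/\sqrt N)$, then also $\hat x^d(t)=\mathcal C z_{init}+o_P(1/\sqrt N)$, and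 hence $$\hat Y_F\alpha=\Gamma\,\mathcal C z_{init}+\mathcal H_du_f+O_P(1/\sqrt N).$$ -/

import Mathlib

open MeasureTheory ProbabilityTheory Filter Topology Matrix Asymptotics
open scoped ComplexOrder

noncomputable section

namespace DDPC

/-! ### Stochastic orders -/

/-- `X N = O_P(r N)` as `N → ∞`, for real random sequences `X` and deterministic rates `r`. The
(outer) measure is used, so that no measurability of `X` is needed. -/
def IsBigOP {Ω : Type*} [MeasurableSpace Ω] (μ : Measure Ω) (X : ℕ → Ω → ℝ) (r : ℕ → ℝ) : Prop :=
  ∀ ε : ℝ, 0 < ε → ∃ c : ℝ, ∃ M : ℕ, ∀ N : ℕ, M ≤ N →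
    μ {ω | c * |r N| < |X N ω|} ≤ ENNReal.ofReal ε

/-- `X N = o_P(r N)` as `N → ∞`. -/
def IsLittleOP {Ω : Type*} [MeasurableSpace Ω] (μ : Measure Ω) (X : ℕ → Ω → ℝ) (r : ℕ → ℝ) :
    Prop :=
  ∀ δ : ℝ, 0 < δ → Tendsto (fun N => μ {ω | δ * |r N| < |X N ω|}) atTop (𝓝 0)

/-- The rate `1 / √N`. -/
def rootRate (N : ℕ) : ℝ := 1 / √(N : ℝ)

/-- The Euclidean norm of a real vector. -/
def euclNorm {ι : Type*} [Fintype ι] (v : ι → ℝ) : ℝ := ‖WithLp.toLp 2 v‖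

/-- The spectral norm (operator norm for the Euclidean norm) of a square real matrix. -/
def opNorm {ι : Type*} [Fintype ι] [DecidableEq ι] (M : Matrix ι ι ℝ) : ℝ :=
  ‖Matrix.toEuclideanCLM (n := ι) (𝕜 := ℝ) M‖

/-! ### Moore–Penrose inverse and projection onto a row span -/

/-- `P` is the Moore–Penrose inverse of the real matrix `A`. -/
structure IsMoorePenrose {ι κ : Type*} [Fintype ι] [Fintype κ]
    (A : Matrix ι κ ℝ) (P : Matrix κ ι ℝ) : Prop where
  mul_mul_self : A * P * A = A
  mul_mul_inv : P * A * P = P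
  symm_left : (A * P)ᵀ = A * P
  symm_right : (P * A)ᵀ = P * A

theorem IsMoorePenrose.unique {ι κ : Type*} [Fintype ι] [Fintype κ]
    {A : Matrix ι κ ℝ} {P Q : Matrix κ ι ℝ} (hP : IsMoorePenrose A P) (hQ : IsMoorePenrose A Q) :
    P = Q := by
  have h1 : A * P = A * Q := by
    calc A * P = (A * Q * A) * P := by rw [hQ.mul_mul_self]
      _ = (A * Q) * (A * P) := by simp only [Matrix.mul_assoc]
      _ = (A * Q)ᵀ * (A * P)ᵀ := by rw [hQ.symm_left, hP.symm_left]
      _ = ((A * P * A) * Q)ᵀ := by rw [← Matrix.transpose_mul]; simp only [Matrix.mul_assoc]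
      _ = A * Q := by rw [hP.mul_mul_self, hQ.symm_left]
  have h2 : P * A = Q * A := by
    calc P * A = P * (A * Q * A) := by rw [hQ.mul_mul_self]
      _ = (P * A) * (Q * A) := by simp only [Matrix.mul_assoc]
      _ = (P * A)ᵀ * (Q * A)ᵀ := by rw [hP.symm_right, hQ.symm_right]
      _ = (Q * (A * P * A))ᵀ := by rw [← Matrix.transpose_mul]; simp only [Matrix.mul_assoc]
      _ = Q * A := by rw [hP.mul_mul_self, hQ.symm_right]
  calc P = P * A * P := hP.mul_mul_inv.symm
    _ = Q * (A * P) := by rw [h2, Matrix.mul_assoc]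
    _ = Q * A * Q := by rw [h1, Matrix.mul_assoc]
    _ = Q := hQ.mul_mul_inv

theorem exists_isMoorePenrose_of_isHermitian {ι : Type*} [Fintype ι]
    {S : Matrix ι ι ℝ} (hS : S.IsHermitian) : ∃ P, IsMoorePenrose S P := by
  classical
  set U : Matrix ι ι ℝ := (hS.eigenvectorUnitary : Matrix ι ι ℝ) with hU
  have hUU : Uᵀ * U = 1 := by
    have h := (Matrix.mem_unitaryGroup_iff' (A := U)).1 hS.eigenvectorUnitary.2
    simpa [Matrix.star_eq_conjTranspose, Matrix.conjTranspose_eq_transpose_of_trivial] using h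
  have hSp : S = U * diagonal hS.eigenvalues * Uᵀ := by
    have h := hS.spectral_theorem
    rw [Unitary.conjStarAlgAut_apply] at h
    simpa [Matrix.star_eq_conjTranspose, Matrix.conjTranspose_eq_transpose_of_trivial,
      Function.comp_def] using h
  have key : ∀ f g : ι → ℝ, (U * diagonal f * Uᵀ) * (U * diagonal g * Uᵀ)
      = U * diagonal (fun i => f i * g i) * Uᵀ := by
    intro f g
    calc (U * diagonal f * Uᵀ) * (U * diagonal g * Uᵀ)
        = U * diagonal f * (Uᵀ * U) * diagonal g * Uᵀ := by simp only [Matrix.mul_assoc]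
      _ = _ := by rw [hUU, Matrix.mul_one, Matrix.mul_assoc U, diagonal_mul_diagonal]
  have ht : ∀ f : ι → ℝ, (U * diagonal f * Uᵀ)ᵀ = U * diagonal f * Uᵀ := by
    intro f
    simp [Matrix.transpose_mul, Matrix.mul_assoc]
  obtain ⟨d, hd⟩ : ∃ d : ι → ℝ, S = U * diagonal d * Uᵀ := ⟨_, hSp⟩
  refine ⟨U * diagonal (fun i => (d i)⁻¹) * Uᵀ, ?_, ?_, ?_, ?_⟩
  · rw [hd, key, key]
    simp
  · rw [hd, key, key]
    congr 3
    funext i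
    by_cases h : d i = 0 <;> simp [h]
  · rw [hd, key, ht]
  · rw [hd, key, ht]

theorem exists_isMoorePenrose {ι κ : Type*} [Fintype ι] [Fintype κ] (A : Matrix ι κ ℝ) :
    ∃ P, IsMoorePenrose A P := by
  classical
  have hS : (A * Aᵀ).IsHermitian := by
    simpa [Matrix.conjTranspose_eq_transpose_of_trivial] using
      Matrix.isHermitian_mul_conjTranspose_self A
  obtain ⟨R, hR⟩ := exists_isMoorePenrose_of_isHermitian hS
  have gen : ∀ M : Matrix ι ι ℝ, Mᵀ = M → IsMoorePenrose M R → IsMoorePenrose M Rᵀ := by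
    intro M hM hR
    have hl : M * Rᵀ = R * M := by
      rw [← hR.symm_right, Matrix.transpose_mul, hM]
    have hr : Rᵀ * M = M * R := by
      rw [← hR.symm_left, Matrix.transpose_mul, hM]
    refine ⟨?_, ?_, ?_, ?_⟩
    · rw [Matrix.mul_assoc, hr, ← Matrix.mul_assoc]
      have h := congrArg Matrix.transpose hR.mul_mul_self
      rw [Matrix.transpose_mul, hR.symm_left, hM] at h
      rw [← Matrix.mul_assoc] at h
      exact h
    · have h := congrArg Matrix.transpose hR.mul_mul_inv
      rwa [Matrix.transpose_mul, Matrix.transpose_mul, hM, ← Matrix.mul_assoc] at h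
    · rw [hl, hR.symm_right]
    · rw [hr, hR.symm_left]
  have hRt : IsMoorePenrose (A * Aᵀ) Rᵀ := gen _ (by simp) hR
  have hsym : Rᵀ = R := hRt.unique hR
  have hfix : A * Aᵀ * R * A = A := by
    have h0 : (A * Aᵀ * R * A - A) * (A * Aᵀ * R * A - A)ᴴ = 0 := by
      rw [Matrix.conjTranspose_eq_transpose_of_trivial, Matrix.transpose_sub, Matrix.mul_sub,
        Matrix.sub_mul, Matrix.sub_mul]
      have e1 : A * Aᵀ * R * A * Aᵀ = A * Aᵀ := by
        have := hR.mul_mul_self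
        rwa [← Matrix.mul_assoc] at this
      have e2 : (A * Aᵀ * R * A)ᵀ = Aᵀ * (A * Aᵀ * R) := by
        rw [Matrix.transpose_mul, hR.symm_left]
      have e3 : A * Aᵀ * R * A * (Aᵀ * (A * Aᵀ * R)) = A * (Aᵀ * (A * Aᵀ * R)) := by
        rw [← Matrix.mul_assoc, e1, Matrix.mul_assoc A]
      rw [e2, e1, e3]
      simp
    have := Matrix.self_mul_conjTranspose_eq_zero.1 h0
    exact sub_eq_zero.1 this
  refine ⟨Aᵀ * R, ?_, ?_, ?_, ?_⟩
  · rw [← Matrix.mul_assoc]; exact hfix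
  · have := hR.mul_mul_inv
    calc Aᵀ * R * A * (Aᵀ * R) = Aᵀ * (R * (A * Aᵀ) * R) := by simp only [Matrix.mul_assoc]
      _ = _ := by rw [this]
  · rw [← Matrix.mul_assoc]; exact hR.symm_left
  · simp only [Matrix.transpose_mul, Matrix.transpose_transpose, hsym, Matrix.mul_assoc]

/-- The Moore–Penrose inverse `A†` of a real matrix. -/
def pinv {ι κ : Type*} [Fintype ι] [Fintype κ] (A : Matrix ι κ ℝ) : Matrix κ ι ℝ :=
  (exists_isMoorePenrose A).choose

theorem pinv_spec {ι κ : Type*} [Fintype ι] [Fintype κ] (A : Matrix ι κ ℝ) :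
    IsMoorePenrose A (pinv A) :=
  (exists_isMoorePenrose A).choose_spec

/-- `Π_A[B] = B Aᵀ (A Aᵀ)† A`, the orthogonal projection of the rows of `B` on the row span
of `A`. -/
def rowProj {ι κ ν : Type*} [Fintype ι] [Fintype ν]
    (A : Matrix ι ν ℝ) (B : Matrix κ ν ℝ) : Matrix κ ν ℝ :=
  B * Aᵀ * pinv (A * Aᵀ) * A

/-! ### The system in innovation form -/

/-- The matrices of `x(t+1) = A x(t) + B u(t) + K e(t)`, `y(t) = C x(t) + D u(t) + e(t)`. -/
structure InnovationModel (n m p : ℕ) where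
  A : Matrix (Fin n) (Fin n) ℝ
  B : Matrix (Fin n) (Fin m) ℝ
  C : Matrix (Fin p) (Fin n) ℝ
  D : Matrix (Fin p) (Fin m) ℝ
  K : Matrix (Fin n) (Fin p) ℝ

namespace InnovationModel

variable {n m p : ℕ} (S : InnovationModel n m p)

/-- The predictor matrix `A - K C`. -/
def predA : Matrix (Fin n) (Fin n) ℝ := S.A - S.K * S.C

/-- The extended observability matrix `Γ = [C; C A; …; C A^(T-1)]`. -/
def Gam (T : ℕ) : Matrix (Fin T × Fin p) (Fin n) ℝ :=
  Matrix.of fun r j => (S.C * S.A ^ (r.1 : ℕ)) r.2 j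

/-- The block Toeplitz matrix `H_d`: block `(k, l)` is `D` if `k = l`, `C A^(k-l-1) B` if `l < k`
and `0` if `k < l`. -/
def Hd (T : ℕ) : Matrix (Fin T × Fin p) (Fin T × Fin m) ℝ :=
  Matrix.of fun r c =>
    if r.1 = c.1 then S.D r.2 c.2
    else if c.1 < r.1 then
      (S.C * S.A ^ ((r.1 : ℕ) - (c.1 : ℕ) - 1) * S.B) r.2 c.2
    else 0

/-- `𝒞_u = [Φ_ρ ⋯ Φ_2 Φ_1]` with `Φ_k = (A - K C)^(k-1) (B - K D)`; block column `i = 0, …, ρ-1`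
is `Φ_(ρ-i)`. -/
def Cu (ρ : ℕ) : Matrix (Fin n) (Fin ρ × Fin m) ℝ :=
  Matrix.of fun i c => (S.predA ^ (ρ - (c.1 : ℕ) - 1) * (S.B - S.K * S.D)) i c.2

/-- `𝒞_y = [Ψ_ρ ⋯ Ψ_2 Ψ_1]` with `Ψ_k = (A - K C)^(k-1) K`. -/
def Cy (ρ : ℕ) : Matrix (Fin n) (Fin ρ × Fin p) ℝ :=
  Matrix.of fun i c => (S.predA ^ (ρ - (c.1 : ℕ) - 1) * S.K) i c.2

/-- `𝒞 = [𝒞_u 𝒞_y]`. -/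
def Cal (ρ : ℕ) : Matrix (Fin n) ((Fin ρ × Fin m) ⊕ (Fin ρ × Fin p)) ℝ :=
  Matrix.fromCols (S.Cu ρ) (S.Cy ρ)

end InnovationModel

/-- All complex eigenvalues of the real matrix `M` have modulus `< 1`. -/
def IsSchurStable {n : ℕ} (M : Matrix (Fin n) (Fin n) ℝ) : Prop :=
  ∀ z ∈ spectrum ℂ (M.map (algebraMap ℝ ℂ)), ‖z‖ < 1

/-! ### Data matrices, for one realization of the signals -/

/-- The block Hankel matrix `W_{[t₀, t₀+L-1], N}` with normalization `1 / √N`. -/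
def hankel {s : ℕ} (w : ℤ → Fin s → ℝ) (t₀ : ℤ) (L N : ℕ) : Matrix (Fin L × Fin s) (Fin N) ℝ :=
  Matrix.of fun r j => (1 / √(N : ℝ)) * w (t₀ + (r.1 : ℕ) + (j : ℕ)) r.2

/-- The block Hankel matrix `W_{t₀}` with a single block row. -/
def hankelRow {s : ℕ} (w : ℤ → Fin s → ℝ) (t₀ : ℤ) (N : ℕ) : Matrix (Fin s) (Fin N) ℝ :=
  Matrix.of fun i j => (1 / √(N : ℝ)) * w (t₀ + (j : ℕ)) i

section Data

variable {n m p : ℕ} (u : ℤ → Fin m → ℝ) (y : ℤ → Fin p → ℝ) (x : ℤ → Fin n → ℝ) (ρ T N : ℕ)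

/-- `Z_P = [U_P; Y_P]`. -/
def ZP : Matrix ((Fin ρ × Fin m) ⊕ (Fin ρ × Fin p)) (Fin N) ℝ :=
  Matrix.fromRows (hankel u 0 ρ N) (hankel y 0 ρ N)

/-- `U_F`. -/
def UF : Matrix (Fin T × Fin m) (Fin N) ℝ := hankel u ρ T N

/-- `Y_F`. -/
def YF : Matrix (Fin T × Fin p) (Fin N) ℝ := hankel y ρ T N

/-- `[Z_P; U_F]`. -/
def ZU : Matrix (((Fin ρ × Fin m) ⊕ (Fin ρ × Fin p)) ⊕ (Fin T × Fin m)) (Fin N) ℝ :=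
  Matrix.fromRows (ZP u y ρ N) (UF u ρ T N)

/-- `Ŷ_F = Π_{Z_P, U_F}(Y_F)`. -/
def YFhat : Matrix (Fin T × Fin p) (Fin N) ℝ := rowProj (ZU u y ρ T N) (YF y ρ T N)

/-- `X̂_ρ = Π_{Z_P, U_F}(X_ρ)`. -/
def Xhat : Matrix (Fin n) (Fin N) ℝ := rowProj (ZU u y ρ T N) (hankelRow x ρ N)

end Data

/-! ### The stochastic setting -/

section Stochastic

variable {Ω : Type*} [MeasurableSpace Ω] (μ : Measure Ω)

/-- Almost surely, the signals satisfy the system equations at all times `t ∈ ℤ`. -/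
def IsTrajectory {n m p : ℕ} (S : InnovationModel n m p) (u : ℤ → Ω → Fin m → ℝ)
    (x : ℤ → Ω → Fin n → ℝ) (e y : ℤ → Ω → Fin p → ℝ) : Prop :=
  ∀ᵐ ω ∂μ, ∀ t : ℤ,
    x (t + 1) ω = S.A *ᵥ x t ω + S.B *ᵥ u t ω + S.K *ᵥ e t ω ∧
    y t ω = S.C *ᵥ x t ω + S.D *ᵥ u t ω + e t ω

/-- A vector process whose second moments are bounded uniformly in `t ∈ ℤ`. -/
def IsL2Bounded {s : ℕ} (w : ℤ → Ω → Fin s → ℝ) : Prop :=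
  (∀ t, MemLp (w t) 2 μ) ∧ ∃ c : ℝ, ∀ t, ∫ ω, ‖w t ω‖ ^ 2 ∂μ ≤ c

/-- Wide-sense stationarity: finite second moments, constant mean, and covariances that depend on
the time lag only. -/
structure IsWideSenseStationary {s : ℕ} (w : ℤ → Ω → Fin s → ℝ) : Prop where
  memLp : ∀ t, MemLp (w t) 2 μ
  mean : ∀ t a, ∫ ω, w t ω a ∂μ = ∫ ω, w 0 ω a ∂μ
  cov : ∀ t k a b, cov[fun ω => w (t + k) ω a, fun ω => w t ω b; μ]
    = cov[fun ω => w k ω a, fun ω => w 0 ω b; μ]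

/-- The sample second moment `(1/N) ∑_{k < N} w_a(i + k) w_b(j + k)`. -/
def sampleMoment {s : ℕ} (w : ℤ → Ω → Fin s → ℝ) (i j : ℤ) (a b : Fin s) (N : ℕ) (ω : Ω) : ℝ :=
  (1 / (N : ℝ)) * ∑ k ∈ Finset.range N, w (i + (k : ℤ)) ω a * w (j + (k : ℤ)) ω b

/-- Second-order ergodicity: the sample second moments converge in probability to the
expectations. -/
def IsSecondOrderErgodic {s : ℕ} (w : ℤ → Ω → Fin s → ℝ) : Prop :=
  ∀ (i j : ℤ) (a b : Fin s),
    TendstoInMeasure μ (fun N ω => sampleMoment w i j a b N ω) atTop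
      (fun _ => ∫ ω, w i ω a * w j ω b ∂μ)

/-- Finite fourth moments, and sample second moments that converge in mean square at rate
`1 / √N`, uniformly in the times. -/
def HasRootRateMoments {s : ℕ} (w : ℤ → Ω → Fin s → ℝ) : Prop :=
  (∀ t, MemLp (w t) 4 μ) ∧
  ∃ c : ℝ, ∀ (i j : ℤ) (a b : Fin s) (N : ℕ), 1 ≤ N →
    ∫ ω, (sampleMoment w i j a b N ω - ∫ ω', w i ω' a * w j ω' b ∂μ) ^ 2 ∂μ ≤ c / N

/-- `f` is the spectral density matrix of `w` on `(-π, π]`: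
`Cov(w(t + k), w(t)) = (1 / 2π) ∫ exp(i k θ) f(θ) dθ`. -/
structure HasSpectralDensity {s : ℕ} (w : ℤ → Ω → Fin s → ℝ)
    (f : ℝ → Matrix (Fin s) (Fin s) ℂ) : Prop where
  integrable : ∀ a b, IntegrableOn (fun θ => f θ a b) (Set.Ioc (-Real.pi) Real.pi)
  posSemidef : ∀ᵐ θ ∂(volume.restrict (Set.Ioc (-Real.pi) Real.pi)), (f θ).PosSemidef
  cov : ∀ (t k : ℤ) (a b : Fin s),
    ((cov[fun ω => w (t + k) ω a, fun ω => w t ω b; μ] : ℝ) : ℂ)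
      = (1 / (2 * (Real.pi : ℂ))) *
        ∫ θ in Set.Ioc (-Real.pi) Real.pi, Complex.exp (Complex.I * (k : ℂ) * (θ : ℂ)) * f θ a b

/-- `w` has a (full rank) spectral density which is bounded away from zero and bounded. -/
def HasBoundedFullRankSpectrum {s : ℕ} (w : ℤ → Ω → Fin s → ℝ) : Prop :=
  ∃ f : ℝ → Matrix (Fin s) (Fin s) ℂ, HasSpectralDensity μ w f ∧ ∃ c C : ℝ, 0 < c ∧
    ∀ᵐ θ ∂(volume.restrict (Set.Ioc (-Real.pi) Real.pi)),
      (f θ - (c : ℂ) • (1 : Matrix (Fin s) (Fin s) ℂ)).PosSemidef ∧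
      ((C : ℂ) • (1 : Matrix (Fin s) (Fin s) ℂ) - f θ).PosSemidef

/-- The σ-algebra generated by the whole input process and the innovations before time `t`. -/
abbrev innovPast {m p : ℕ} (u : ℤ → Ω → Fin m → ℝ) (e : ℤ → Ω → Fin p → ℝ) (t : ℤ) :
    MeasurableSpace Ω :=
  (⨆ s : ℤ, MeasurableSpace.comap (u s) inferInstance) ⊔
    ⨆ s : {s : ℤ // s < t}, MeasurableSpace.comap (e s) inferInstance

/-- `e` is a stationary innovation process with variance `Λ`, for data collected in open loop:
conditionally on the input process and on the past innovations, `e(t)` has mean zero and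
variance `Λ`. -/
structure IsInnovation {m p : ℕ} (u : ℤ → Ω → Fin m → ℝ) (e : ℤ → Ω → Fin p → ℝ)
    (Λ : Matrix (Fin p) (Fin p) ℝ) : Prop where
  measurable_input : ∀ t, Measurable (u t)
  measurable : ∀ t, Measurable (e t)
  identDistrib : ∀ t, IdentDistrib (e t) (e 0) μ μ
  memLp : MemLp (e 0) 2 μ
  condMean : ∀ t a, μ[fun ω => e t ω a | innovPast u e t] =ᵐ[μ] fun _ => 0
  condVar : ∀ t a b,
    μ[fun ω => e t ω a * e t ω b | innovPast u e t] =ᵐ[μ] fun _ => Λ a b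

end Stochastic

/-! ### The two relations -/

section Relations

variable {Ω : Type*} [MeasurableSpace Ω] (μ : Measure Ω) {n m p : ℕ} (S : InnovationModel n m p)
  (u : ℤ → Ω → Fin m → ℝ) (x : ℤ → Ω → Fin n → ℝ) (y : ℤ → Ω → Fin p → ℝ) (T : ℕ)
  (ρ : ℕ → Ω → ℕ) (α : (N : ℕ) → Ω → Fin N → ℝ)

/-- `x̂ᵈ(t) = X̂_ρ α`. -/
def xdHat (N : ℕ) (ω : Ω) : Fin n → ℝ :=
  Xhat (fun t => u t ω) (fun t => y t ω) (fun t => x t ω) (ρ N ω) T N *ᵥ α N ω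

/-- `z_init = Z_P α`. -/
def zInit (N : ℕ) (ω : Ω) : (Fin (ρ N ω) × Fin m) ⊕ (Fin (ρ N ω) × Fin p) → ℝ :=
  ZP (fun t => u t ω) (fun t => y t ω) (ρ N ω) N *ᵥ α N ω

/-- `u_f = U_F α`. -/
def uf (N : ℕ) (ω : Ω) : Fin T × Fin m → ℝ :=
  UF (fun t => u t ω) (ρ N ω) T N *ᵥ α N ω

/-- `ŷᵈ_f = Ŷ_F α`. -/
def yfHat (N : ℕ) (ω : Ω) : Fin T × Fin p → ℝ :=
  YFhat (fun t => u t ω) (fun t => y t ω) (ρ N ω) T N *ᵥ α N ω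

/-- `Ŷ_F α = Γ x̂ᵈ(t) + H_d u_f + O_P(1/√N)`. -/
def OutputRelation : Prop :=
  IsBigOP μ (fun N ω => euclNorm (yfHat u y T ρ α N ω
    - (S.Gam T *ᵥ xdHat u x y T ρ α N ω + S.Hd T *ᵥ uf u T ρ α N ω))) rootRate

/-- `x̂ᵈ(t) = 𝒞 z_init + o_P(1/√N)`. -/
def StateRelation : Prop :=
  IsLittleOP μ (fun N ω => euclNorm (xdHat u x y T ρ α N ω
    - S.Cal (ρ N ω) *ᵥ zInit u y ρ α N ω)) rootRate

/-- `Ŷ_F α = Γ 𝒞 z_init + H_d u_f + O_P(1/√N)`. -/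
def OutputDataRelation : Prop :=
  IsBigOP μ (fun N ω => euclNorm (yfHat u y T ρ α N ω
    - (S.Gam T *ᵥ (S.Cal (ρ N ω) *ᵥ zInit u y ρ α N ω) + S.Hd T *ᵥ uf u T ρ α N ω))) rootRate

/-- The past horizon is long enough: `‖(A - K C)^ρ‖ = o_P(1/√N)`. -/
def LongHorizon : Prop :=
  IsLittleOP μ (fun N ω => opNorm (S.predA ^ ρ N ω)) rootRate

end Relations

end DDPC

end

open DDPC

/-!
Let `Z = [Z_P; U_F]`, let `P` be the orthogonal projector on the row span of `Z`, and let `E` be the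
Hankel matrix of the future innovations. Unrolling the state equation over the future horizon gives
`Ŷ_F α - Γ x̂ᵈ - H_d u_f = H_s E P α` with a fixed Toeplitz matrix `H_s` (`output_error_eq`).
Unrolling its predictor form `x(t+1) = (A - K C) x(t) + (B - K D) u(t) + K y(t)` over the past
horizon gives `x̂ᵈ - 𝒞 z_init = (A - K C)^ρ X_0 P α` (`state_error_eq`). Since `X_0` is bounded in
probability, the state relation follows as soon as `‖P α‖ = O_P(1)`; for `‖α‖ = O_P(1)` this holds
because `P` is a contraction. The output relation asks for `w ⬝ P α = O_P(1/√N)` for every row `w`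
of `E`.

*Orthogonality.* The entries of `Z w` are averages of products of an innovation with a variable
that is measurable with respect to the inputs and the earlier innovations. They are sums of
martingale differences, hence `O(1/√N)` in mean square (`eLpNorm_dotProduct_ZU_hankel_le`). As
`P w = Zᵀ c` with `Z Zᵀ c = Z w`, the vector `P w` is as small as `Z w`, up to the conditioning of
the sample moment matrix `Z Zᵀ`, which is compared with its expectation `S` (`rowMoment`).

*Fixed past horizon.* The law of large numbers gives `Z Zᵀ → S` in probability
(`isLittleOP_frob_gram_sub`). The matrix `S` may be singular, but a combination of rows of
expected square zero vanishes almost surely in every data matrix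
(`ae_rowMoment_mul_pinv_mul_ZU`), so only the range of `S` matters.

*Growing past horizon.* The smallest eigenvalue of `S` is bounded below by some `κ > 0`, uniformly
in the horizon (`exists_le_quadraticForm_rowMoment`). Indeed, a linear functional of the inputs and
outputs becomes, by a backward costate recursion driven by `(A - K C)ᵀ`, a functional of the inputs
and innovations; stability of `A - K C` makes the original weights `ℓ²`-bounded by the new ones
(`exists_sum_weights_le`), and the spectral density bound and `Λ > 0` bound the variance of the new
functional below. With `q = E[Z a] + v` and `S h = q`, the vector `h` is bounded uniformly in the
horizon (`exists_coeff_of_meanData`), and `w ⬝ P α` differs from `h ⬝ Z w = O_P(1/√N)` by products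
of `‖Z w‖ ~ √(d/N)` with `‖Z Zᵀ - S‖ ~ d/√N` or `‖Z a - E[Z a]‖ ~ √(d/N)`, where `d` is the number
of rows (`abs_dotProduct_rowProjector_le`). These products are `O_P(d^(3/2)/N) = O_P(1/√N)` because
`ρ³ = O(N)`.

*Moments of filtered signals.* States and outputs are mean square limits of finite combinations of
shifted inputs and innovations, with `ℓ¹` coefficients bounded by a constant, the gain
(`IsFiltered`). Stationarity, convergence of sample moments and variance bounds are proved for the
inputs and innovations and passed on to all filtered signals by linearity.
-/



namespace DDPC

/-! ### Euclidean norms, Frobenius norms and the orthogonal projector on a row span -/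

section LinearAlgebra

variable {ι κ ν : Type*} [Fintype ι] [Fintype κ] [Fintype ν]

theorem euclNorm_nonneg (v : ι → ℝ) : 0 ≤ euclNorm v := norm_nonneg _

theorem euclNorm_eq_sqrt (v : ι → ℝ) : euclNorm v = √(∑ i, v i ^ 2) := by
  rw [euclNorm, EuclideanSpace.norm_eq]
  simp

theorem euclNorm_sq (v : ι → ℝ) : euclNorm v ^ 2 = ∑ i, v i ^ 2 := by
  rw [euclNorm_eq_sqrt, Real.sq_sqrt (Finset.sum_nonneg fun i _ => sq_nonneg _)]

theorem euclNorm_sq_eq_dotProduct (v : ι → ℝ) : euclNorm v ^ 2 = v ⬝ᵥ v := by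
  rw [euclNorm_sq, dotProduct]
  simp [sq]

theorem euclNorm_add_le (v w : ι → ℝ) : euclNorm (v + w) ≤ euclNorm v + euclNorm w := by
  simpa [euclNorm] using norm_add_le (WithLp.toLp 2 v) (WithLp.toLp 2 w)

theorem euclNorm_neg (v : ι → ℝ) : euclNorm (-v) = euclNorm v := by
  simp [euclNorm]

theorem abs_dotProduct_le (v w : ι → ℝ) : |v ⬝ᵥ w| ≤ euclNorm v * euclNorm w := by
  refine abs_le_of_sq_le_sq ?_ (mul_nonneg (euclNorm_nonneg v) (euclNorm_nonneg w))
  rw [mul_pow, euclNorm_sq, euclNorm_sq]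
  exact Finset.sum_mul_sq_le_sq_mul_sq _ _ _

theorem abs_le_euclNorm (v : ι → ℝ) (i : ι) : |v i| ≤ euclNorm v := by
  refine abs_le_of_sq_le_sq ?_ (euclNorm_nonneg v)
  rw [euclNorm_sq]
  exact Finset.single_le_sum (f := fun i => v i ^ 2) (fun i _ => sq_nonneg _) (Finset.mem_univ i)

theorem euclNorm_le_sum_abs (v : ι → ℝ) : euclNorm v ≤ ∑ i, |v i| := by
  rw [euclNorm_eq_sqrt]
  apply Real.sqrt_le_iff.2 ⟨Finset.sum_nonneg fun i _ => abs_nonneg _, ?_⟩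
  simpa using Finset.sum_sq_le_sq_sum_of_nonneg (s := Finset.univ) (f := fun i => |v i|)
    (fun i _ => abs_nonneg _)

/-- The Frobenius norm of a real matrix. -/
noncomputable def frob (M : Matrix ι κ ℝ) : ℝ := euclNorm fun q : ι × κ => M q.1 q.2

theorem frob_nonneg (M : Matrix ι κ ℝ) : 0 ≤ frob M := euclNorm_nonneg _

theorem euclNorm_mulVec_le (M : Matrix ι κ ℝ) (v : κ → ℝ) :
    euclNorm (M *ᵥ v) ≤ frob M * euclNorm v := by
  refine le_of_sq_le_sq ?_ (mul_nonneg (frob_nonneg M) (euclNorm_nonneg v))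
  rw [mul_pow, frob, euclNorm_sq, euclNorm_sq, euclNorm_sq, Fintype.sum_prod_type, Finset.sum_mul]
  exact Finset.sum_le_sum fun i _ => Finset.sum_mul_sq_le_sq_mul_sq _ _ _

theorem euclNorm_mulVec_le_opNorm [DecidableEq ι] (M : Matrix ι ι ℝ) (v : ι → ℝ) :
    euclNorm (M *ᵥ v) ≤ opNorm M * euclNorm v := by
  have := (Matrix.toEuclideanCLM (n := ι) (𝕜 := ℝ) M).le_opNorm (WithLp.toLp 2 v)
  simpa [euclNorm, opNorm, Matrix.toEuclideanCLM_toLp] using this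

/-- The orthogonal projector on the row span of `A`, acting on column vectors. -/
noncomputable def rowProjector (A : Matrix ι ν ℝ) : Matrix ν ν ℝ := Aᵀ * pinv (A * Aᵀ) * A

theorem rowProj_eq {κ' : Type*} (A : Matrix ι ν ℝ) (B : Matrix κ' ν ℝ) :
    rowProj A B = B * rowProjector A := by
  simp only [rowProj, rowProjector, Matrix.mul_assoc]

theorem pinv_transpose_of_symm {S : Matrix ι ι ℝ} (hS : Sᵀ = S) : (pinv S)ᵀ = pinv S := by
  have h := pinv_spec S
  have hl : S * (pinv S)ᵀ = pinv S * S := by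
    rw [← h.symm_right, Matrix.transpose_mul, hS]
  have hr : (pinv S)ᵀ * S = S * pinv S := by
    rw [← h.symm_left, Matrix.transpose_mul, hS]
  refine IsMoorePenrose.unique (A := S) ⟨?_, ?_, ?_, ?_⟩ h
  · rw [Matrix.mul_assoc, hr, ← Matrix.mul_assoc]
    have h' := congrArg Matrix.transpose h.mul_mul_self
    rw [Matrix.transpose_mul, h.symm_left, hS] at h'
    rwa [← Matrix.mul_assoc] at h'
  · have h' := congrArg Matrix.transpose h.mul_mul_inv
    rwa [Matrix.transpose_mul, Matrix.transpose_mul, hS, ← Matrix.mul_assoc] at h'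
  · rw [hl, h.symm_right]
  · rw [hr, h.symm_left]

theorem mul_rowProjector (A : Matrix ι ν ℝ) : A * rowProjector A = A := by
  have h := pinv_spec (A * Aᵀ)
  have h0 : (A * Aᵀ * pinv (A * Aᵀ) * A - A) * (A * Aᵀ * pinv (A * Aᵀ) * A - A)ᴴ = 0 := by
    have e1 : (A * Aᵀ * pinv (A * Aᵀ) * A - A) * Aᵀ = 0 := by
      rw [Matrix.sub_mul, sub_eq_zero]
      simpa only [Matrix.mul_assoc] using h.mul_mul_self
    have e2 : (A * Aᵀ * pinv (A * Aᵀ) * A - A)ᴴ = Aᵀ * (A * Aᵀ * pinv (A * Aᵀ)) - Aᵀ := by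
      rw [Matrix.conjTranspose_eq_transpose_of_trivial, Matrix.transpose_sub,
        Matrix.transpose_mul, h.symm_left]
    rw [e2, Matrix.mul_sub, ← Matrix.mul_assoc, e1]
    simp
  have := sub_eq_zero.1 (Matrix.self_mul_conjTranspose_eq_zero.1 h0)
  rw [rowProjector]
  simpa only [Matrix.mul_assoc] using this

theorem rowProjector_transpose (A : Matrix ι ν ℝ) : (rowProjector A)ᵀ = rowProjector A := by
  simp [rowProjector, Matrix.transpose_mul, pinv_transpose_of_symm, Matrix.mul_assoc]

theorem rowProjector_mul_self (A : Matrix ι ν ℝ) :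
    rowProjector A * rowProjector A = rowProjector A := by
  have h : rowProjector A = Aᵀ * pinv (A * Aᵀ) * A := rfl
  conv_lhs => lhs; rw [h]
  rw [Matrix.mul_assoc, mul_rowProjector, h]

theorem mulVec_rowProjector_mulVec (A : Matrix ι ν ℝ) (w : ν → ℝ) :
    A *ᵥ (rowProjector A *ᵥ w) = A *ᵥ w := by
  rw [Matrix.mulVec_mulVec, mul_rowProjector]

theorem euclNorm_rowProjector_sq (A : Matrix ι ν ℝ) (w : ν → ℝ) :
    euclNorm (rowProjector A *ᵥ w) ^ 2 = w ⬝ᵥ rowProjector A *ᵥ w := by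
  rw [euclNorm_sq_eq_dotProduct, Matrix.dotProduct_mulVec, ← Matrix.mulVec_transpose,
    rowProjector_transpose, Matrix.mulVec_mulVec, rowProjector_mul_self, dotProduct_comm]

theorem euclNorm_rowProjector_le (A : Matrix ι ν ℝ) (w : ν → ℝ) :
    euclNorm (rowProjector A *ᵥ w) ≤ euclNorm w := by
  have h1 := euclNorm_rowProjector_sq A w
  have h2 := (le_abs_self _).trans (abs_dotProduct_le w (rowProjector A *ᵥ w))
  rw [← h1, sq] at h2
  rcases (euclNorm_nonneg (rowProjector A *ᵥ w)).eq_or_lt with h | h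
  · rw [← h]; exact euclNorm_nonneg w
  · exact le_of_mul_le_mul_right h2 h

theorem dotProduct_rowProjector (A : Matrix ι ν ℝ) (v w : ν → ℝ) :
    v ⬝ᵥ rowProjector A *ᵥ w = (rowProjector A *ᵥ v) ⬝ᵥ w := by
  rw [Matrix.dotProduct_mulVec, ← Matrix.mulVec_transpose, rowProjector_transpose]

/-- The projection of `w` on the row span of `A` is `Aᵀ c` for a solution `c` of the normal
equations. -/
theorem exists_rowProjector_coeff (A : Matrix ι ν ℝ) (w : ν → ℝ) :
    ∃ c : ι → ℝ, Aᵀ *ᵥ c = rowProjector A *ᵥ w := by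
  refine ⟨pinv (A * Aᵀ) *ᵥ (A *ᵥ w), ?_⟩
  simp [rowProjector, Matrix.mulVec_mulVec, Matrix.mul_assoc]

theorem transpose_mulVec_dotProduct (A : Matrix ι ν ℝ) (c : ι → ℝ) (w : ν → ℝ) :
    (Aᵀ *ᵥ c) ⬝ᵥ w = c ⬝ᵥ A *ᵥ w := by
  rw [Matrix.mulVec_transpose, Matrix.dotProduct_mulVec]

/-- If `S` is bounded below by `1 / r` at `c`, then so is, up to a factor `2`, every matrix `G`
that is close to `S`. -/
theorem euclNorm_le_of_close {S G : Matrix ι ι ℝ} {r : ℝ} (hr : 0 ≤ r) {c : ι → ℝ}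
    (hc : euclNorm c ≤ r * euclNorm (S *ᵥ c)) (hG : r * frob (G - S) ≤ 1 / 2) :
    euclNorm c ≤ 2 * r * euclNorm (G *ᵥ c) := by
  have h1 : S *ᵥ c = G *ᵥ c + -((G - S) *ᵥ c) := by
    rw [Matrix.sub_mulVec]; abel
  have h2 := euclNorm_add_le (G *ᵥ c) (-((G - S) *ᵥ c))
  rw [← h1, euclNorm_neg] at h2
  have h3 := euclNorm_mulVec_le (G - S) c
  have h4 := euclNorm_nonneg c
  have h5 : r * euclNorm (S *ᵥ c) ≤ r * euclNorm (G *ᵥ c) + r * frob (G - S) * euclNorm c := by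
    have := mul_le_mul_of_nonneg_left (h2.trans (add_le_add_right h3 _)) hr
    linarith
  nlinarith [mul_le_mul_of_nonneg_right hG h4]

/-- The coefficients of the projection solve the normal equations. -/
theorem gram_mulVec_of_coeff {A : Matrix ι ν ℝ} {w : ν → ℝ} {c : ι → ℝ}
    (hc : Aᵀ *ᵥ c = rowProjector A *ᵥ w) : (A * Aᵀ) *ᵥ c = A *ᵥ w := by
  rw [← Matrix.mulVec_mulVec, hc, mulVec_rowProjector_mulVec]

/-- The projection of `w` on the row span of `Z` is small if `Z w` is small and `Z Zᵀ` is close to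
a matrix `S` which is bounded below on a space that carries the columns of `Z`. -/
theorem euclNorm_rowProjector_sq_le {Z : Matrix ι ν ℝ} {S Q : Matrix ι ι ℝ} {r : ℝ} (hr : 0 ≤ r)
    (hQ : ∀ c, euclNorm (Qᵀ *ᵥ c) ≤ r * euclNorm (S *ᵥ (Qᵀ *ᵥ c))) (hQZ : Q * Z = Z)
    (hG : r * frob (Z * Zᵀ - S) ≤ 1 / 2) (w : ν → ℝ) :
    euclNorm (rowProjector Z *ᵥ w) ^ 2 ≤ 2 * r * euclNorm (Z *ᵥ w) ^ 2 := by
  obtain ⟨c', hc'⟩ := exists_rowProjector_coeff Z w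
  obtain ⟨c, hcdef⟩ : ∃ c, c = Qᵀ *ᵥ c' := ⟨_, rfl⟩
  have hc : Zᵀ *ᵥ c = rowProjector Z *ᵥ w := by
    rw [hcdef, Matrix.mulVec_mulVec, ← Matrix.transpose_mul, hQZ, hc']
  have h1 : euclNorm c ≤ 2 * r * euclNorm (Z *ᵥ w) := by
    rw [← gram_mulVec_of_coeff hc]
    refine euclNorm_le_of_close hr ?_ hG
    rw [hcdef]; exact hQ c'
  rw [euclNorm_rowProjector_sq, dotProduct_comm, ← hc, transpose_mulVec_dotProduct]
  have h2 := (le_abs_self _).trans (abs_dotProduct_le c (Z *ᵥ w))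
  nlinarith [euclNorm_nonneg (Z *ᵥ w)]

/-- The first order term `(Z w) ⬝ h` depends on `α` only through the target `q` of `Z α`; the error
terms are products of two small quantities if `Z w`, `Z Zᵀ - S` and `Z α - q` are small. -/
theorem abs_dotProduct_rowProjector_le {Z : Matrix ι ν ℝ} {S : Matrix ι ι ℝ} {r : ℝ} (hr : 0 ≤ r)
    (hS : ∀ c, euclNorm c ≤ r * euclNorm (S *ᵥ c))
    (hG : r * frob (Z * Zᵀ - S) ≤ 1 / 2) (w α : ν → ℝ) {h q : ι → ℝ} (hq : S *ᵥ h = q) :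
    |w ⬝ᵥ rowProjector Z *ᵥ α| ≤ |(Z *ᵥ w) ⬝ᵥ h|
      + 2 * r * euclNorm (Z *ᵥ w) * (frob (Z * Zᵀ - S) * euclNorm h)
      + 2 * r * euclNorm (Z *ᵥ w) * euclNorm (Z *ᵥ α - q) := by
  obtain ⟨c, hc⟩ := exists_rowProjector_coeff Z w
  have h1 : euclNorm c ≤ 2 * r * euclNorm (Z *ᵥ w) := by
    rw [← gram_mulVec_of_coeff hc]
    exact euclNorm_le_of_close hr (hS c) hG
  have h2 : w ⬝ᵥ rowProjector Z *ᵥ α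
      = (Z *ᵥ w) ⬝ᵥ h + -(c ⬝ᵥ ((Z * Zᵀ - S) *ᵥ h)) + c ⬝ᵥ (Z *ᵥ α - q) := by
    have e1 : w ⬝ᵥ rowProjector Z *ᵥ α = c ⬝ᵥ Z *ᵥ α := by
      rw [dotProduct_rowProjector, ← hc, transpose_mulVec_dotProduct]
    have e2 : (Z *ᵥ w) ⬝ᵥ h = c ⬝ᵥ (Z * Zᵀ) *ᵥ h := by
      rw [← gram_mulVec_of_coeff hc, Matrix.dotProduct_mulVec, ← Matrix.mulVec_transpose]
      simp
    rw [e1, e2, Matrix.sub_mulVec, dotProduct_sub, dotProduct_sub, hq]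
    ring
  rw [h2]
  refine (abs_add_le _ _).trans (add_le_add ((abs_add_le _ _).trans (add_le_add le_rfl ?_)) ?_)
  · rw [abs_neg]
    refine (abs_dotProduct_le _ _).trans ?_
    exact mul_le_mul h1 (euclNorm_mulVec_le _ _) (euclNorm_nonneg _)
      ((euclNorm_nonneg c).trans h1)
  · refine (abs_dotProduct_le _ _).trans ?_
    exact mul_le_mul_of_nonneg_right h1 (euclNorm_nonneg _)

theorem euclNorm_rowProjector_le_of_mulVec_eq {Z : Matrix ι ν ℝ} {S : Matrix ι ι ℝ} {r : ℝ}
    (hr : 0 ≤ r) (hS : ∀ c, euclNorm c ≤ r * euclNorm (S *ᵥ c))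
    (hG : r * frob (Z * Zᵀ - S) ≤ 1 / 2) {α a : ν → ℝ} {v : ι → ℝ} (hα : Z *ᵥ α = Z *ᵥ a + v) :
    euclNorm (rowProjector Z *ᵥ α) ≤ euclNorm a + √(2 * r) * euclNorm v := by
  classical
  have h1 : rowProjector Z *ᵥ α = rowProjector Z *ᵥ a + rowProjector Z *ᵥ (α - a) := by
    rw [Matrix.mulVec_sub]; abel
  have h2 : Z *ᵥ (α - a) = v := by rw [Matrix.mulVec_sub, hα]; abel
  rw [h1]
  refine (euclNorm_add_le _ _).trans (add_le_add (euclNorm_rowProjector_le _ _) ?_)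
  have h3 := euclNorm_rowProjector_sq_le (Q := 1) hr (by simpa using hS) (by simp) hG (α - a)
  rw [h2] at h3
  refine le_of_sq_le_sq ?_ (mul_nonneg (Real.sqrt_nonneg _) (euclNorm_nonneg v))
  rw [mul_pow, Real.sq_sqrt (by positivity)]
  exact h3

/-- A symmetric matrix is bounded below on its range, with the constant given by its
Moore–Penrose inverse. -/
theorem euclNorm_le_of_mem_range {S : Matrix ι ι ℝ} (hS : Sᵀ = S) (c : ι → ℝ) :
    euclNorm ((S * pinv S)ᵀ *ᵥ c)
      ≤ frob (pinv S) * euclNorm (S *ᵥ ((S * pinv S)ᵀ *ᵥ c)) := by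
  have h := pinv_spec S
  have e : (S * pinv S)ᵀ = pinv S * S := by
    rw [Matrix.transpose_mul, hS, pinv_transpose_of_symm hS]
  have e2 : (S * pinv S)ᵀ *ᵥ c = pinv S *ᵥ (S *ᵥ ((S * pinv S)ᵀ *ᵥ c)) := by
    rw [e]
    simp only [Matrix.mulVec_mulVec]
    congr 1
    rw [← Matrix.mul_assoc S, h.mul_mul_self]
  conv_lhs => rw [e2]
  exact euclNorm_mulVec_le _ _

end LinearAlgebra

/-! ### Powers of stable matrices and linear recursions -/

section Stability

attribute [local instance] Matrix.linftyOpNormedRing Matrix.linftyOpNormedAlgebra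
  Matrix.linftyOpNormedAddCommGroup

theorem norm_entry_le_linftyOp {n : ℕ} (M : Matrix (Fin n) (Fin n) ℂ) (i j : Fin n) :
    ‖M i j‖ ≤ ‖M‖ := by
  rw [Matrix.linfty_opNorm_def, ← coe_nnnorm, NNReal.coe_le_coe]
  exact (Finset.single_le_sum (f := fun j => ‖M i j‖₊) (fun _ _ => zero_le)
    (Finset.mem_univ j)).trans
    (Finset.le_sup (f := fun i => ∑ j, ‖M i j‖₊) (Finset.mem_univ i))

/-- The powers of a stable matrix decay geometrically (Gelfand's formula). -/
theorem IsSchurStable.exists_pow_le {n : ℕ} {F : Matrix (Fin n) (Fin n) ℝ} (hF : IsSchurStable F) :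
    ∃ c r : ℝ, 0 < c ∧ 0 < r ∧ r < 1 ∧ ∀ (k : ℕ) (i j : Fin n), |(F ^ k) i j| ≤ c * r ^ k := by
  rcases Nat.eq_zero_or_pos n with rfl | hn
  · exact ⟨1, 1 / 2, by norm_num, by norm_num, by norm_num, fun k i => i.elim0⟩
  have : Nonempty (Fin n) := ⟨⟨0, hn⟩⟩
  obtain ⟨G, hG⟩ : ∃ G, G = F.map (algebraMap ℝ ℂ) := ⟨_, rfl⟩
  have h1 : spectralRadius ℂ G < ((1 : NNReal) : ENNReal) := by
    apply spectrum.spectralRadius_lt_of_forall_lt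
    intro z hz
    rw [hG] at hz
    have := hF z hz
    exact_mod_cast this
  obtain ⟨q, hq1, hq2⟩ := ENNReal.lt_iff_exists_nnreal_btwn.1 h1
  have h2 := spectrum.pow_nnnorm_pow_one_div_tendsto_nhds_spectralRadius G
  have h3 : ∀ᶠ k : ℕ in atTop, ‖G ^ k‖ ≤ (q : ℝ) ^ k := by
    filter_upwards [h2.eventually_lt_const hq1, eventually_gt_atTop 0] with k hk hk0
    have hk' : (k : ℝ) ≠ 0 := by positivity
    have h4 : ((‖G ^ k‖₊ : ENNReal) ^ (1 / (k : ℝ))) ^ (k : ℝ) ≤ (q : ENNReal) ^ (k : ℝ) :=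
      ENNReal.rpow_le_rpow hk.le (by positivity)
    rw [← ENNReal.rpow_mul, one_div_mul_cancel hk', ENNReal.rpow_one, ENNReal.rpow_natCast] at h4
    exact_mod_cast h4
  obtain ⟨k0, hk0⟩ := eventually_atTop.1 h3
  have hq3 : (q : ℝ) < 1 := by exact_mod_cast hq2
  obtain ⟨r, hr1, hr2⟩ := exists_between hq3
  have hr0 : 0 < r := lt_of_le_of_lt q.2 hr1
  obtain ⟨c, hc⟩ : ∃ c, c = 1 + ∑ k ∈ Finset.range k0, ‖G ^ k‖ / r ^ k := ⟨_, rfl⟩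
  have hs : 0 ≤ ∑ k ∈ Finset.range k0, ‖G ^ k‖ / r ^ k :=
    Finset.sum_nonneg fun k _ => by positivity
  refine ⟨c, r, by linarith, hr0, hr2, fun k i j => ?_⟩
  have h5 : |(F ^ k) i j| ≤ ‖G ^ k‖ := by
    have : (G ^ k) i j = (((F ^ k) i j : ℝ) : ℂ) := by
      have : G ^ k = (F ^ k).map (algebraMap ℝ ℂ) := by
        rw [hG]
        exact (map_pow (RingHom.mapMatrix (algebraMap ℝ ℂ)) F k).symm
      rw [this]; rfl
    have h6 := norm_entry_le_linftyOp (G ^ k) i j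
    rwa [this, Complex.norm_real, Real.norm_eq_abs] at h6
  refine h5.trans ?_
  rcases lt_or_ge k k0 with hk | hk
  · have h7 := Finset.single_le_sum (f := fun k => ‖G ^ k‖ / r ^ k) (s := Finset.range k0)
      (fun k _ => by positivity) (Finset.mem_range.2 hk)
    rw [← div_le_iff₀ (by positivity)]
    exact h7.trans (by linarith)
  · calc ‖G ^ k‖ ≤ (q : ℝ) ^ k := hk0 k hk
      _ ≤ r ^ k := pow_le_pow_left₀ q.2 hr1.le k
      _ ≤ c * r ^ k := by nlinarith [pow_pos hr0 k]

end Stability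

/-- The solution of `x(t + 1) = F x(t) + g(t)`. -/
theorem linear_recursion_eq {n : ℕ} (F : Matrix (Fin n) (Fin n) ℝ) (x g : ℤ → Fin n → ℝ)
    (h : ∀ t, x (t + 1) = F *ᵥ x t + g t) (t : ℤ) (k : ℕ) :
    x (t + k) = F ^ k *ᵥ x t + ∑ l ∈ Finset.range k, F ^ (k - l - 1) *ᵥ g (t + l) := by
  induction k with
  | zero => simp
  | succ k ih =>
    have h1 : x (t + ((k + 1 : ℕ) : ℤ)) = F *ᵥ x (t + k) + g (t + k) := by
      rw [← h]; push_cast; ring_nf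
    rw [h1, ih, Matrix.mulVec_add, Matrix.mulVec_mulVec, ← pow_succ', Finset.sum_range_succ,
      add_assoc]
    have h2 : F *ᵥ ∑ l ∈ Finset.range k, F ^ (k - l - 1) *ᵥ g (t + l)
        = ∑ l ∈ Finset.range k, F ^ (k + 1 - l - 1) *ᵥ g (t + l) := by
      rw [Matrix.mulVec_sum]
      refine Finset.sum_congr rfl fun l hl => ?_
      rw [Matrix.mulVec_mulVec, ← pow_succ']
      have := Finset.mem_range.1 hl
      congr 2
      omega
    rw [h2]
    simp

/-! ### Calculus of stochastic orders -/

section StochasticOrders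

variable {Ω : Type*} [MeasurableSpace Ω] {μ : Measure Ω}

/-- Domination outside events of vanishing probability. -/
theorem IsBigOP.mono_off {X Y : ℕ → Ω → ℝ} {r : ℕ → ℝ} (hX : IsBigOP μ X r) (A : ℕ → Set Ω)
    (hA : Tendsto (fun N => μ (A N)) atTop (𝓝 0))
    (h : ∀ᶠ N in atTop, ∀ ω, ω ∉ A N → |Y N ω| ≤ |X N ω|) : IsBigOP μ Y r := by
  intro ε hε
  obtain ⟨c, M, hM⟩ := hX (ε / 2) (half_pos hε)
  have hA' : ∀ᶠ N in atTop, μ (A N) ≤ ENNReal.ofReal (ε / 2) :=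
    hA.eventually_le_const (ENNReal.ofReal_pos.2 (half_pos hε))
  obtain ⟨M', hM'⟩ := eventually_atTop.1 (h.and hA')
  refine ⟨c, max M M', fun N hN => ?_⟩
  obtain ⟨h1, h2⟩ := hM' N (le_of_max_le_right hN)
  have h3 := hM N (le_of_max_le_left hN)
  calc μ {ω | c * |r N| < |Y N ω|} ≤ μ ({ω | c * |r N| < |X N ω|} ∪ A N) := by
        refine measure_mono fun ω hω => ?_
        by_cases hA : ω ∈ A N
        · exact Or.inr hA
        · exact Or.inl (lt_of_lt_of_le hω (h1 ω hA))
    _ ≤ μ {ω | c * |r N| < |X N ω|} + μ (A N) := measure_union_le _ _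
    _ ≤ ENNReal.ofReal (ε / 2) + ENNReal.ofReal (ε / 2) := add_le_add h3 h2
    _ = ENNReal.ofReal ε := by
        rw [← ENNReal.ofReal_add (half_pos hε).le (half_pos hε).le, add_halves]

theorem IsBigOP.mono {X Y : ℕ → Ω → ℝ} {r : ℕ → ℝ} (hX : IsBigOP μ X r)
    (h : ∀ N ω, |Y N ω| ≤ |X N ω|) : IsBigOP μ Y r :=
  hX.mono_off (fun _ => ∅) (by simp) (Eventually.of_forall fun N ω _ => h N ω)

theorem IsBigOP.mono_ae {X Y : ℕ → Ω → ℝ} {r : ℕ → ℝ} (hX : IsBigOP μ X r)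
    (h : ∀ᵐ ω ∂μ, ∀ N, |Y N ω| ≤ |X N ω|) : IsBigOP μ Y r := by
  refine hX.mono_off (fun _ => {ω | ¬ ∀ N, |Y N ω| ≤ |X N ω|}) ?_
    (Eventually.of_forall fun N ω hω => ?_)
  · rw [ae_iff.1 h]; exact tendsto_const_nhds
  · exact not_not.1 hω N

theorem IsLittleOP.mono_off {X Y : ℕ → Ω → ℝ} {r : ℕ → ℝ} (hX : IsLittleOP μ X r) (A : ℕ → Set Ω)
    (hA : Tendsto (fun N => μ (A N)) atTop (𝓝 0))
    (h : ∀ᶠ N in atTop, ∀ ω, ω ∉ A N → |Y N ω| ≤ |X N ω|) : IsLittleOP μ Y r := by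
  intro δ hδ
  have h1 := (hX δ hδ).add hA
  rw [add_zero] at h1
  refine tendsto_of_tendsto_of_tendsto_of_le_of_le' tendsto_const_nhds h1
    (Eventually.of_forall fun _ => zero_le) ?_
  filter_upwards [h] with N hN
  refine (measure_mono fun ω hω => ?_).trans (measure_union_le _ _)
  by_cases hA : ω ∈ A N
  · exact Or.inr hA
  · exact Or.inl (lt_of_lt_of_le hω (hN ω hA))

theorem IsLittleOP.mono_ae {X Y : ℕ → Ω → ℝ} {r : ℕ → ℝ} (hX : IsLittleOP μ X r)
    (h : ∀ᵐ ω ∂μ, ∀ N, |Y N ω| ≤ |X N ω|) : IsLittleOP μ Y r := by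
  refine hX.mono_off (fun _ => {ω | ¬ ∀ N, |Y N ω| ≤ |X N ω|}) ?_
    (Eventually.of_forall fun N ω hω => ?_)
  · rw [ae_iff.1 h]; exact tendsto_const_nhds
  · exact not_not.1 hω N

theorem IsBigOP.exists_pos {X : ℕ → Ω → ℝ} {r : ℕ → ℝ} (hX : IsBigOP μ X r) {ε : ℝ} (hε : 0 < ε) :
    ∃ c : ℝ, 0 < c ∧ ∃ M : ℕ, ∀ N, M ≤ N → μ {ω | c * |r N| < |X N ω|} ≤ ENNReal.ofReal ε := by
  obtain ⟨c, M, h⟩ := hX ε hε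
  refine ⟨max c 1, by positivity, M, fun N hN => (measure_mono fun ω hω => ?_).trans (h N hN)⟩
  exact lt_of_le_of_lt (mul_le_mul_of_nonneg_right (le_max_left c 1) (abs_nonneg _)) hω

theorem IsBigOP.rate {X : ℕ → Ω → ℝ} {r s : ℕ → ℝ} (hX : IsBigOP μ X r) (C : ℝ)
    (h : ∀ᶠ N in atTop, |r N| ≤ C * |s N|) : IsBigOP μ X s := by
  intro ε hε
  obtain ⟨c, hc, M, hM⟩ := hX.exists_pos hε
  obtain ⟨M', hM'⟩ := eventually_atTop.1 h
  refine ⟨c * C, max M M', fun N hN => (measure_mono fun ω hω => ?_).trans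
    (hM N (le_of_max_le_left hN))⟩
  rw [Set.mem_ofPred_eq] at hω ⊢
  refine lt_of_le_of_lt ?_ hω
  rw [mul_assoc]
  exact mul_le_mul_of_nonneg_left (hM' N (le_of_max_le_right hN)) hc.le

/-- Stated for the sum of the absolute values, which bounds `|X + Y|` and also serves several
summands at once. -/
theorem IsBigOP.add {X Y : ℕ → Ω → ℝ} {r : ℕ → ℝ} (hX : IsBigOP μ X r) (hY : IsBigOP μ Y r) :
    IsBigOP μ (fun N ω => |X N ω| + |Y N ω|) r := by
  intro ε hε
  obtain ⟨c, M, h⟩ := hX (ε / 2) (half_pos hε)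
  obtain ⟨c', M', h'⟩ := hY (ε / 2) (half_pos hε)
  refine ⟨c + c', max M M', fun N hN => ?_⟩
  calc _ ≤ μ ({ω | c * |r N| < |X N ω|} ∪ {ω | c' * |r N| < |Y N ω|}) := by
        refine measure_mono fun ω hω => ?_
        by_contra hcon
        simp only [Set.mem_union, Set.mem_ofPred_eq, not_or, not_lt] at hcon
        simp only [Set.mem_ofPred_eq] at hω
        rw [abs_of_nonneg (add_nonneg (abs_nonneg (X N ω)) (abs_nonneg (Y N ω)))] at hω
        nlinarith [hcon.1, hcon.2]
    _ ≤ ENNReal.ofReal (ε / 2) + ENNReal.ofReal (ε / 2) :=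
        (measure_union_le _ _).trans (add_le_add (h N (le_of_max_le_left hN))
          (h' N (le_of_max_le_right hN)))
    _ = ENNReal.ofReal ε := by
        rw [← ENNReal.ofReal_add (half_pos hε).le (half_pos hε).le, add_halves]

theorem IsBigOP.mul {X Y : ℕ → Ω → ℝ} {r s : ℕ → ℝ} (hX : IsBigOP μ X r) (hY : IsBigOP μ Y s) :
    IsBigOP μ (fun N ω => X N ω * Y N ω) (fun N => r N * s N) := by
  intro ε hε
  obtain ⟨c, hc, M, h⟩ := hX.exists_pos (half_pos hε)
  obtain ⟨c', hc', M', h'⟩ := hY.exists_pos (half_pos hε)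
  refine ⟨c * c', max M M', fun N hN => ?_⟩
  calc _ ≤ μ ({ω | c * |r N| < |X N ω|} ∪ {ω | c' * |s N| < |Y N ω|}) := by
        refine measure_mono fun ω hω => ?_
        by_contra hcon
        simp only [Set.mem_union, Set.mem_ofPred_eq, not_or, not_lt] at hcon
        simp only [Set.mem_ofPred_eq, abs_mul] at hω
        have := mul_le_mul hcon.1 hcon.2 (abs_nonneg _) (by positivity)
        nlinarith
    _ ≤ ENNReal.ofReal (ε / 2) + ENNReal.ofReal (ε / 2) :=
        (measure_union_le _ _).trans (add_le_add (h N (le_of_max_le_left hN))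
          (h' N (le_of_max_le_right hN)))
    _ = ENNReal.ofReal ε := by
        rw [← ENNReal.ofReal_add (half_pos hε).le (half_pos hε).le, add_halves]

theorem isBigOP_const (c : ℝ) : IsBigOP μ (fun _ _ => c) (fun _ => 1) :=
  fun ε _ => ⟨|c|, 0, fun N _ => by simp⟩

theorem IsBigOP.const_mul {X : ℕ → Ω → ℝ} {r : ℕ → ℝ} (hX : IsBigOP μ X r) (c : ℝ) :
    IsBigOP μ (fun N ω => c * X N ω) r := by
  simpa using (isBigOP_const (μ := μ) c).mul hX

theorem isBigOP_zero (r : ℕ → ℝ) : IsBigOP μ (fun _ _ => 0) r :=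
  fun ε _ => ⟨0, 0, fun N _ => by simp⟩

theorem IsBigOP.sum {ι : Type*} (s : Finset ι) {X : ι → ℕ → Ω → ℝ} {r : ℕ → ℝ}
    (h : ∀ i ∈ s, IsBigOP μ (X i) r) : IsBigOP μ (fun N ω => ∑ i ∈ s, |X i N ω|) r := by
  classical
  induction s using Finset.induction_on with
  | empty => simpa using isBigOP_zero r
  | insert i s hi ih =>
    have h1 := (h i (Finset.mem_insert_self i s)).add
      (ih fun j hj => h j (Finset.mem_insert_of_mem hj))
    refine h1.mono fun N ω => le_of_eq ?_
    rw [Finset.sum_insert hi, abs_of_nonneg (Finset.sum_nonneg fun j _ => abs_nonneg (X j N ω))]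

theorem IsLittleOP.isBigOP {X : ℕ → Ω → ℝ} {r : ℕ → ℝ} (hX : IsLittleOP μ X r) :
    IsBigOP μ X r := by
  intro ε hε
  have h := (hX 1 one_pos).eventually_le_const (ENNReal.ofReal_pos.2 hε)
  obtain ⟨M, hM⟩ := eventually_atTop.1 h
  exact ⟨1, M, hM⟩

theorem IsLittleOP.mul_isBigOP {X Y : ℕ → Ω → ℝ} {r : ℕ → ℝ} (hX : IsLittleOP μ X r)
    (hY : IsBigOP μ Y fun _ => 1) : IsLittleOP μ (fun N ω => X N ω * Y N ω) r := by
  intro δ hδ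
  rw [ENNReal.tendsto_nhds_zero]
  intro ε hε
  obtain ⟨ε', hε'0, hε'⟩ : ∃ ε' : ℝ, 0 < ε' ∧ ENNReal.ofReal ε' ≤ ε / 2 := by
    rcases eq_or_ne ε ⊤ with rfl | h
    · exact ⟨1, one_pos, by simp [ENNReal.top_div]⟩
    · exact ⟨(ε / 2).toReal, ENNReal.toReal_pos (by simpa using hε.ne') (by simp [ENNReal.div_eq_top, h]),
        ENNReal.ofReal_toReal_le⟩
  obtain ⟨c, hc, M, h⟩ := hY.exists_pos hε'0
  have h2 : ∀ᶠ N in atTop, μ {ω | δ / c * |r N| < |X N ω|} ≤ ε / 2 :=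
    (hX (δ / c) (div_pos hδ hc)).eventually_le_const (ENNReal.half_pos hε.ne')
  filter_upwards [h2, eventually_ge_atTop M] with N h2 hN
  calc _ ≤ μ ({ω | δ / c * |r N| < |X N ω|} ∪ {ω | c * |(1 : ℝ)| < |Y N ω|}) := by
        refine measure_mono fun ω hω => ?_
        by_contra hcon
        simp only [Set.mem_union, Set.mem_ofPred_eq, not_or, not_lt, abs_one, mul_one] at hcon
        simp only [Set.mem_ofPred_eq, abs_mul] at hω
        have := mul_le_mul hcon.1 hcon.2 (abs_nonneg _) (by positivity)
        have e : δ / c * |r N| * c = δ * |r N| := by field_simp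
        linarith
    _ ≤ ε / 2 + ε / 2 := (measure_union_le _ _).trans (add_le_add h2 ((h N hN).trans hε'))
    _ = ε := ENNReal.add_halves ε

theorem IsBigOP.tendsto_measure_lt {X : ℕ → Ω → ℝ} {r : ℕ → ℝ} (hX : IsBigOP μ X r)
    (hr : Tendsto r atTop (𝓝 0)) {δ : ℝ} (hδ : 0 < δ) :
    Tendsto (fun N => μ {ω | δ < |X N ω|}) atTop (𝓝 0) := by
  rw [ENNReal.tendsto_nhds_zero]
  intro ε hε
  obtain ⟨ε', hε'0, hε'⟩ : ∃ ε' : ℝ, 0 < ε' ∧ ENNReal.ofReal ε' ≤ ε := by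
    rcases eq_or_ne ε ⊤ with rfl | h
    · exact ⟨1, one_pos, by simp⟩
    · exact ⟨ε.toReal, ENNReal.toReal_pos hε.ne' h, ENNReal.ofReal_toReal_le⟩
  obtain ⟨c, hc, M, h⟩ := hX.exists_pos hε'0
  have h1 : ∀ᶠ N in atTop, c * |r N| ≤ δ := by
    have : Tendsto (fun N => c * |r N|) atTop (𝓝 0) := by simpa using (hr.abs.const_mul c)
    exact this.eventually_le_const hδ
  filter_upwards [h1, eventually_ge_atTop M] with N h1 hN
  exact (measure_mono fun ω hω => lt_of_le_of_lt h1 hω).trans ((h N hN).trans hε')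

end StochasticOrders

/-! ### Mean square norms -/

section MeanSquare

variable {Ω : Type*} {m0 : MeasurableSpace Ω} {μ : Measure Ω}

theorem eLpNorm_two_sq (X : Ω → ℝ) :
    eLpNorm X 2 μ ^ 2 = ∫⁻ ω, ENNReal.ofReal (X ω ^ 2) ∂μ := by
  have h := eLpNorm_nnreal_pow_eq_lintegral (μ := μ) (f := X) (p := 2) (by norm_num)
  have e : ((2 : NNReal) : ℝ) = ((2 : ℕ) : ℝ) := by norm_num
  simp only [e, ENNReal.rpow_natCast] at h
  rw [show ((2 : NNReal) : ENNReal) = 2 by norm_num] at h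
  rw [h]
  refine lintegral_congr fun ω => ?_
  rw [Real.enorm_eq_ofReal_abs, ← ENNReal.ofReal_pow (abs_nonneg _), sq_abs]

theorem eLpNorm_two_le_iff {X : Ω → ℝ} {b : ℝ} (hb : 0 ≤ b) :
    eLpNorm X 2 μ ≤ ENNReal.ofReal b
      ↔ ∫⁻ ω, ENNReal.ofReal (X ω ^ 2) ∂μ ≤ ENNReal.ofReal (b ^ 2) := by
  rw [← eLpNorm_two_sq, ENNReal.ofReal_pow hb]
  exact (ENNReal.pow_le_pow_left_iff (by norm_num)).symm

theorem lintegral_sq_eq {X : Ω → ℝ} (hX : MemLp X 2 μ) :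
    ∫⁻ ω, ENNReal.ofReal (X ω ^ 2) ∂μ = ENNReal.ofReal (∫ ω, X ω ^ 2 ∂μ) :=
  (ofReal_integral_eq_lintegral_ofReal hX.integrable_sq
    (Eventually.of_forall fun _ => sq_nonneg _)).symm

theorem eLpNorm_two_le_iff_integral {X : Ω → ℝ} (hX : MemLp X 2 μ) {b : ℝ} (hb : 0 ≤ b) :
    eLpNorm X 2 μ ≤ ENNReal.ofReal b ↔ ∫ ω, X ω ^ 2 ∂μ ≤ b ^ 2 := by
  rw [eLpNorm_two_le_iff hb, lintegral_sq_eq hX, ENNReal.ofReal_le_ofReal_iff (sq_nonneg b)]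

theorem memLp_of_eLpNorm_le {X : Ω → ℝ} {p : ENNReal} (hX : AEStronglyMeasurable X μ) {b : ℝ}
    (h : eLpNorm X p μ ≤ ENNReal.ofReal b) : MemLp X p μ :=
  ⟨hX, h.trans_lt ENNReal.ofReal_lt_top⟩

theorem eLpNorm_const_mul_le {X : Ω → ℝ} {p : ENNReal} {b : ℝ} (c : ℝ)
    (h : eLpNorm X p μ ≤ ENNReal.ofReal b) :
    eLpNorm (fun ω => c * X ω) p μ ≤ ENNReal.ofReal (|c| * b) := by
  have := eLpNorm_const_smul (c := c) (f := X) (p := p) (μ := μ)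
  have e : (fun ω => c * X ω) = c • X := rfl
  rw [e, this, ENNReal.ofReal_mul (abs_nonneg c), Real.enorm_eq_ofReal_abs]
  gcongr

theorem eLpNorm_add_le_ofReal {X Y : Ω → ℝ} {p : ENNReal} (hp : 1 ≤ p) {a b : ℝ} (ha : 0 ≤ a)
    (hb : 0 ≤ b) (hX : AEStronglyMeasurable X μ) (hY : AEStronglyMeasurable Y μ)
    (h : eLpNorm X p μ ≤ ENNReal.ofReal a) (h' : eLpNorm Y p μ ≤ ENNReal.ofReal b) :
    eLpNorm (fun ω => X ω + Y ω) p μ ≤ ENNReal.ofReal (a + b) := by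
  rw [ENNReal.ofReal_add ha hb]
  exact (eLpNorm_add_le hX hY hp).trans (add_le_add h h')

theorem eLpNorm_mul_le_ofReal {X Y : Ω → ℝ} {a b : ℝ} (ha : 0 ≤ a)
    (hX : AEStronglyMeasurable X μ) (hY : AEStronglyMeasurable Y μ)
    (h : eLpNorm X 2 μ ≤ ENNReal.ofReal a) (h' : eLpNorm Y 2 μ ≤ ENNReal.ofReal b) :
    eLpNorm (fun ω => X ω * Y ω) 1 μ ≤ ENNReal.ofReal (a * b) := by
  rw [ENNReal.ofReal_mul ha]
  exact (eLpNorm_smul_le_mul_eLpNorm (p := 2) (q := 2) (r := 1) hY hX).trans (mul_le_mul' h h')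

theorem eLpNorm_sum_le_ofReal {ι : Type*} {p : ENNReal} (hp : 1 ≤ p) (s : Finset ι)
    {X : ι → Ω → ℝ} {b : ι → ℝ} (hb : ∀ i ∈ s, 0 ≤ b i)
    (hX : ∀ i ∈ s, AEStronglyMeasurable (X i) μ)
    (h : ∀ i ∈ s, eLpNorm (X i) p μ ≤ ENNReal.ofReal (b i)) :
    eLpNorm (fun ω => ∑ i ∈ s, X i ω) p μ ≤ ENNReal.ofReal (∑ i ∈ s, b i) := by
  have e : (fun ω => ∑ i ∈ s, X i ω) = ∑ i ∈ s, X i := by ext ω; simp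
  rw [e, ENNReal.ofReal_sum_of_nonneg hb]
  exact (eLpNorm_sum_le hX hp).trans (Finset.sum_le_sum h)

theorem abs_integral_le_of_eLpNorm {X : Ω → ℝ} {b : ℝ} (hb : 0 ≤ b)
    (h : eLpNorm X 1 μ ≤ ENNReal.ofReal b) : |∫ ω, X ω ∂μ| ≤ b := by
  have h1 := enorm_integral_le_lintegral_enorm (μ := μ) X
  rw [← eLpNorm_one_eq_lintegral_enorm, Real.enorm_eq_ofReal_abs] at h1
  exact (ENNReal.ofReal_le_ofReal_iff hb).1 (h1.trans h)

theorem eLpNorm_const_le [IsProbabilityMeasure μ] (c : ℝ) {p : ENNReal} (hp : p ≠ 0) :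
    eLpNorm (fun _ : Ω => c) p μ ≤ ENNReal.ofReal |c| := by
  rw [eLpNorm_const _ hp (IsProbabilityMeasure.ne_zero μ)]
  simp [Real.enorm_eq_ofReal_abs]

/-- A mean square bound passes to the limit in `L¹`. -/
theorem eLpNorm_two_le_of_tendsto {X : ℕ → Ω → ℝ} {Y : Ω → ℝ} {B : ENNReal}
    (hX : ∀ M, AEStronglyMeasurable (X M) μ) (hY : AEStronglyMeasurable Y μ)
    (hlim : Tendsto (fun M => eLpNorm (X M - Y) 1 μ) atTop (𝓝 0))
    (hB : ∀ M, eLpNorm (X M) 2 μ ≤ B) : eLpNorm Y 2 μ ≤ B := by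
  obtain ⟨ns, -, hns⟩ :=
    (tendstoInMeasure_of_tendsto_eLpNorm one_ne_zero hX hY hlim).exists_seq_tendsto_ae
  refine (Lp.eLpNorm_lim_le_liminf_eLpNorm (fun n => hX (ns n)) Y hns).trans ?_
  exact liminf_le_of_le (by isBoundedDefault) fun b hb => by
    obtain ⟨k, hk⟩ := hb.exists
    exact hk.trans (hB _)

/-- Chebyshev's inequality for a vector whose entries are small in mean square; the dimension may
grow with `N`. -/
theorem isBigOP_euclNorm {ι : ℕ → Type*} [∀ N, Fintype (ι N)] (V : ∀ N, Ω → ι N → ℝ)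
    (hV : ∀ N i, AEStronglyMeasurable (fun ω => V N ω i) μ) {b : ℕ → ℝ} (hb : ∀ N, 0 ≤ b N)
    (h : ∀ᶠ N in atTop, ∀ i, eLpNorm (fun ω => V N ω i) 2 μ ≤ ENNReal.ofReal (b N)) :
    IsBigOP μ (fun N ω => euclNorm (V N ω)) (fun N => √(Fintype.card (ι N) : ℝ) * b N) := by
  intro ε hε
  obtain ⟨M, hM⟩ := eventually_atTop.1 h
  refine ⟨√(1 / ε), M, fun N hN => ?_⟩
  have hb' := hb N
  obtain ⟨R, hR⟩ : ∃ R, R = √(Fintype.card (ι N) : ℝ) * b N := ⟨_, rfl⟩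
  have hR0 : 0 ≤ R := by rw [hR]; positivity
  have hmeas : AEMeasurable (fun ω => ENNReal.ofReal (euclNorm (V N ω) ^ 2)) μ := by
    simp only [euclNorm_sq]
    exact (Finset.aemeasurable_fun_sum _ fun i _ => (hV N i).aemeasurable.pow_const 2).ennreal_ofReal
  have h2 : ∫⁻ ω, ENNReal.ofReal (euclNorm (V N ω) ^ 2) ∂μ ≤ ENNReal.ofReal (R ^ 2) := by
    simp only [euclNorm_sq]
    calc ∫⁻ ω, ENNReal.ofReal (∑ i, V N ω i ^ 2) ∂μ
        = ∑ i, ∫⁻ ω, ENNReal.ofReal (V N ω i ^ 2) ∂μ := by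
          rw [← lintegral_finsetSum']
          · exact lintegral_congr fun ω => ENNReal.ofReal_sum_of_nonneg fun i _ => sq_nonneg _
          · exact fun i _ => ((hV N i).aemeasurable.pow_const 2).ennreal_ofReal
      _ ≤ ∑ _i : ι N, ENNReal.ofReal (b N ^ 2) :=
          Finset.sum_le_sum fun i _ => (eLpNorm_two_le_iff hb').1 (hM N hN i)
      _ = ENNReal.ofReal (R ^ 2) := by
          rw [Finset.sum_const, hR, mul_pow, Real.sq_sqrt (by positivity), nsmul_eq_mul,
            ENNReal.ofReal_mul (by positivity)]
          simp
  simp only [← hR]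
  rw [abs_of_nonneg hR0]
  rcases hR0.eq_or_lt with hR1 | hR1
  · rw [← hR1] at h2 ⊢
    simp only [ne_eq, OfNat.ofNat_ne_zero, not_false_eq_true, zero_pow, ENNReal.ofReal_zero,
      nonpos_iff_eq_zero] at h2
    rw [lintegral_eq_zero_iff' hmeas] at h2
    have h3 : μ {ω | √(1 / ε) * 0 < |euclNorm (V N ω)|} = 0 := by
      refine measure_mono_null ?_ (ae_iff.1 h2)
      intro ω hω
      simp only [Set.mem_ofPred_eq, mul_zero, abs_pos, Pi.zero_apply, ENNReal.ofReal_eq_zero,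
        not_le] at hω ⊢
      positivity
    rw [h3]; exact zero_le
  · have h4 := meas_ge_le_lintegral_div hmeas (ε := ENNReal.ofReal (R ^ 2 / ε))
      (by simpa using div_pos (pow_pos hR1 2) hε) ENNReal.ofReal_ne_top
    refine (measure_mono fun ω hω => ?_).trans (h4.trans ?_)
    · simp only [Set.mem_ofPred_eq, abs_of_nonneg (euclNorm_nonneg _)] at hω ⊢
      apply ENNReal.ofReal_le_ofReal
      have h5 := pow_le_pow_left₀ (by positivity) hω.le 2
      rw [mul_pow, Real.sq_sqrt (by positivity)] at h5
      calc R ^ 2 / ε = 1 / ε * R ^ 2 := by ring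
        _ ≤ _ := h5
    · refine (ENNReal.div_le_div_right h2 _).trans ?_
      rw [← ENNReal.ofReal_div_of_pos (by positivity)]
      apply ENNReal.ofReal_le_ofReal
      rw [div_div_cancel₀ (by positivity)]

theorem isBigOP_of_eLpNorm {X : ℕ → Ω → ℝ} (hX : ∀ N, AEStronglyMeasurable (X N) μ) {b : ℕ → ℝ}
    (hb : ∀ N, 0 ≤ b N) (h : ∀ᶠ N in atTop, eLpNorm (X N) 2 μ ≤ ENNReal.ofReal (b N)) :
    IsBigOP μ X b := by
  have := isBigOP_euclNorm (ι := fun _ => Unit) (fun N ω _ => X N ω) (fun N _ => hX N) hb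
    (h.mono fun N hN _ => hN)
  simp only [Fintype.card_unit, Nat.cast_one, Real.sqrt_one, one_mul] at this
  exact this.mono fun N ω => (abs_le_euclNorm (fun _ : Unit => X N ω) ()).trans (le_abs_self _)

theorem integral_sq_sum_of_orthogonal {ξ : ℕ → Ω → ℝ} (hξ : ∀ k, MemLp (ξ k) 2 μ)
    (h : ∀ k l, k < l → ∫ ω, ξ k ω * ξ l ω ∂μ = 0) (N : ℕ) :
    ∫ ω, (∑ k ∈ Finset.range N, ξ k ω) ^ 2 ∂μ = ∑ k ∈ Finset.range N, ∫ ω, ξ k ω ^ 2 ∂μ := by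
  induction N with
  | zero => simp
  | succ N ih =>
    rw [Finset.sum_range_succ, ← ih]
    have hS : MemLp (fun ω => ∑ k ∈ Finset.range N, ξ k ω) 2 μ :=
      memLp_finsetSum _ fun k _ => hξ k
    have i1 : ∀ k, Integrable (fun ω => ξ k ω * ξ N ω) μ := fun k => (hξ k).integrable_mul (hξ N)
    have h0 : ∫ ω, (∑ k ∈ Finset.range N, ξ k ω) * ξ N ω ∂μ = 0 := by
      simp only [Finset.sum_mul]
      rw [integral_finsetSum _ fun k _ => i1 k]
      exact Finset.sum_eq_zero fun k hk => h k N (Finset.mem_range.1 hk)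
    have e : ∀ ω, (∑ k ∈ Finset.range (N + 1), ξ k ω) ^ 2
        = (∑ k ∈ Finset.range N, ξ k ω) ^ 2 + 2 * ((∑ k ∈ Finset.range N, ξ k ω) * ξ N ω)
          + ξ N ω ^ 2 := fun ω => by rw [Finset.sum_range_succ]; ring
    simp only [e]
    have i2 : Integrable (fun ω => 2 * ((∑ k ∈ Finset.range N, ξ k ω) * ξ N ω)) μ :=
      (hS.integrable_mul (hξ N)).const_mul 2
    have i3 : Integrable (fun ω => (∑ k ∈ Finset.range N, ξ k ω) ^ 2
        + 2 * ((∑ k ∈ Finset.range N, ξ k ω) * ξ N ω)) μ := hS.integrable_sq.add i2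
    rw [integral_add i3 (hξ N).integrable_sq,
      integral_add hS.integrable_sq i2, integral_const_mul, h0]
    ring

end MeanSquare

/-! ### Martingale differences -/

section Martingale

variable {Ω : Type*} {m0 : MeasurableSpace Ω} {μ : Measure Ω} [IsProbabilityMeasure μ]

theorem integral_mul_eq_zero_of_condExp {m : MeasurableSpace Ω} (hm : m ≤ m0) {X Y : Ω → ℝ}
    (hX : AEStronglyMeasurable[m] X μ) (hXY : Integrable (fun ω => X ω * Y ω) μ)
    (hY : Integrable Y μ) (h : μ[Y | m] =ᵐ[μ] fun _ => 0) : ∫ ω, X ω * Y ω ∂μ = 0 := by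
  have h1 := condExp_mul_of_aestronglyMeasurable_left (m := m) hX hXY hY
  rw [← integral_condExp hm]
  have h2 : μ[fun ω => X ω * Y ω | m] =ᵐ[μ] fun _ => 0 := by
    refine h1.trans ?_
    filter_upwards [h] with ω hω
    simp [hω]
  rw [integral_congr_ae h2]
  simp

/-- Sums of square integrable martingale differences grow like `√N`. -/
theorem eLpNorm_sum_le_of_martingaleDiff {F : ℕ → MeasurableSpace Ω} (hF : Monotone F)
    (hF0 : ∀ k, F k ≤ m0) {ξ : ℕ → Ω → ℝ} {b : ℝ} (hb : 0 ≤ b)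
    (hξ : ∀ k, AEStronglyMeasurable[F (k + 1)] (ξ k) μ)
    (hξb : ∀ k, eLpNorm (ξ k) 2 μ ≤ ENNReal.ofReal b) (h : ∀ k, μ[ξ k | F k] =ᵐ[μ] fun _ => 0)
    (N : ℕ) :
    eLpNorm (fun ω => ∑ k ∈ Finset.range N, ξ k ω) 2 μ ≤ ENNReal.ofReal (√N * b) := by
  have hL : ∀ k, MemLp (ξ k) 2 μ := fun k =>
    memLp_of_eLpNorm_le ((hξ k).mono (hF0 _)) (hξb k)
  have hS : MemLp (fun ω => ∑ k ∈ Finset.range N, ξ k ω) 2 μ :=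
    memLp_finsetSum _ fun k _ => hL k
  rw [eLpNorm_two_le_iff_integral hS (by positivity), integral_sq_sum_of_orthogonal hL]
  · calc _ ≤ ∑ _k ∈ Finset.range N, b ^ 2 :=
        Finset.sum_le_sum fun k _ => (eLpNorm_two_le_iff_integral (hL k) hb).1 (hξb k)
      _ = (√N * b) ^ 2 := by
        rw [Finset.sum_const, mul_pow, Real.sq_sqrt (by positivity)]; simp
  · intro k l hkl
    exact integral_mul_eq_zero_of_condExp (hF0 l) ((hξ k).mono (hF hkl))
      ((hL k).integrable_mul (hL l)) ((hL l).integrable (by norm_num)) (h l)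

/-- Pulling a factor that is measurable with respect to the past out of a conditional second
moment; `g` is not assumed bounded, so the integrability of `(Y g)²` is part of the conclusion. -/
theorem lintegral_sq_mul_of_condExp {m : MeasurableSpace Ω} (hm : m ≤ m0) {Y g : Ω → ℝ} {c : ℝ}
    (hY : MemLp Y 2 μ) (h : μ[fun ω => Y ω ^ 2 | m] =ᵐ[μ] fun _ => c)
    (hg : AEStronglyMeasurable[m] g μ) :
    ∫⁻ ω, ENNReal.ofReal ((Y ω * g ω) ^ 2) ∂μ
      = ENNReal.ofReal c * ∫⁻ ω, ENNReal.ofReal (g ω ^ 2) ∂μ := by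
  obtain ⟨g', hg', hgg⟩ := hg
  have e1 : ∫⁻ ω, ENNReal.ofReal (g ω ^ 2) ∂μ = ∫⁻ ω, ENNReal.ofReal (g' ω ^ 2) ∂μ :=
    lintegral_congr_ae (by filter_upwards [hgg] with ω hω; rw [hω])
  have e2 : ∫⁻ ω, ENNReal.ofReal ((Y ω * g ω) ^ 2) ∂μ
      = ∫⁻ ω, ENNReal.ofReal (Y ω ^ 2) * ENNReal.ofReal (g' ω ^ 2) ∂μ :=
    lintegral_congr_ae (by
      filter_upwards [hgg] with ω hω; rw [hω, mul_pow, ENNReal.ofReal_mul (sq_nonneg _)])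
  rw [e1, e2]
  have hgm : Measurable[m] fun ω => ENNReal.ofReal (g' ω ^ 2) :=
    ENNReal.measurable_ofReal.comp (hg'.measurable.pow_const 2)
  have hYm : AEMeasurable (fun ω => ENNReal.ofReal (Y ω ^ 2)) μ :=
    (hY.aemeasurable.pow_const 2).ennreal_ofReal
  have key : (μ.withDensity fun ω => ENNReal.ofReal (Y ω ^ 2)).trim hm
      = ENNReal.ofReal c • μ.trim hm := by
    refine @Measure.ext _ m _ _ fun s hs => ?_
    rw [trim_measurableSet_eq hm hs, withDensity_apply _ (hm s hs), Measure.smul_apply,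
      trim_measurableSet_eq hm hs, smul_eq_mul]
    have h1 := setIntegral_condExp hm hY.integrable_sq hs
    rw [← ofReal_integral_eq_lintegral_ofReal hY.integrable_sq.integrableOn
      (Eventually.of_forall fun _ => sq_nonneg _), ← h1,
      setIntegral_congr_ae (g := fun _ => c) (hm s hs) (h.mono fun ω hω _ => hω),
      setIntegral_const, smul_eq_mul, mul_comm, Measure.real,
      ENNReal.ofReal_mul' ENNReal.toReal_nonneg, ENNReal.ofReal_toReal (measure_ne_top _ _)]
  calc _ = ∫⁻ ω, ENNReal.ofReal (g' ω ^ 2) ∂(μ.withDensity fun ω => ENNReal.ofReal (Y ω ^ 2)) := by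
        rw [lintegral_withDensity_eq_lintegral_mul₀ hYm
          (hgm.mono hm le_rfl).aemeasurable]
        rfl
    _ = _ := by
        rw [← lintegral_trim hm hgm, key, lintegral_smul_measure, lintegral_trim hm hgm, smul_eq_mul]

end Martingale

/-! ### Vanishing in probability and a weak law of large numbers -/

section VanishingInProbability

variable {Ω : Type*} {m0 : MeasurableSpace Ω} {μ : Measure Ω}

theorem IsLittleOP.add {X Y : ℕ → Ω → ℝ} {r : ℕ → ℝ} (hX : IsLittleOP μ X r)
    (hY : IsLittleOP μ Y r) : IsLittleOP μ (fun N ω => X N ω + Y N ω) r := by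
  intro δ hδ
  have h := (hX (δ / 2) (half_pos hδ)).add (hY (δ / 2) (half_pos hδ))
  rw [add_zero] at h
  refine tendsto_of_tendsto_of_tendsto_of_le_of_le tendsto_const_nhds h (fun _ => zero_le)
    fun N => (measure_mono fun ω hω => ?_).trans (measure_union_le _ _)
  by_contra hcon
  simp only [Set.mem_union, Set.mem_ofPred_eq, not_or, not_lt] at hcon hω
  linarith [abs_add_le (X N ω) (Y N ω), hcon.1, hcon.2]

theorem IsLittleOP.const_mul {X : ℕ → Ω → ℝ} {r : ℕ → ℝ} (hX : IsLittleOP μ X r) (c : ℝ) :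
    IsLittleOP μ (fun N ω => c * X N ω) r := by
  simpa [mul_comm] using hX.mul_isBigOP (isBigOP_const c)

theorem isLittleOP_zero (r : ℕ → ℝ) : IsLittleOP μ (fun _ _ => 0) r := by
  intro δ hδ
  have : ∀ N, {ω : Ω | δ * |r N| < |(0 : ℝ)|} = ∅ := fun N => by
    ext ω
    simp only [abs_zero, Set.mem_ofPred_eq, Set.mem_empty_iff_false, iff_false, not_lt]
    positivity
  simp only [this, measure_empty]
  exact tendsto_const_nhds

theorem IsLittleOP.sum {ι : Type*} (s : Finset ι) {X : ι → ℕ → Ω → ℝ} {r : ℕ → ℝ}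
    (h : ∀ i ∈ s, IsLittleOP μ (X i) r) : IsLittleOP μ (fun N ω => ∑ i ∈ s, X i N ω) r := by
  classical
  induction s using Finset.induction_on with
  | empty => simpa using isLittleOP_zero r
  | insert i s hi ih =>
    simp only [Finset.sum_insert hi]
    exact (h i (Finset.mem_insert_self i s)).add
      (ih fun j hj => h j (Finset.mem_insert_of_mem hj))

theorem IsLittleOP.of_eLpNorm_two {X : ℕ → Ω → ℝ} {b : ℕ → ℝ}
    (hX : ∀ N, AEStronglyMeasurable (X N) μ) (hb0 : ∀ N, 0 ≤ b N) (hb : Tendsto b atTop (𝓝 0))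
    (h : ∀ N, eLpNorm (X N) 2 μ ≤ ENNReal.ofReal (b N)) : IsLittleOP μ X fun _ => 1 := by
  intro δ hδ
  simpa using (isBigOP_of_eLpNorm hX hb0 (Eventually.of_forall h)).tendsto_measure_lt hb hδ

theorem tendsto_const_div_sqrt (c : ℝ) : Tendsto (fun N : ℕ => c / √(N : ℝ)) atTop (𝓝 0) :=
  tendsto_const_nhds.div_atTop (Real.tendsto_sqrt_atTop.comp tendsto_natCast_atTop_atTop)

/-- A sequence that can be approximated in `L¹`, uniformly in `N`, by sequences that vanish in
probability vanishes in probability. -/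
theorem IsLittleOP.of_approx {X : ℕ → Ω → ℝ}
    (h : ∀ ε : ℝ, 0 < ε → ∃ Y : ℕ → Ω → ℝ, IsLittleOP μ Y (fun _ => 1) ∧
      (∀ N, AEStronglyMeasurable (fun ω => X N ω - Y N ω) μ) ∧
      ∀ N, eLpNorm (fun ω => X N ω - Y N ω) 1 μ ≤ ENNReal.ofReal ε) :
    IsLittleOP μ X fun _ => 1 := by
  intro δ hδ
  rw [ENNReal.tendsto_nhds_zero]
  intro η hη
  obtain ⟨ε', hε'0, hε'⟩ : ∃ ε' : ℝ, 0 < ε' ∧ ENNReal.ofReal ε' ≤ η / 2 := by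
    rcases eq_or_ne η ⊤ with rfl | h
    · exact ⟨1, one_pos, by simp [ENNReal.top_div]⟩
    · exact ⟨(η / 2).toReal, ENNReal.toReal_pos (by simpa using hη.ne')
        (by simp [ENNReal.div_eq_top, h]), ENNReal.ofReal_toReal_le⟩
  obtain ⟨Y, hY, hm, hle⟩ := h (δ / 2 * ε') (by positivity)
  have h2 : ∀ᶠ N in atTop, μ {ω | δ / 2 * |(1 : ℝ)| < |Y N ω|} ≤ η / 2 :=
    (hY (δ / 2) (half_pos hδ)).eventually_le_const (ENNReal.half_pos hη.ne')
  filter_upwards [h2] with N h2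
  have h3 : μ {ω | δ / 2 ≤ |X N ω - Y N ω|} ≤ η / 2 := by
    have h4 := meas_ge_le_lintegral_div (hm N).enorm
      (ε := ENNReal.ofReal (δ / 2)) (by simpa using half_pos hδ) ENNReal.ofReal_ne_top
    refine (measure_mono fun ω hω => ?_).trans (h4.trans ?_)
    · simp only [Set.mem_ofPred_eq, Real.enorm_eq_ofReal_abs] at hω ⊢
      exact ENNReal.ofReal_le_ofReal hω
    · rw [← eLpNorm_one_eq_lintegral_enorm]
      refine (ENNReal.div_le_div_right (hle N) _).trans ?_
      rw [← ENNReal.ofReal_div_of_pos (by positivity), mul_div_cancel_left₀ _ (by positivity)]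
      exact hε'
  calc _ ≤ μ ({ω | δ / 2 * |(1 : ℝ)| < |Y N ω|} ∪ {ω | δ / 2 ≤ |X N ω - Y N ω|}) := by
        refine measure_mono fun ω hω => ?_
        by_contra hcon
        simp only [Set.mem_union, Set.mem_ofPred_eq, not_or, not_lt, not_le, abs_one,
          mul_one] at hcon hω
        have := abs_add_le (X N ω - Y N ω) (Y N ω)
        rw [sub_add_cancel] at this
        linarith [hcon.1, hcon.2]
    _ ≤ η / 2 + η / 2 := (measure_union_le _ _).trans (add_le_add h2 h3)
    _ = η := ENNReal.add_halves η

end VanishingInProbability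

section MartingaleLLN

variable {Ω : Type*} {m0 : MeasurableSpace Ω} {μ : Measure Ω} [IsProbabilityMeasure μ]

theorem one_div_mul_sqrt (N : ℕ) (b : ℝ) : |1 / (N : ℝ)| * (√N * b) = b / √N := by
  rw [abs_of_nonneg (by positivity)]
  rcases Nat.eq_zero_or_pos N with rfl | hN
  · simp
  · have h : √(N : ℝ) * √N = N := Real.mul_self_sqrt (by positivity)
    have h' : 0 < √(N : ℝ) := Real.sqrt_pos.2 (by positivity)
    rw [← mul_assoc]
    nth_rewrite 1 [← h]
    field_simp

/-- Weak law of large numbers for an adapted, identically distributed, integrable sequence with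
constant conditional mean. No second moments are needed: truncated variables, centred at their
conditional means, are bounded martingale differences. -/
theorem isLittleOP_average_of_condExp {F : ℕ → MeasurableSpace Ω} (hF : Monotone F)
    (hF0 : ∀ k, F k ≤ m0) {ξ : ℕ → Ω → ℝ} {c : ℝ} (hξ : ∀ k, Measurable[F (k + 1)] (ξ k))
    (hid : ∀ k, IdentDistrib (ξ k) (ξ 0) μ μ) (hint : Integrable (ξ 0) μ)
    (h : ∀ k, μ[ξ k | F k] =ᵐ[μ] fun _ => c) :
    IsLittleOP μ (fun N ω => (1 / (N : ℝ)) * ∑ k ∈ Finset.range N, (ξ k ω - c)) fun _ => 1 := by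
  have hξ0 : ∀ k, Measurable (ξ k) := fun k => (hξ k).mono (hF0 _) le_rfl
  have hinti : ∀ k, Integrable (ξ k) μ := fun k => ((hid k).integrable_iff).2 hint
  -- the truncation at level `L`
  let τ : ℝ → ℝ → ℝ := fun L x => if |x| ≤ L then x else 0
  have hτm : ∀ L, Measurable (τ L) := fun L =>
    Measurable.ite (measurableSet_le measurable_norm measurable_const) measurable_id
      measurable_const
  have hτ1 : ∀ L x, 0 ≤ L → |τ L x| ≤ L := fun L x hL => by
    by_cases hx : |x| ≤ L <;> simp [τ, hx, hL]
  have hτ2 : ∀ L x, |x - τ L x| ≤ |x| := fun L x => by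
    by_cases hx : |x| ≤ L <;> simp [τ, hx]
  have htail : Tendsto (fun L : ℕ => ∫ ω, |ξ 0 ω - τ L (ξ 0 ω)| ∂μ) atTop (𝓝 0) := by
    have h0 : (0 : ℝ) = ∫ _ω, (0 : ℝ) ∂μ := by simp
    rw [h0]
    refine tendsto_integral_of_dominated_convergence (fun ω => |ξ 0 ω|) (fun L => ?_) hint.abs
      (fun L => Eventually.of_forall fun ω => ?_) (Eventually.of_forall fun ω => ?_)
    · exact ((hξ0 0).sub ((hτm L).comp (hξ0 0))).norm.aestronglyMeasurable
    · simpa using hτ2 L (ξ 0 ω)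
    · refine tendsto_const_nhds.congr' ?_
      obtain ⟨K, hK⟩ := exists_nat_ge |ξ 0 ω|
      filter_upwards [eventually_ge_atTop K] with L hL
      have : |ξ 0 ω| ≤ (L : ℝ) := hK.trans (by exact_mod_cast hL)
      simp [τ, this]
  refine IsLittleOP.of_approx fun ε hε => ?_
  obtain ⟨L, hL⟩ := (htail.eventually_lt_const (half_pos hε)).exists
  have hb : ∀ k, Integrable (fun ω => τ L (ξ k ω)) μ := fun k =>
    Integrable.of_bound ((hτm L).comp (hξ0 k)).aestronglyMeasurable (L : ℝ)
      (Eventually.of_forall fun ω => hτ1 L _ (by positivity))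
  let η : ℕ → Ω → ℝ := fun k ω => τ L (ξ k ω) - (μ[fun ω => τ L (ξ k ω) | F k]) ω
  have hηm : ∀ k, AEStronglyMeasurable[F (k + 1)] (η k) μ := fun k =>
    (((hτm L).comp (hξ k)).stronglyMeasurable.sub
      (stronglyMeasurable_condExp.mono (hF (Nat.le_succ k)))).aestronglyMeasurable
  have hηm0 : ∀ k, AEStronglyMeasurable (η k) μ := fun k => (hηm k).mono (hF0 _)
  have hη1 : ∀ k, μ[η k | F k] =ᵐ[μ] fun _ => 0 := fun k => by
    have h1 := condExp_sub (hb k) (integrable_condExp (m := F k) (f := fun ω => τ L (ξ k ω))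
      (μ := μ)) (F k)
    have h2 := condExp_of_stronglyMeasurable (hF0 k) (stronglyMeasurable_condExp
      (m := F k) (f := fun ω => τ L (ξ k ω)) (μ := μ)) integrable_condExp
    rw [h2, sub_self] at h1
    exact h1
  have hη2 : ∀ k, eLpNorm (η k) 2 μ ≤ ENNReal.ofReal (2 * L) := fun k => by
    have h1 : ∀ᵐ ω ∂μ, |(μ[fun ω => τ L (ξ k ω) | F k]) ω| ≤ (L : ℝ) := by
      exact ae_bdd_abs_condExp_of_ae_bdd_abs
        (Eventually.of_forall fun ω => hτ1 L _ (by positivity))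
    have h2 : ∀ᵐ ω ∂μ, ‖η k ω‖ ≤ 2 * (L : ℝ) := by
      filter_upwards [h1] with ω hω
      have := (abs_sub _ _).trans (add_le_add (hτ1 L (ξ k ω) (by positivity)) hω)
      rw [Real.norm_eq_abs]
      linarith
    refine (eLpNorm_le_of_ae_bound h2).trans ?_
    simp
  refine ⟨fun N ω => (1 / (N : ℝ)) * ∑ k ∈ Finset.range N, η k ω, ?_, fun N => ?_, fun N => ?_⟩
  · refine IsLittleOP.of_eLpNorm_two (b := fun N => 2 * L / √N)
      (fun N => (Finset.aestronglyMeasurable_fun_sum _ fun k _ => hηm0 k).const_mul _)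
      (fun N => by positivity) (tendsto_const_div_sqrt _) fun N => ?_
    rw [← one_div_mul_sqrt]
    exact eLpNorm_const_mul_le _
      (eLpNorm_sum_le_of_martingaleDiff hF hF0 (by positivity) hηm hη2 hη1 N)
  · exact ((Finset.aestronglyMeasurable_fun_sum _ fun k _ =>
      ((hξ0 k).aestronglyMeasurable.sub aestronglyMeasurable_const)).const_mul _).sub
      ((Finset.aestronglyMeasurable_fun_sum _ fun k _ => hηm0 k).const_mul _)
  · -- the remainder is a centred average of the tails
    let ζ : ℕ → Ω → ℝ := fun k ω => ξ k ω - τ L (ξ k ω)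
    have hζi : ∀ k, Integrable (ζ k) μ := fun k => (hinti k).sub (hb k)
    have hζ : ∀ k, eLpNorm (ζ k) 1 μ ≤ ENNReal.ofReal (ε / 2) := fun k => by
      have h1 : IdentDistrib (ζ k) (ζ 0) μ μ :=
        (hid k).comp (u := fun x => x - τ L x) (measurable_id.sub (hτm L))
      rw [h1.eLpNorm_eq, eLpNorm_one_eq_lintegral_enorm, ← ofReal_integral_norm_eq_lintegral_enorm
        (hζi 0)]
      exact ENNReal.ofReal_le_ofReal hL.le
    have hd : ∀ k, eLpNorm (fun ω => ξ k ω - c - η k ω) 1 μ ≤ ENNReal.ofReal ε := fun k => by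
      have h1 : (fun ω => ξ k ω - c - η k ω) =ᵐ[μ] ζ k - μ[ζ k | F k] := by
        filter_upwards [h k, condExp_sub (hinti k) (hb k) (F k)] with ω h1 h2
        have h3 : (μ[ζ k | F k]) ω = c - (μ[fun ω => τ L (ξ k ω) | F k]) ω := by
          rw [← h1]; exact h2
        simp only [Pi.sub_apply, h3, ζ, η]
        ring
      rw [eLpNorm_congr_ae h1]
      refine (eLpNorm_sub_le (hζi k).1 integrable_condExp.1 le_rfl).trans ?_
      have h2 := eLpNorm_condExp_le_eLpNorm (m := F k) (μ := μ) (ζ k) le_rfl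
      calc _ ≤ ENNReal.ofReal (ε / 2) + ENNReal.ofReal (ε / 2) :=
            add_le_add (hζ k) (h2.trans (hζ k))
        _ = ENNReal.ofReal ε := by
            rw [← ENNReal.ofReal_add (half_pos hε).le (half_pos hε).le, add_halves]
    have e : (fun ω => (1 / (N : ℝ)) * ∑ k ∈ Finset.range N, (ξ k ω - c)
        - (1 / (N : ℝ)) * ∑ k ∈ Finset.range N, η k ω)
        = fun ω => (1 / (N : ℝ)) * ∑ k ∈ Finset.range N, (ξ k ω - c - η k ω) := by
      ext ω
      rw [← mul_sub, ← Finset.sum_sub_distrib]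
    rw [e]
    refine (eLpNorm_const_mul_le _ (eLpNorm_sum_le_ofReal le_rfl (Finset.range N)
      (b := fun _ => ε) (fun _ _ => hε.le) (fun k _ => ?_) fun k _ => hd k)).trans ?_
    · exact ((hξ0 k).aestronglyMeasurable.sub aestronglyMeasurable_const).sub (hηm0 k)
    · apply ENNReal.ofReal_le_ofReal
      rw [Finset.sum_const, Finset.card_range, nsmul_eq_mul, abs_of_nonneg (by positivity),
        ← mul_assoc]
      rcases Nat.eq_zero_or_pos N with rfl | hN
      · simpa using hε.le
      · rw [one_div_mul_cancel (by positivity), one_mul]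

end MartingaleLLN

/-! ### Innovations and second moments of the driving signals -/

section Innovation

variable {Ω : Type*} {m0 : MeasurableSpace Ω} {μ : Measure Ω} {m p : ℕ} {u : ℤ → Ω → Fin m → ℝ}
  {e : ℤ → Ω → Fin p → ℝ} {Λ : Matrix (Fin p) (Fin p) ℝ}

theorem innovPast_mono {s t : ℤ} (h : s ≤ t) : innovPast u e s ≤ innovPast u e t := by
  refine sup_le_sup le_rfl (iSup_le fun r => ?_)
  exact le_iSup (fun r : {r : ℤ // r < t} => MeasurableSpace.comap (e r) inferInstance)
    ⟨r.1, r.2.trans_le h⟩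

theorem measurable_input_innovPast (t s : ℤ) (a : Fin m) :
    Measurable[innovPast u e t] fun ω => u s ω a := by
  have h : Measurable[innovPast u e t] (u s) := by
    refine Measurable.mono (comap_measurable (u s)) ?_ le_rfl
    exact (le_iSup (fun r : ℤ => MeasurableSpace.comap (u r) inferInstance) s).trans le_sup_left
  exact (measurable_pi_apply a).comp h

theorem measurable_innov_innovPast {s t : ℤ} (h : s < t) (a : Fin p) :
    Measurable[innovPast u e t] fun ω => e s ω a := by
  have h : Measurable[innovPast u e t] (e s) := by
    refine Measurable.mono (comap_measurable (e s)) ?_ le_rfl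
    exact (le_iSup (fun r : {r : ℤ // r < t} => MeasurableSpace.comap (e r) inferInstance)
      ⟨s, h⟩).trans le_sup_right
  exact (measurable_pi_apply a).comp h

theorem memLp_coord {s : ℕ} {w : Ω → Fin s → ℝ} {q : ENNReal} (h : MemLp w q μ) (a : Fin s) :
    MemLp (fun ω => w ω a) q μ :=
  h.of_le ((continuous_apply a).comp_aestronglyMeasurable h.1)
    (Eventually.of_forall fun ω => norm_le_pi_norm (w ω) a)

theorem memLp_two_mul_of_memLp_four {X Y : Ω → ℝ} (hX : MemLp X 4 μ) (hY : MemLp Y 4 μ) :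
    MemLp (fun ω => X ω * Y ω) 2 μ := by
  have : ENNReal.HolderTriple 4 4 2 := ⟨by
    rw [show (4 : ENNReal) = 2 * 2 by norm_num, ENNReal.mul_inv (by simp) (by simp), ← mul_add,
      ENNReal.inv_two_add_inv_two, mul_one]⟩
  exact hY.mul hX

namespace IsInnovation

theorem innovPast_le (he : IsInnovation μ u e Λ) (t : ℤ) : innovPast u e t ≤ m0 :=
  sup_le (iSup_le fun s => (he.measurable_input s).comap_le)
    (iSup_le fun s => (he.measurable s).comap_le)

theorem memLp_two (he : IsInnovation μ u e Λ) (t : ℤ) (a : Fin p) :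
    MemLp (fun ω => e t ω a) 2 μ :=
  memLp_coord (((he.identDistrib t).memLp_iff).2 he.memLp) a

theorem measurable_coord (he : IsInnovation μ u e Λ) (t : ℤ) (a : Fin p) :
    Measurable fun ω => e t ω a := (measurable_pi_apply a).comp (he.measurable t)

variable [IsProbabilityMeasure μ]

theorem integral_mul_self (he : IsInnovation μ u e Λ) (t : ℤ) (a b : Fin p) :
    ∫ ω, e t ω a * e t ω b ∂μ = Λ a b := by
  rw [← integral_condExp (he.innovPast_le t), integral_congr_ae (he.condVar t a b)]
  simp

theorem variance_nonneg (he : IsInnovation μ u e Λ) (a : Fin p) : 0 ≤ Λ a a := by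
  rw [← he.integral_mul_self 0]
  exact integral_nonneg fun ω => mul_self_nonneg _

theorem eLpNorm_past_mul_le (he : IsInnovation μ u e Λ) {t : ℤ} (a : Fin p) {g : Ω → ℝ} {b : ℝ}
    (hg : AEStronglyMeasurable[innovPast u e t] g μ)
    (hgb : eLpNorm g 2 μ ≤ ENNReal.ofReal b) :
    eLpNorm (fun ω => g ω * e t ω a) 2 μ ≤ ENNReal.ofReal (√(Λ a a) * b) := by
  have h := lintegral_sq_mul_of_condExp (he.innovPast_le t) (he.memLp_two t a) (c := Λ a a)
    (by simpa [sq] using he.condVar t a a) hg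
  rw [← eLpNorm_two_sq, ← eLpNorm_two_sq] at h
  rw [ENNReal.ofReal_mul (Real.sqrt_nonneg _)]
  rw [← ENNReal.pow_le_pow_left_iff two_ne_zero, mul_pow,
    ← ENNReal.ofReal_pow (Real.sqrt_nonneg _), Real.sq_sqrt (he.variance_nonneg a)]
  simp only [mul_comm (e t _ a)] at h
  rw [h]
  gcongr

theorem condExp_past_mul (he : IsInnovation μ u e Λ) {t : ℤ} (a : Fin p) {g : Ω → ℝ}
    (hg : AEStronglyMeasurable[innovPast u e t] g μ) (hg2 : MemLp g 2 μ) :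
    μ[fun ω => g ω * e t ω a | innovPast u e t] =ᵐ[μ] fun _ => 0 := by
  have h1 := condExp_mul_of_aestronglyMeasurable_left hg
    (hg2.integrable_mul (he.memLp_two t a)) ((he.memLp_two t a).integrable (by norm_num))
  refine h1.trans ?_
  filter_upwards [he.condMean t a] with ω hω
  simp [hω]

theorem integral_past_mul (he : IsInnovation μ u e Λ) {t : ℤ} (a : Fin p) {g : Ω → ℝ}
    (hg : AEStronglyMeasurable[innovPast u e t] g μ) (hg2 : MemLp g 2 μ) :
    ∫ ω, g ω * e t ω a ∂μ = 0 := by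
  rw [← integral_condExp (he.innovPast_le t), integral_congr_ae (he.condExp_past_mul a hg hg2)]
  simp

/-- Averages of products of an innovation with variables from its past are `O(1/√N)` in mean
square. -/
theorem eLpNorm_average_le (he : IsInnovation μ u e Λ) (t : ℤ) (a : Fin p) {g : ℕ → Ω → ℝ} {b : ℝ}
    (hb : 0 ≤ b) (hg : ∀ k : ℕ, AEStronglyMeasurable[innovPast u e (t + k)] (g k) μ)
    (hgb : ∀ k, eLpNorm (g k) 2 μ ≤ ENNReal.ofReal b) (N : ℕ) :
    eLpNorm (fun ω => (1 / (N : ℝ)) * ∑ k ∈ Finset.range N, g k ω * e (t + (k : ℤ)) ω a) 2 μ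
      ≤ ENNReal.ofReal (√(Λ a a) * b / √N) := by
  have hF : Monotone fun k : ℕ => innovPast u e (t + k) := fun k l hkl =>
    innovPast_mono (by have : (k : ℤ) ≤ l := by exact_mod_cast hkl
                       linarith)
  have hL : ∀ k, MemLp (g k) 2 μ := fun k =>
    memLp_of_eLpNorm_le ((hg k).mono (he.innovPast_le _)) (hgb k)
  rw [← one_div_mul_sqrt]
  refine eLpNorm_const_mul_le _ (eLpNorm_sum_le_of_martingaleDiff hF
    (fun k => he.innovPast_le _) (by positivity) (fun k => ?_)
    (fun k => he.eLpNorm_past_mul_le a (hg k) (hgb k))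
    (fun k => he.condExp_past_mul a (hg k) (hL k)) N)
  refine ((hg k).mono (hF (Nat.le_succ k))).mul ?_
  refine (Measurable.stronglyMeasurable ?_).aestronglyMeasurable
  exact measurable_innov_innovPast (by push_cast; linarith) a

end IsInnovation

/-- The signals that drive the system: inputs and innovations. -/
noncomputable def drive (u : ℤ → Ω → Fin m → ℝ) (e : ℤ → Ω → Fin p → ℝ) :
    ℤ → Ω → Fin m ⊕ Fin p → ℝ := fun t ω => Sum.elim (u t ω) (e t ω)

/-- The sample mean of `f(k) g(k)`, `k < N`, minus the expectation of `f(0) g(0)`. -/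
noncomputable def centredMoment (μ : Measure Ω) (f g : ℤ → Ω → ℝ) (N : ℕ) (ω : Ω) : ℝ :=
  (1 / (N : ℝ)) * (∑ k ∈ Finset.range N, f k ω * g k ω) - ∫ ω', f 0 ω' * g 0 ω' ∂μ

theorem centredMoment_comm (f g : ℤ → Ω → ℝ) : centredMoment μ f g = centredMoment μ g f := by
  ext N ω
  simp only [centredMoment, mul_comm]

theorem centredMoment_eq_average {f g : ℤ → Ω → ℝ} {c : ℝ} (hc : ∫ ω, f 0 ω * g 0 ω ∂μ = c) {N : ℕ}
    (hN : 1 ≤ N) (ω : Ω) : centredMoment μ f g N ω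
      = (1 / (N : ℝ)) * ∑ k ∈ Finset.range N, (f k ω * g k ω - c) := by
  have : (N : ℝ) ≠ 0 := by positivity
  rw [centredMoment, hc, Finset.sum_sub_distrib, mul_sub, Finset.sum_const, Finset.card_range,
    nsmul_eq_mul, ← mul_assoc, one_div_mul_cancel this, one_mul]

theorem memLp_drive (hu : IsWideSenseStationary μ u) (he : IsInnovation μ u e Λ) (t : ℤ)
    (a : Fin m ⊕ Fin p) : MemLp (fun ω => drive u e t ω a) 2 μ := by
  cases a with
  | inl a => exact memLp_coord (hu.memLp t) a
  | inr a => exact he.memLp_two t a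

variable [IsProbabilityMeasure μ]

theorem IsWideSenseStationary.integral_mul (hu : IsWideSenseStationary μ u) (s s' t : ℤ)
    (a b : Fin m) :
    ∫ ω, u (s + t) ω a * u (s' + t) ω b ∂μ = ∫ ω, u s ω a * u s' ω b ∂μ := by
  have h : ∀ r r', ∫ ω, u r ω a * u r' ω b ∂μ = cov[fun ω => u (r - r') ω a, fun ω => u 0 ω b; μ]
      + (∫ ω, u 0 ω a ∂μ) * ∫ ω, u 0 ω b ∂μ := fun r r' => by
    have h1 := covariance_eq_sub (memLp_coord (hu.memLp r) a) (memLp_coord (hu.memLp r') b)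
    have h2 := hu.cov r' (r - r') a b
    rw [add_sub_cancel] at h2
    rw [h2, hu.mean r a, hu.mean r' b] at h1
    rw [h1]
    simp
  rw [h, h]
  congr 3
  ext ω
  congr 1
  ring_nf

theorem integral_input_mul_innov (hu : IsWideSenseStationary μ u) (he : IsInnovation μ u e Λ)
    (s t : ℤ) (a : Fin m) (b : Fin p) : ∫ ω, u s ω a * e t ω b ∂μ = 0 :=
  he.integral_past_mul b (measurable_input_innovPast t s a).stronglyMeasurable.aestronglyMeasurable
    (memLp_coord (hu.memLp s) a)

theorem IsInnovation.integral_mul_of_lt (he : IsInnovation μ u e Λ) {s t : ℤ} (h : s < t)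
    (a b : Fin p) : ∫ ω, e s ω a * e t ω b ∂μ = 0 :=
  he.integral_past_mul b (measurable_innov_innovPast h a).stronglyMeasurable.aestronglyMeasurable
    (he.memLp_two s a)

theorem IsInnovation.integral_mul (he : IsInnovation μ u e Λ) (s t : ℤ) (a b : Fin p) :
    ∫ ω, e s ω a * e t ω b ∂μ = if s = t then Λ a b else 0 := by
  rcases lt_trichotomy s t with h | h | h
  · rw [if_neg h.ne, he.integral_mul_of_lt h]
  · rw [if_pos h, h, he.integral_mul_self]
  · rw [if_neg h.ne']
    simp only [mul_comm (e s _ a)]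
    exact he.integral_mul_of_lt h b a

/-- The inputs and innovations together have stationary second moments. -/
theorem integral_drive_mul_drive (hu : IsWideSenseStationary μ u) (he : IsInnovation μ u e Λ)
    (s s' t : ℤ) (a b : Fin m ⊕ Fin p) :
    ∫ ω, drive u e (s + t) ω a * drive u e (s' + t) ω b ∂μ
      = ∫ ω, drive u e s ω a * drive u e s' ω b ∂μ := by
  rcases a with a | a <;> rcases b with b | b <;> simp only [drive, Sum.elim_inl, Sum.elim_inr]
  · exact hu.integral_mul s s' t a b
  · rw [integral_input_mul_innov hu he, integral_input_mul_innov hu he]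
  · simp only [mul_comm (e _ _ a)]
    rw [integral_input_mul_innov hu he, integral_input_mul_innov hu he]
  · rw [he.integral_mul, he.integral_mul]
    simp

theorem exists_eLpNorm_drive_le (hu : IsWideSenseStationary μ u) (he : IsInnovation μ u e Λ) :
    ∃ b : ℝ, 0 ≤ b ∧ ∀ t a, eLpNorm (fun ω => drive u e t ω a) 2 μ ≤ ENNReal.ofReal b := by
  refine ⟨∑ a, (eLpNorm (fun ω => drive u e 0 ω a) 2 μ).toReal,
    Finset.sum_nonneg fun a _ => ENNReal.toReal_nonneg, fun t a => ?_⟩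
  have h1 : eLpNorm (fun ω => drive u e t ω a) 2 μ = eLpNorm (fun ω => drive u e 0 ω a) 2 μ := by
    apply (ENNReal.pow_right_strictMono two_ne_zero).injective
    simp only
    rw [eLpNorm_two_sq, eLpNorm_two_sq,
      lintegral_sq_eq (memLp_drive hu he t a), lintegral_sq_eq (memLp_drive hu he 0 a)]
    congr 1
    have := integral_drive_mul_drive hu he 0 0 t a a
    simpa [sq] using this
  rw [h1]
  conv_lhs => rw [← ENNReal.ofReal_toReal (memLp_drive hu he 0 a).2.ne]
  exact ENNReal.ofReal_le_ofReal (Finset.single_le_sum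
    (f := fun a => (eLpNorm (fun ω => drive u e 0 ω a) 2 μ).toReal)
    (fun _ _ => ENNReal.toReal_nonneg) (Finset.mem_univ a))

/-- Sample cross moments of the innovations with variables from their past. -/
theorem IsInnovation.eLpNorm_centredMoment_le (he : IsInnovation μ u e Λ) (s : ℤ) (a : Fin p)
    {f : ℤ → Ω → ℝ} {b : ℝ} (hb : 0 ≤ b)
    (hf : ∀ k, AEStronglyMeasurable[innovPast u e (s + k)] (f k) μ)
    (hfb : ∀ k, eLpNorm (f k) 2 μ ≤ ENNReal.ofReal b) (N : ℕ) :
    eLpNorm (centredMoment μ f (fun t ω => e (s + t) ω a) N) 2 μ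
      ≤ ENNReal.ofReal (√(Λ a a) * b / √N) := by
  have h0 : ∫ ω, f 0 ω * e (s + 0) ω a ∂μ = 0 := he.integral_past_mul a (hf 0)
    (memLp_of_eLpNorm_le ((hf 0).mono (he.innovPast_le _)) (hfb 0))
  have h1 : centredMoment μ f (fun t ω => e (s + t) ω a) N
      = fun ω => (1 / (N : ℝ)) * ∑ k ∈ Finset.range N, f k ω * e (s + (k : ℤ)) ω a := by
    ext ω
    simp only [centredMoment, h0, sub_zero]
  rw [h1]
  exact he.eLpNorm_average_le s a (g := fun k => f k) hb (fun k => hf k) (fun k => hfb k) N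

/-- All sample cross moments of the driving signals that involve an innovation, except those of
simultaneous innovations, are `O(1/√N)` in mean square. -/
theorem exists_eLpNorm_centredMoment_drive_le (hu : IsWideSenseStationary μ u)
    (he : IsInnovation μ u e Λ) :
    ∃ c : ℝ, 0 ≤ c ∧ ∀ (s s' : ℤ) (a b : Fin m ⊕ Fin p), (∀ a' b', ¬ (a = .inl a' ∧ b = .inl b')) →
      (∀ a' b', ¬ (s = s' ∧ a = .inr a' ∧ b = .inr b')) → ∀ N : ℕ,
      eLpNorm (centredMoment μ (fun t ω => drive u e (s + t) ω a)
        (fun t ω => drive u e (s' + t) ω b) N) 2 μ ≤ ENNReal.ofReal (c / √N) := by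
  obtain ⟨b0, hb0, hb⟩ := exists_eLpNorm_drive_le hu he
  have hc : ∀ a, √(Λ a a) * b0 ≤ ∑ a, √(Λ a a) * b0 := fun a =>
    Finset.single_le_sum (f := fun a => √(Λ a a) * b0) (fun a _ => by positivity)
      (Finset.mem_univ a)
  refine ⟨∑ a, √(Λ a a) * b0, Finset.sum_nonneg fun a _ => by positivity,
    fun s s' a b h1 h2 N => ?_⟩
  have key : ∀ (f : ℤ → Ω → ℝ) (r : ℤ) (a : Fin p),
      (∀ k, AEStronglyMeasurable[innovPast u e (r + k)] (f k) μ) →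
      (∀ k, eLpNorm (f k) 2 μ ≤ ENNReal.ofReal b0) →
      eLpNorm (centredMoment μ f (fun t ω => e (r + t) ω a) N) 2 μ
        ≤ ENNReal.ofReal ((∑ a, √(Λ a a) * b0) / √N) := fun f r a hf hfb =>
    (he.eLpNorm_centredMoment_le r a hb0 hf hfb N).trans
      (ENNReal.ofReal_le_ofReal (div_le_div_of_nonneg_right (hc a) (Real.sqrt_nonneg _)))
  have hum : ∀ (r r' : ℤ) (a : Fin m), AEStronglyMeasurable[innovPast u e r'] (fun ω => u r ω a) μ :=
    fun r r' a => (measurable_input_innovPast r' r a).stronglyMeasurable.aestronglyMeasurable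
  have hem : ∀ {r r' : ℤ} (_ : r < r') (a : Fin p),
      AEStronglyMeasurable[innovPast u e r'] (fun ω => e r ω a) μ :=
    fun h a => (measurable_innov_innovPast h a).stronglyMeasurable.aestronglyMeasurable
  rcases a with a | a <;> rcases b with b | b
  · exact absurd ⟨rfl, rfl⟩ (h1 a b)
  · exact key _ s' b (fun k => hum _ _ a) (fun k => hb _ (.inl a))
  · rw [centredMoment_comm]
    exact key _ s a (fun k => hum _ _ b) (fun k => hb _ (.inl b))
  · rcases lt_trichotomy s s' with h | h | h
    · exact key _ s' b (fun k => hem (by linarith) a) (fun k => hb _ (.inr a))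
    · exact absurd ⟨h, rfl, rfl⟩ (h2 a b)
    · rw [centredMoment_comm]
      exact key _ s a (fun k => hem (by linarith) b) (fun k => hb _ (.inr b))

theorem monotone_innovPast_add (t : ℤ) : Monotone fun k : ℕ => innovPast u e (t + k) :=
  fun k l hkl => innovPast_mono (by
    have : (k : ℤ) ≤ l := by exact_mod_cast hkl
    linarith)

/-- The law of large numbers for the sample second moments of the driving signals. -/
theorem isLittleOP_centredMoment_drive (hu : IsWideSenseStationary μ u)
    (huerg : IsSecondOrderErgodic μ u) (he : IsInnovation μ u e Λ) (s s' : ℤ)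
    (a b : Fin m ⊕ Fin p) :
    IsLittleOP μ (centredMoment μ (fun t ω => drive u e (s + t) ω a)
        (fun t ω => drive u e (s' + t) ω b)) fun _ => 1 := by
  by_cases h1 : ∃ a' b', a = .inl a' ∧ b = .inl b'
  · obtain ⟨a', b', rfl, rfl⟩ := h1
    intro δ hδ
    have h2 := tendstoInMeasure_iff_norm.1 (huerg s s' a' b') δ hδ
    refine tendsto_of_tendsto_of_tendsto_of_le_of_le tendsto_const_nhds h2 (fun _ => zero_le)
      fun N => measure_mono fun ω hω => ?_
    simp only [Set.mem_ofPred_eq, abs_one, mul_one, centredMoment, drive, Sum.elim_inl,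
      add_zero] at hω
    exact hω.le
  by_cases h2 : ∃ a' b', s = s' ∧ a = .inr a' ∧ b = .inr b'
  · obtain ⟨a', b', rfl, rfl, rfl⟩ := h2
    have hm : Measurable fun v : Fin p → ℝ => v a' * v b' :=
      (measurable_pi_apply a').mul (measurable_pi_apply b')
    have h3 := isLittleOP_average_of_condExp (monotone_innovPast_add (u := u) (e := e) s)
      (fun k => he.innovPast_le _) (ξ := fun k ω => e (s + (k : ℤ)) ω a' * e (s + (k : ℤ)) ω b')
      (c := Λ a' b')
      (fun k => (measurable_innov_innovPast (by push_cast; linarith) a').mul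
        (measurable_innov_innovPast (by push_cast; linarith) b'))
      (fun k => ((he.identDistrib _).trans (he.identDistrib _).symm).comp hm)
      ((he.memLp_two _ a').integrable_mul (he.memLp_two _ b')) (fun k => he.condVar _ a' b')
    refine h3.mono_off (fun _ => ∅) (by simp) ?_
    filter_upwards [eventually_ge_atTop 1] with N hN ω _
    rw [centredMoment_eq_average (c := Λ a' b') _ hN]
    · rfl
    · simpa [drive] using he.integral_mul_self s a' b'
  · obtain ⟨c, hc0, hc⟩ := exists_eLpNorm_centredMoment_drive_le hu he
    refine IsLittleOP.of_eLpNorm_two (b := fun N => c / √N) (fun N => ?_) (fun N => by positivity)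
      (tendsto_const_div_sqrt c) (hc s s' a b 
        (fun a' b' h => h1 ⟨a', b', h⟩) (fun a' b' h => h2 ⟨a', b', h⟩))
    refine AEStronglyMeasurable.sub (AEStronglyMeasurable.const_mul ?_ _) aestronglyMeasurable_const
    exact Finset.aestronglyMeasurable_fun_sum _ fun k _ =>
      (memLp_drive hu he _ a).1.mul (memLp_drive hu he _ b).1

/-- The mean square rate for the sample second moments of the driving signals. -/
theorem exists_eLpNorm_centredMoment_drive_le_of_rate (hu : IsWideSenseStationary μ u)
    (hrate : HasRootRateMoments μ u) (he : IsInnovation μ u e Λ) (h4 : MemLp (e 0) 4 μ) :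
    ∃ c : ℝ, 0 ≤ c ∧ ∀ (s s' : ℤ) (a b : Fin m ⊕ Fin p) (N : ℕ), 1 ≤ N →
      eLpNorm (centredMoment μ (fun t ω => drive u e (s + t) ω a)
        (fun t ω => drive u e (s' + t) ω b) N) 2 μ ≤ ENNReal.ofReal (c / √N) := by
  obtain ⟨c1, hc10, hc1⟩ := exists_eLpNorm_centredMoment_drive_le hu he
  obtain ⟨hu4, c2, hc2⟩ := hrate
  let ξ : ℤ → Fin p → Fin p → Ω → ℝ := fun t a b ω => e t ω a * e t ω b - Λ a b
  have h4' : ∀ t a, MemLp (fun ω => e t ω a) 4 μ := fun t a =>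
    memLp_coord (((he.identDistrib t).memLp_iff).2 h4) a
  have hξ2 : ∀ t a b, MemLp (ξ t a b) 2 μ := fun t a b =>
    (memLp_two_mul_of_memLp_four (h4' t a) (h4' t b)).sub (memLp_const _)
  obtain ⟨c3, hc30, hc3⟩ : ∃ c3 : ℝ, 0 ≤ c3 ∧ ∀ t a b, eLpNorm (ξ t a b) 2 μ
      ≤ ENNReal.ofReal c3 := by
    refine ⟨∑ a, ∑ b, (eLpNorm (ξ 0 a b) 2 μ).toReal, Finset.sum_nonneg fun a _ =>
      Finset.sum_nonneg fun b _ => ENNReal.toReal_nonneg, fun t a b => ?_⟩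
    have hm : Measurable fun v : Fin p → ℝ => v a * v b - Λ a b :=
      ((measurable_pi_apply a).mul (measurable_pi_apply b)).sub_const _
    have h1 : eLpNorm (ξ t a b) 2 μ = eLpNorm (ξ 0 a b) 2 μ :=
      ((he.identDistrib t).comp hm).eLpNorm_eq 2
    rw [h1]
    conv_lhs => rw [← ENNReal.ofReal_toReal (hξ2 0 a b).2.ne]
    refine ENNReal.ofReal_le_ofReal ?_
    refine (Finset.single_le_sum (f := fun b => (eLpNorm (ξ 0 a b) 2 μ).toReal)
      (fun _ _ => ENNReal.toReal_nonneg) (Finset.mem_univ b)).trans ?_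
    exact Finset.single_le_sum (f := fun a => ∑ b, (eLpNorm (ξ 0 a b) 2 μ).toReal)
      (fun _ _ => Finset.sum_nonneg fun _ _ => ENNReal.toReal_nonneg) (Finset.mem_univ a)
  have hle : ∀ (c : ℝ) (N : ℕ), c ≤ c1 + √|c2| + c3 → ENNReal.ofReal (c / √N)
      ≤ ENNReal.ofReal ((c1 + √|c2| + c3) / √N) := fun c N h =>
    ENNReal.ofReal_le_ofReal (div_le_div_of_nonneg_right h (Real.sqrt_nonneg _))
  have hs2 := Real.sqrt_nonneg |c2|
  refine ⟨c1 + √|c2| + c3, by positivity, fun s s' a b N hN => ?_⟩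
  by_cases h1 : ∃ a' b', a = .inl a' ∧ b = .inl b'
  · obtain ⟨a', b', rfl, rfl⟩ := h1
    refine le_trans ?_ (hle √|c2| N (by linarith))
    have e1 : centredMoment μ (fun t ω => drive u e (s + t) ω (.inl a'))
        (fun t ω => drive u e (s' + t) ω (.inl b')) N
        = fun ω => sampleMoment u s s' a' b' N ω - ∫ ω', u s ω' a' * u s' ω' b' ∂μ := by
      ext ω
      simp [centredMoment, sampleMoment, drive]
    rw [e1, eLpNorm_two_le_iff_integral _ (by positivity)]
    · refine (hc2 s s' a' b' N hN).trans ?_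
      rw [div_pow, Real.sq_sqrt (abs_nonneg _), Real.sq_sqrt (by positivity)]
      exact div_le_div_of_nonneg_right (le_abs_self _) (by positivity)
    · have hm : ∀ k : ℕ, MemLp (fun ω => u (s + (k : ℤ)) ω a' * u (s' + (k : ℤ)) ω b') 2 μ :=
        fun k => memLp_two_mul_of_memLp_four (memLp_coord (hu4 _) a') (memLp_coord (hu4 _) b')
      have hS : MemLp (fun ω => sampleMoment u s s' a' b' N ω) 2 μ := by
        unfold sampleMoment
        exact (memLp_finsetSum _ fun k _ => hm k).const_mul _
      exact hS.sub (memLp_const _)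
  by_cases h2 : ∃ a' b', s = s' ∧ a = .inr a' ∧ b = .inr b'
  · obtain ⟨a', b', rfl, rfl, rfl⟩ := h2
    refine le_trans ?_ (hle c3 N (by linarith))
    have e1 : centredMoment μ (fun t ω => drive u e (s + t) ω (.inr a'))
        (fun t ω => drive u e (s + t) ω (.inr b')) N
        = fun ω => (1 / (N : ℝ)) * ∑ k ∈ Finset.range N, ξ (s + (k : ℤ)) a' b' ω := by
      ext ω
      rw [centredMoment_eq_average (c := Λ a' b') _ hN]
      · rfl
      · simpa [drive] using he.integral_mul_self s a' b'
    rw [e1, ← one_div_mul_sqrt]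
    refine eLpNorm_const_mul_le _ (eLpNorm_sum_le_of_martingaleDiff
      (monotone_innovPast_add (u := u) (e := e) s) (fun k => he.innovPast_le _) hc30 (fun k => ?_)
      (fun k => hc3 _ a' b') (fun k => ?_) N)
    · refine (Measurable.stronglyMeasurable ?_).aestronglyMeasurable
      exact ((measurable_innov_innovPast (by push_cast; linarith) a').mul
        (measurable_innov_innovPast (by push_cast; linarith) b')).sub_const _
    · have h3 := condExp_sub ((he.memLp_two (s + k) a').integrable_mul (he.memLp_two (s + k) b'))
        (integrable_const (Λ a' b')) (innovPast u e (s + k))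
      refine h3.trans ?_
      filter_upwards [he.condVar (s + k) a' b'] with ω hω
      have h4 : (fun ω => e (s + k) ω a') * (fun ω => e (s + k) ω b')
        = fun ω => e (s + k) ω a' * e (s + k) ω b' := rfl
      rw [Pi.sub_apply, h4, hω, condExp_const (he.innovPast_le _)]
      simp
  · exact (hc1 s s' a b 
        (fun a' b' h => h1 ⟨a', b', h⟩) (fun a' b' h => h2 ⟨a', b', h⟩) N).trans
      (hle c1 N (by linarith))

end Innovation

/-! ### Spectral bounds for linear combinations of inputs and innovations -/

section Spectral

variable {m : ℕ}

/-- The trigonometric polynomial `∑ i < N, b i exp(-I (τ i) θ)` with vector coefficients. -/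
noncomputable def trigVec (N : ℕ) (τ : ℕ → ℤ) (b : ℕ → Fin m → ℝ) (θ : ℝ) : Fin m → ℂ := fun a =>
  ∑ i ∈ Finset.range N, (b i a : ℂ) * Complex.exp (-(Complex.I * (τ i : ℂ) * (θ : ℂ)))

theorem star_trigVec_dotProduct (N : ℕ) (τ : ℕ → ℤ) (b : ℕ → Fin m → ℝ) (θ : ℝ)
    (g : Matrix (Fin m) (Fin m) ℂ) :
    star (trigVec N τ b θ) ⬝ᵥ g *ᵥ trigVec N τ b θ
      = ∑ q ∈ Finset.range N ×ˢ Finset.univ, ∑ q' ∈ Finset.range N ×ˢ Finset.univ,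
        ((b q.1 q.2 * b q'.1 q'.2 : ℝ) : ℂ) *
          (Complex.exp (Complex.I * ((τ q.1 - τ q'.1 : ℤ) : ℂ) * (θ : ℂ)) * g q.2 q'.2) := by
  have h1 : ∀ a, star (trigVec N τ b θ) a
      = ∑ i ∈ Finset.range N, (b i a : ℂ) * Complex.exp (Complex.I * (τ i : ℂ) * (θ : ℂ)) := by
    intro a
    simp only [trigVec, Pi.star_apply, star_sum, star_mul', Complex.star_def, Complex.conj_ofReal,
      ← Complex.exp_conj, map_neg, map_mul, Complex.conj_I, map_intCast]
    refine Finset.sum_congr rfl fun i _ => ?_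
    congr 2
    ring
  simp only [dotProduct, mulVec, h1, Finset.sum_product]
  simp only [trigVec, Finset.sum_mul, Finset.mul_sum]
  refine (Finset.sum_congr rfl fun a _ => (Finset.sum_comm.trans
    (Finset.sum_congr rfl fun j _ => Finset.sum_comm)).trans Finset.sum_comm).trans
    (Finset.sum_comm.trans ?_)
  refine Finset.sum_congr rfl fun i _ => Finset.sum_congr rfl fun a _ =>
    Finset.sum_congr rfl fun j _ => Finset.sum_congr rfl fun a' _ => ?_
  have h2 : Complex.exp (Complex.I * ((τ i - τ j : ℤ) : ℂ) * (θ : ℂ))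
      = Complex.exp (Complex.I * (τ i : ℂ) * (θ : ℂ))
        * Complex.exp (-(Complex.I * (τ j : ℂ) * (θ : ℂ))) := by
    rw [← Complex.exp_add]; congr 1; push_cast; ring
  rw [h2]
  push_cast
  ring

theorem integrableOn_exp_mul {g : ℝ → ℂ} (k : ℤ)
    (hg : IntegrableOn g (Set.Ioc (-Real.pi) Real.pi)) :
    IntegrableOn (fun θ : ℝ => Complex.exp (Complex.I * (k : ℂ) * (θ : ℂ)) * g θ)
      (Set.Ioc (-Real.pi) Real.pi) := by
  refine Integrable.bdd_mul (c := 1) hg ?_ (Eventually.of_forall fun θ => ?_)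
  · exact (Continuous.aestronglyMeasurable (by fun_prop))
  · have : Complex.I * (k : ℂ) * (θ : ℂ) = ((k * θ : ℝ) : ℂ) * Complex.I := by push_cast; ring
    rw [this, Complex.norm_exp_ofReal_mul_I]

theorem setIntegral_star_trigVec_dotProduct (N : ℕ) (τ : ℕ → ℤ) (b : ℕ → Fin m → ℝ)
    {g : ℝ → Matrix (Fin m) (Fin m) ℂ}
    (hg : ∀ a a', IntegrableOn (fun θ => g θ a a') (Set.Ioc (-Real.pi) Real.pi)) :
    IntegrableOn (fun θ => star (trigVec N τ b θ) ⬝ᵥ g θ *ᵥ trigVec N τ b θ)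
      (Set.Ioc (-Real.pi) Real.pi) ∧
    ∫ θ in Set.Ioc (-Real.pi) Real.pi, star (trigVec N τ b θ) ⬝ᵥ g θ *ᵥ trigVec N τ b θ
      = ∑ q ∈ Finset.range N ×ˢ Finset.univ, ∑ q' ∈ Finset.range N ×ˢ Finset.univ,
        ((b q.1 q.2 * b q'.1 q'.2 : ℝ) : ℂ) *
          ∫ θ in Set.Ioc (-Real.pi) Real.pi,
            Complex.exp (Complex.I * ((τ q.1 - τ q'.1 : ℤ) : ℂ) * (θ : ℂ)) * g θ q.2 q'.2 := by
  simp only [star_trigVec_dotProduct]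
  have h1 : ∀ q q' : ℕ × Fin m, Integrable (fun θ : ℝ => ((b q.1 q.2 * b q'.1 q'.2 : ℝ) : ℂ) *
      (Complex.exp (Complex.I * ((τ q.1 - τ q'.1 : ℤ) : ℂ) * (θ : ℂ)) * g θ q.2 q'.2))
      (volume.restrict (Set.Ioc (-Real.pi) Real.pi)) := fun q q' =>
    (integrableOn_exp_mul (τ q.1 - τ q'.1) (hg q.2 q'.2)).const_mul _
  refine ⟨integrable_finsetSum _ fun q _ => integrable_finsetSum _ fun q' _ => h1 q q', ?_⟩
  rw [integral_finsetSum _ fun q _ => integrable_finsetSum _ fun q' _ => h1 q q']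
  refine Finset.sum_congr rfl fun q _ => ?_
  rw [integral_finsetSum _ fun q' _ => h1 q q']
  exact Finset.sum_congr rfl fun q' _ => integral_const_mul _ _

theorem setIntegral_exp_int_mul (k : ℤ) :
    ∫ θ in Set.Ioc (-Real.pi) Real.pi, Complex.exp (Complex.I * (k : ℂ) * (θ : ℂ))
      = if k = 0 then 2 * (Real.pi : ℂ) else 0 := by
  rw [← intervalIntegral.integral_of_le (by linarith [Real.pi_pos])]
  split_ifs with h
  · subst h
    simp
    ring
  · have hk : Complex.I * (k : ℂ) ≠ 0 := mul_ne_zero Complex.I_ne_zero (by exact_mod_cast h)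
    rw [integral_exp_mul_complex hk]
    have h2 : Complex.exp (Complex.I * (k : ℂ) * (Real.pi : ℂ))
        = Complex.exp (Complex.I * (k : ℂ) * ((-Real.pi : ℝ) : ℂ)) := by
      rw [show Complex.I * (k : ℂ) * (Real.pi : ℂ) = Complex.I * (k : ℂ) * ((-Real.pi : ℝ) : ℂ)
        + (k : ℂ) * (2 * (Real.pi : ℂ) * Complex.I) by push_cast; ring, Complex.exp_add,
        Complex.exp_int_mul_two_pi_mul_I, mul_one]
    rw [h2]
    simp

/-- Parseval's identity for trigonometric polynomials. -/
theorem setIntegral_trigVec_sq (N : ℕ) {τ : ℕ → ℤ} (hτ : Function.Injective τ)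
    (b : ℕ → Fin m → ℝ) :
    ∫ θ in Set.Ioc (-Real.pi) Real.pi,
        star (trigVec N τ b θ) ⬝ᵥ (1 : Matrix (Fin m) (Fin m) ℂ) *ᵥ trigVec N τ b θ
      = ((2 * Real.pi * ∑ i ∈ Finset.range N, ∑ a, b i a ^ 2 : ℝ) : ℂ) := by
  have hg : ∀ a a' : Fin m, IntegrableOn (fun _ : ℝ => (1 : Matrix (Fin m) (Fin m) ℂ) a a')
      (Set.Ioc (-Real.pi) Real.pi) := fun a a' => integrableOn_const (by simp)
  rw [(setIntegral_star_trigVec_dotProduct N τ b hg).2]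
  rw [Finset.mul_sum, Complex.ofReal_sum, Finset.sum_product]
  refine Finset.sum_congr rfl fun i hi => ?_
  rw [Finset.mul_sum, Complex.ofReal_sum]
  refine Finset.sum_congr rfl fun a _ => ?_
  rw [Finset.sum_eq_single (i, a)]
  · simp only [sub_self, one_apply_eq, mul_one]
    rw [setIntegral_exp_int_mul]
    push_cast
    ring
  · rintro ⟨j, a'⟩ _ hne
    rw [integral_mul_const, setIntegral_exp_int_mul]
    by_cases h : a = a'
    · have hij : i ≠ j := fun hij => hne (by rw [h, hij])
      rw [if_neg (sub_ne_zero.2 (hτ.ne hij))]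
      simp
    · rw [one_apply_ne h]
      simp
  · intro h
    exact absurd (Finset.mem_product.2 ⟨hi, Finset.mem_univ a⟩) h

theorem quadraticForm_le_of_posSemidef_sub {g h : Matrix (Fin m) (Fin m) ℂ}
    (hgh : (g - h).PosSemidef) (v : Fin m → ℂ) :
    (star v ⬝ᵥ h *ᵥ v).re ≤ (star v ⬝ᵥ g *ᵥ v).re := by
  have := hgh.re_dotProduct_nonneg v
  rw [Matrix.sub_mulVec, dotProduct_sub, map_sub] at this
  simpa using this

variable {Ω : Type*} {m0 : MeasurableSpace Ω} {μ : Measure Ω} [IsProbabilityMeasure μ]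
  {u : ℤ → Ω → Fin m → ℝ}

/-- Upper and lower spectral bounds for the variance of a linear combination of inputs. -/
theorem HasBoundedFullRankSpectrum.exists_variance_bounds (hs : HasBoundedFullRankSpectrum μ u)
    (hu : ∀ t, MemLp (u t) 2 μ) :
    ∃ c C : ℝ, 0 < c ∧ 0 ≤ C ∧ ∀ (N : ℕ) (τ : ℕ → ℤ), Function.Injective τ →
      ∀ b : ℕ → Fin m → ℝ,
      c * ∑ i ∈ Finset.range N, ∑ a, b i a ^ 2
        ≤ Var[fun ω => ∑ i ∈ Finset.range N, ∑ a, b i a * u (τ i) ω a; μ] ∧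
      Var[fun ω => ∑ i ∈ Finset.range N, ∑ a, b i a * u (τ i) ω a; μ]
        ≤ C * ∑ i ∈ Finset.range N, ∑ a, b i a ^ 2 := by
  obtain ⟨f, hf, c, C, hc, hb⟩ := hs
  refine ⟨c, |C|, hc, abs_nonneg C, fun N τ hτ b => ?_⟩
  obtain ⟨hi, hint⟩ := setIntegral_star_trigVec_dotProduct N τ b hf.integrable
  have hsum : (fun ω => ∑ i ∈ Finset.range N, ∑ a, b i a * u (τ i) ω a)
      = fun ω => ∑ q ∈ Finset.range N ×ˢ Finset.univ, b q.1 q.2 * u (τ q.1) ω q.2 := by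
    ext ω; rw [Finset.sum_product]
  have hvar : ((Var[fun ω => ∑ i ∈ Finset.range N, ∑ a, b i a * u (τ i) ω a; μ] : ℝ) : ℂ)
      = (1 / (2 * (Real.pi : ℂ))) * ∫ θ in Set.Ioc (-Real.pi) Real.pi,
        star (trigVec N τ b θ) ⬝ᵥ f θ *ᵥ trigVec N τ b θ := by
    rw [hsum, variance_fun_sum' fun q _ => (memLp_coord (hu _) q.2).const_mul _, hint,
      Finset.mul_sum, Complex.ofReal_sum]
    refine Finset.sum_congr rfl fun q _ => ?_
    rw [Finset.mul_sum, Complex.ofReal_sum]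
    refine Finset.sum_congr rfl fun q' _ => ?_
    have h1 := hf.cov (τ q'.1) (τ q.1 - τ q'.1) q.2 q'.2
    rw [add_sub_cancel] at h1
    rw [covariance_const_mul_left, covariance_const_mul_right]
    push_cast
    rw [h1]
    push_cast
    ring
  have hvar' : Var[fun ω => ∑ i ∈ Finset.range N, ∑ a, b i a * u (τ i) ω a; μ]
      = (1 / (2 * Real.pi)) * ∫ θ in Set.Ioc (-Real.pi) Real.pi,
        (star (trigVec N τ b θ) ⬝ᵥ f θ *ᵥ trigVec N τ b θ).re := by
    have h1 := integral_re (𝕜 := ℂ) hi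
    simp only [RCLike.re_eq_complex_re] at h1
    rw [h1]
    have h2 := congrArg Complex.re hvar
    rw [Complex.ofReal_re, show (1 / (2 * (Real.pi : ℂ))) = ((1 / (2 * Real.pi) : ℝ) : ℂ) by
      push_cast; rfl, Complex.re_ofReal_mul] at h2
    exact h2
  have hone : ∀ r : ℝ, IntegrableOn (fun θ => (star (trigVec N τ b θ) ⬝ᵥ
        ((r : ℂ) • (1 : Matrix (Fin m) (Fin m) ℂ)) *ᵥ trigVec N τ b θ).re)
        (Set.Ioc (-Real.pi) Real.pi) ∧
      (1 / (2 * Real.pi)) * ∫ θ in Set.Ioc (-Real.pi) Real.pi,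
      (star (trigVec N τ b θ) ⬝ᵥ ((r : ℂ) • (1 : Matrix (Fin m) (Fin m) ℂ)) *ᵥ trigVec N τ b θ).re
      = r * ∑ i ∈ Finset.range N, ∑ a, b i a ^ 2 := fun r => by
    have hg : ∀ a a' : Fin m, IntegrableOn (fun _ : ℝ => (1 : Matrix (Fin m) (Fin m) ℂ) a a')
      (Set.Ioc (-Real.pi) Real.pi) := fun a a' => integrableOn_const (by simp)
    have h0 := (setIntegral_star_trigVec_dotProduct N τ b hg).1
    have h1 := integral_re (𝕜 := ℂ) h0
    rw [setIntegral_trigVec_sq N hτ b] at h1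
    simp only [RCLike.re_eq_complex_re, Complex.ofReal_re] at h1
    simp only [Matrix.smul_mulVec, dotProduct_smul, smul_eq_mul, Complex.re_ofReal_mul]
    refine ⟨(Integrable.re h0).const_mul r, ?_⟩
    rw [integral_const_mul, h1]
    have := Real.pi_pos
    field_simp
  have hpi : 0 ≤ 1 / (2 * Real.pi) := by have := Real.pi_pos; positivity
  constructor
  · rw [hvar', ← (hone c).2]
    refine mul_le_mul_of_nonneg_left (integral_mono_ae (hone c).1 (Integrable.re hi) ?_) hpi
    filter_upwards [hb] with θ hθ
    exact quadraticForm_le_of_posSemidef_sub hθ.1 _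
  · refine le_trans ?_ (mul_le_mul_of_nonneg_right (le_abs_self C)
      (Finset.sum_nonneg fun i _ => Finset.sum_nonneg fun a _ => sq_nonneg _))
    rw [hvar', ← (hone C).2]
    refine mul_le_mul_of_nonneg_left (integral_mono_ae (Integrable.re hi) (hone C).1 ?_) hpi
    filter_upwards [hb] with θ hθ
    exact quadraticForm_le_of_posSemidef_sub hθ.2 _

end Spectral

theorem exists_pos_le_quadraticForm {p : ℕ} {Λ : Matrix (Fin p) (Fin p) ℝ} (hΛ : Λ.PosDef) :
    ∃ c : ℝ, 0 < c ∧ ∀ v : Fin p → ℝ, c * ∑ a, v a ^ 2 ≤ ∑ a, ∑ b, v a * v b * Λ a b := by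
  have hform : ∀ v : Fin p → ℝ, star v ⬝ᵥ Λ *ᵥ v = ∑ a, ∑ b, v a * v b * Λ a b := fun v => by
    simp only [dotProduct, mulVec, Finset.mul_sum, Pi.star_apply, star_trivial]
    exact Finset.sum_congr rfl fun a _ => Finset.sum_congr rfl fun b _ => by ring
  rcases Nat.eq_zero_or_pos p with rfl | hp
  · exact ⟨1, one_pos, fun v => by simp⟩
  have : Nonempty (Fin p) := ⟨⟨0, hp⟩⟩
  have hcont : Continuous fun v : EuclideanSpace ℝ (Fin p) =>
      ∑ a, ∑ b, v a * v b * Λ a b := by fun_prop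
  obtain ⟨w, hw, hmin⟩ := (isCompact_sphere (0 : EuclideanSpace ℝ (Fin p)) 1).exists_isMinOn
    (NormedSpace.sphere_nonempty.2 zero_le_one) hcont.continuousOn
  have hw1 : ‖w‖ = 1 := by simpa using hw
  have hw0 : (fun a => w a) ≠ 0 := fun h => by
    have : w = 0 := by ext a; exact congrFun h a
    rw [this] at hw1
    simp at hw1
  have hpos := hΛ.dotProduct_mulVec_pos hw0
  rw [hform] at hpos
  refine ⟨_, hpos, fun v => ?_⟩
  rcases eq_or_ne (euclNorm v) 0 with h0 | h0
  · have : v = 0 := by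
      have := norm_eq_zero.1 h0
      ext a; exact congrArg (fun z : EuclideanSpace ℝ (Fin p) => z a) this
    simp [this]
  · have h1 : WithLp.toLp 2 ((euclNorm v)⁻¹ • v) ∈ Metric.sphere (0 : EuclideanSpace ℝ (Fin p)) 1 := by
      rw [mem_sphere_zero_iff_norm, WithLp.toLp_smul, norm_smul, Real.norm_eq_abs,
        abs_of_nonneg (inv_nonneg.2 (euclNorm_nonneg v))]
      exact inv_mul_cancel₀ h0
    have h2 := hmin h1
    simp only [Set.mem_ofPred_eq, Pi.smul_apply, smul_eq_mul] at h2
    have h3 : ∑ a, ∑ b, (euclNorm v)⁻¹ * v a * ((euclNorm v)⁻¹ * v b) * Λ a b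
        = (euclNorm v ^ 2)⁻¹ * ∑ a, ∑ b, v a * v b * Λ a b := by
      simp only [Finset.mul_sum]
      refine Finset.sum_congr rfl fun a _ => Finset.sum_congr rfl fun b _ => ?_
      rw [← inv_pow]; ring
    rw [h3] at h2
    rw [← euclNorm_sq]
    have h4 : 0 < euclNorm v ^ 2 := by positivity
    rw [inv_mul_eq_div, le_div_iff₀ h4] at h2
    exact h2

section DriveBounds

variable {Ω : Type*} {m0 : MeasurableSpace Ω} {μ : Measure Ω} [IsProbabilityMeasure μ] {m p : ℕ}
  {u : ℤ → Ω → Fin m → ℝ} {e : ℤ → Ω → Fin p → ℝ} {Λ : Matrix (Fin p) (Fin p) ℝ}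

theorem IsInnovation.integral_sq_sum (he : IsInnovation μ u e Λ) (N : ℕ) {τ : ℕ → ℤ}
    (hτ : Function.Injective τ) (d : ℕ → Fin p → ℝ) :
    ∫ ω, (∑ i ∈ Finset.range N, ∑ a, d i a * e (τ i) ω a) ^ 2 ∂μ
      = ∑ i ∈ Finset.range N, ∑ a, ∑ b, d i a * d i b * Λ a b := by
  have hm : ∀ (i j : ℕ) (a b : Fin p),
      Integrable (fun ω => d i a * d j b * (e (τ i) ω a * e (τ j) ω b)) μ := fun i j a b =>
    ((he.memLp_two _ a).integrable_mul (he.memLp_two _ b)).const_mul _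
  have hX : ∀ i, MemLp (fun ω => ∑ a, d i a * e (τ i) ω a) 2 μ := fun i =>
    memLp_finsetSum _ fun a _ => (he.memLp_two _ a).const_mul _
  have hmul : ∀ i j, ∫ ω, (∑ a, d i a * e (τ i) ω a) * (∑ b, d j b * e (τ j) ω b) ∂μ
      = ∑ a, ∑ b, d i a * d j b * if τ i = τ j then Λ a b else 0 := fun i j => by
    have e1 : ∀ ω, (∑ a, d i a * e (τ i) ω a) * (∑ b, d j b * e (τ j) ω b)
        = ∑ a, ∑ b, d i a * d j b * (e (τ i) ω a * e (τ j) ω b) := fun ω => by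
      rw [Finset.sum_mul_sum]
      exact Finset.sum_congr rfl fun a _ => Finset.sum_congr rfl fun b _ => by ring
    simp only [e1]
    rw [integral_finsetSum _ fun a _ => integrable_finsetSum _ fun b _ => hm i j a b]
    refine Finset.sum_congr rfl fun a _ => ?_
    rw [integral_finsetSum _ fun b _ => hm i j a b]
    refine Finset.sum_congr rfl fun b _ => ?_
    rw [integral_const_mul, he.integral_mul]
  rw [integral_sq_sum_of_orthogonal hX]
  · refine Finset.sum_congr rfl fun i _ => ?_
    simp only [sq]
    rw [hmul]
    simp
  · intro k l hkl
    rw [hmul]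
    simp [hτ.ne hkl.ne]

/-- Inputs with a spectral density bounded away from zero and nondegenerate innovations are jointly
persistently exciting: their linear combinations are bounded below in mean square. -/
theorem exists_le_integral_sq_drive (hu : ∀ t, MemLp (u t) 2 μ) (he : IsInnovation μ u e Λ)
    (hs : HasBoundedFullRankSpectrum μ u) (hΛ : Λ.PosDef) :
    ∃ c : ℝ, 0 < c ∧ ∀ (N : ℕ) (τ : ℕ → ℤ), Function.Injective τ →
      ∀ (b : ℕ → Fin m → ℝ) (d : ℕ → Fin p → ℝ),
      c * ∑ i ∈ Finset.range N, (∑ a, b i a ^ 2 + ∑ a, d i a ^ 2)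
        ≤ ∫ ω, (∑ i ∈ Finset.range N, (∑ a, b i a * u (τ i) ω a + ∑ a, d i a * e (τ i) ω a)) ^ 2
          ∂μ := by
  obtain ⟨c1, C, hc1, -, h1⟩ := hs.exists_variance_bounds hu
  obtain ⟨c2, hc2, h2⟩ := exists_pos_le_quadraticForm hΛ
  refine ⟨min c1 c2, lt_min hc1 hc2, fun N τ hτ b d => ?_⟩
  have hX : MemLp (fun ω => ∑ i ∈ Finset.range N, ∑ a, b i a * u (τ i) ω a) 2 μ :=
    memLp_finsetSum _ fun i _ => memLp_finsetSum _ fun a _ => (memLp_coord (hu _) a).const_mul _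
  have hY : MemLp (fun ω => ∑ i ∈ Finset.range N, ∑ a, d i a * e (τ i) ω a) 2 μ :=
    memLp_finsetSum _ fun i _ => memLp_finsetSum _ fun a _ => (he.memLp_two _ a).const_mul _
  -- the inputs belong to the past of every innovation, so the cross term vanishes
  have hXY : ∫ ω, (∑ i ∈ Finset.range N, ∑ a, b i a * u (τ i) ω a)
      * (∑ i ∈ Finset.range N, ∑ a, d i a * e (τ i) ω a) ∂μ = 0 := by
    have hXm : ∀ t, AEStronglyMeasurable[innovPast u e t]
        (fun ω => ∑ i ∈ Finset.range N, ∑ a, b i a * u (τ i) ω a) μ := fun t =>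
      Measurable.aestronglyMeasurable <| Finset.measurable_fun_sum _ fun i _ =>
        Finset.measurable_fun_sum _ fun a _ => (measurable_input_innovPast t _ a).const_mul _
    have e1 : ∀ ω, (∑ i ∈ Finset.range N, ∑ a, b i a * u (τ i) ω a)
        * (∑ i ∈ Finset.range N, ∑ a, d i a * e (τ i) ω a)
        = ∑ i ∈ Finset.range N, ∑ a, d i a *
          ((∑ i ∈ Finset.range N, ∑ a, b i a * u (τ i) ω a) * e (τ i) ω a) := fun ω => by
      rw [Finset.mul_sum]
      refine Finset.sum_congr rfl fun i _ => ?_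
      rw [Finset.mul_sum]
      exact Finset.sum_congr rfl fun a _ => by ring
    have hi : ∀ i a, Integrable (fun ω => d i a *
          ((∑ i ∈ Finset.range N, ∑ a, b i a * u (τ i) ω a) * e (τ i) ω a)) μ := fun i a =>
      (hX.integrable_mul (he.memLp_two _ a)).const_mul _
    simp only [e1]
    rw [integral_finsetSum _ fun i _ => integrable_finsetSum _ fun a _ => hi i a]
    refine Finset.sum_eq_zero fun i _ => ?_
    rw [integral_finsetSum _ fun a _ => hi i a]
    refine Finset.sum_eq_zero fun a _ => ?_
    rw [integral_const_mul, he.integral_past_mul a (hXm _) hX, mul_zero]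
  have e2 : ∀ ω, (∑ i ∈ Finset.range N,
      (∑ a, b i a * u (τ i) ω a + ∑ a, d i a * e (τ i) ω a)) ^ 2
      = ((∑ i ∈ Finset.range N, ∑ a, b i a * u (τ i) ω a) ^ 2
        + (∑ i ∈ Finset.range N, ∑ a, d i a * e (τ i) ω a) ^ 2)
        + 2 * ((∑ i ∈ Finset.range N, ∑ a, b i a * u (τ i) ω a)
        * (∑ i ∈ Finset.range N, ∑ a, d i a * e (τ i) ω a)) := fun ω => by
    rw [Finset.sum_add_distrib]; ring
  simp only [e2]
  have i1 : Integrable (fun ω => (∑ i ∈ Finset.range N, ∑ a, b i a * u (τ i) ω a) ^ 2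
      + (∑ i ∈ Finset.range N, ∑ a, d i a * e (τ i) ω a) ^ 2) μ :=
    hX.integrable_sq.add hY.integrable_sq
  have i2 : Integrable (fun ω => 2 * ((∑ i ∈ Finset.range N, ∑ a, b i a * u (τ i) ω a)
        * (∑ i ∈ Finset.range N, ∑ a, d i a * e (τ i) ω a))) μ :=
    (hX.integrable_mul hY).const_mul 2
  rw [integral_add i1 i2, integral_add hX.integrable_sq hY.integrable_sq, integral_const_mul, hXY,
    mul_zero, add_zero, Finset.sum_add_distrib, mul_add]
  refine add_le_add ?_ ?_
  · -- the mean of the inputs need not vanish; it can only increase the second moment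
    have h3 := (h1 N τ hτ b).1
    have h4 := variance_le_expectation_sq hX.1
    refine le_trans ?_ (h3.trans h4)
    exact mul_le_mul_of_nonneg_right (min_le_left _ _)
      (Finset.sum_nonneg fun i _ => Finset.sum_nonneg fun a _ => sq_nonneg _)
  · rw [he.integral_sq_sum N hτ, Finset.mul_sum]
    refine Finset.sum_le_sum fun i _ => le_trans ?_ (h2 (d i))
    exact mul_le_mul_of_nonneg_right (min_le_right _ _)
      (Finset.sum_nonneg fun a _ => sq_nonneg _)

/-- Weighted sums of one driving signal have a variance that is bounded by the sum of the squared
weights. -/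
theorem exists_eLpNorm_weighted_drive_le (hu : ∀ t, MemLp (u t) 2 μ) (he : IsInnovation μ u e Λ)
    (hs : HasBoundedFullRankSpectrum μ u) :
    ∃ C : ℝ, 0 ≤ C ∧ ∀ (s : ℤ) (a : Fin m ⊕ Fin p) (N : ℕ) (w : ℕ → ℝ),
      eLpNorm (fun ω => ∑ k ∈ Finset.range N,
        w k * (drive u e (s + k) ω a - ∫ ω', drive u e (s + k) ω' a ∂μ)) 2 μ
        ≤ ENNReal.ofReal (C * √(∑ k ∈ Finset.range N, w k ^ 2)) := by
  classical
  obtain ⟨c1, C1, -, hC1, h1⟩ := hs.exists_variance_bounds hu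
  have hinj : ∀ s : ℤ, Function.Injective fun k : ℕ => s + (k : ℤ) := fun s k l h => by
    have : (k : ℤ) = l := by simpa using h
    exact_mod_cast this
  have hle : ∀ a, Λ a a ≤ ∑ a, Λ a a := fun a =>
    Finset.single_le_sum (f := fun a => Λ a a) (fun a _ => he.variance_nonneg a) (Finset.mem_univ a)
  have hΛ0 : 0 ≤ ∑ a, Λ a a := Finset.sum_nonneg fun a _ => he.variance_nonneg a
  refine ⟨√(C1 + ∑ a, Λ a a), Real.sqrt_nonneg _, fun s a N w => ?_⟩
  have hw0 : 0 ≤ ∑ k ∈ Finset.range N, w k ^ 2 := Finset.sum_nonneg fun k _ => sq_nonneg _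
  have hm : ∀ t, MemLp (fun ω => drive u e t ω a) 2 μ := fun t => by
    cases a with
    | inl a => exact memLp_coord (hu t) a
    | inr a => exact he.memLp_two t a
  have hX : MemLp (fun ω => ∑ k ∈ Finset.range N,
        w k * (drive u e (s + k) ω a - ∫ ω', drive u e (s + k) ω' a ∂μ)) 2 μ :=
    memLp_finsetSum _ fun k _ => ((hm _).sub (memLp_const _)).const_mul _
  rw [eLpNorm_two_le_iff_integral hX (by positivity), mul_pow, Real.sq_sqrt (by positivity),
    Real.sq_sqrt hw0]
  cases a with
  | inl a =>
    have h2 := (h1 N _ (hinj s) (fun k => Pi.single a (w k))).2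
    have h3 : ∀ k ω, ∑ b, (Pi.single a (w k) : Fin m → ℝ) b * u (s + (k : ℤ)) ω b
        = w k * u (s + (k : ℤ)) ω a := fun k ω => by
      rw [Finset.sum_eq_single a (fun b _ hb => by simp [hb]) (by simp)]
      simp
    have h4 : ∀ k, ∑ b, (Pi.single a (w k) : Fin m → ℝ) b ^ 2 = w k ^ 2 := fun k => by
      rw [Finset.sum_eq_single a (fun b _ hb => by simp [hb]) (by simp)]
      simp
    simp only [h3, h4] at h2
    have hmX : ∀ k ∈ Finset.range N, MemLp (fun ω => w k * u (s + (k : ℤ)) ω a) 2 μ :=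
      fun k _ => (memLp_coord (hu _) a).const_mul _
    rw [variance_eq_integral (memLp_finsetSum _ hmX).aemeasurable,
      integral_finsetSum _ fun k hk => (hmX k hk).integrable (by norm_num)] at h2
    simp only [integral_const_mul, ← Finset.sum_sub_distrib, ← mul_sub] at h2
    refine h2.trans (mul_le_mul_of_nonneg_right (by linarith) hw0)
  | inr a =>
    have h0 : ∀ t, ∫ ω, e t ω a ∂μ = 0 := fun t => by
      rw [← integral_condExp (he.innovPast_le t), integral_congr_ae (he.condMean t a)]
      simp
    have h2 := he.integral_sq_sum N (hinj s) (fun k => Pi.single a (w k))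
    have h3 : ∀ k ω, ∑ b, (Pi.single a (w k) : Fin p → ℝ) b * e (s + (k : ℤ)) ω b
        = w k * e (s + (k : ℤ)) ω a := fun k ω => by
      rw [Finset.sum_eq_single a (fun b _ hb => by simp [hb]) (by simp)]
      simp
    have h4 : ∀ k, ∑ b, ∑ c, (Pi.single a (w k) : Fin p → ℝ) b
        * (Pi.single a (w k) : Fin p → ℝ) c * Λ b c = w k ^ 2 * Λ a a := fun k => by
      rw [Finset.sum_eq_single a (fun b _ hb => by simp [hb]) (by simp),
        Finset.sum_eq_single a (fun b _ hb => by simp [hb]) (by simp)]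
      simp [sq]
    simp only [h3, h4] at h2
    simp only [drive, Sum.elim_inr, h0, sub_zero]
    rw [h2, ← Finset.sum_mul, mul_comm]
    exact mul_le_mul_of_nonneg_right (by linarith [hle a]) hw0

end DriveBounds

/-! ### Signals obtained by summable filtering -/

section Filtered

variable {Ω : Type*} {m0 : MeasurableSpace Ω} {μ : Measure Ω} {ι : Type*}

/-- `IsFiltered μ w G f`: the scalar signal `f` is the output of a linear time-invariant filter
driven by the vector signal `w`, whose impulse response has `ℓ¹` norm at most `G`. Such signals are
generated by the shifted components of `w` under linear combinations and under mean square limits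
that are uniform in time. -/
inductive IsFiltered (μ : Measure Ω) (w : ℤ → Ω → ι → ℝ) : ℝ → (ℤ → Ω → ℝ) → Prop
  | zero : IsFiltered μ w 0 fun _ _ => 0
  | shift (s : ℤ) (a : ι) : IsFiltered μ w 1 fun t ω => w (s + t) ω a
  | add {G G' : ℝ} {f g : ℤ → Ω → ℝ} (hf : IsFiltered μ w G f) (hg : IsFiltered μ w G' g) :
      IsFiltered μ w (G + G') fun t ω => f t ω + g t ω
  | smul (c : ℝ) {G : ℝ} {f : ℤ → Ω → ℝ} (hf : IsFiltered μ w G f) :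
      IsFiltered μ w (|c| * G) fun t ω => c * f t ω
  | mono {G G' : ℝ} {f : ℤ → Ω → ℝ} (h : G ≤ G') (hf : IsFiltered μ w G f) : IsFiltered μ w G' f
  | limit {G : ℝ} {f : ℤ → Ω → ℝ} (g : ℕ → ℤ → Ω → ℝ) (b : ℕ → ℝ) (hg : ∀ M, IsFiltered μ w G (g M))
      (hf : ∀ t, AEStronglyMeasurable (f t) μ) (hb0 : ∀ M, 0 ≤ b M) (hb : Tendsto b atTop (𝓝 0))
      (hgf : ∀ M t, eLpNorm (fun ω => g M t ω - f t ω) 2 μ ≤ ENNReal.ofReal (b M)) :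
      IsFiltered μ w G f

variable {w : ℤ → Ω → ι → ℝ} {G G' : ℝ} {f g : ℤ → Ω → ℝ}

theorem IsFiltered.sum {κ : Type*} (s : Finset κ) {G : κ → ℝ} {f : κ → ℤ → Ω → ℝ}
    (h : ∀ i ∈ s, IsFiltered μ w (G i) (f i)) :
    IsFiltered μ w (∑ i ∈ s, G i) fun t ω => ∑ i ∈ s, f i t ω := by
  classical
  induction s using Finset.induction_on with
  | empty => simpa using IsFiltered.zero
  | insert i s hi ih =>
    simp only [Finset.sum_insert hi]
    exact (h i (Finset.mem_insert_self i s)).add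
      (ih fun j hj => h j (Finset.mem_insert_of_mem hj))

theorem IsFiltered.gain_nonneg (hf : IsFiltered μ w G f) : 0 ≤ G := by
  induction hf with
  | zero => exact le_rfl
  | shift => exact zero_le_one
  | add _ _ ih1 ih2 => exact add_nonneg ih1 ih2
  | smul c _ ih => exact mul_nonneg (abs_nonneg c) ih
  | mono h _ ih => exact ih.trans h
  | limit g b hg _ _ _ _ ih => exact ih 0

theorem tendsto_eLpNorm_one_of_le {X : ℕ → Ω → ℝ} {Y : Ω → ℝ} {b : ℕ → ℝ}
    (hb : Tendsto b atTop (𝓝 0))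
    (h : ∀ M, eLpNorm (fun ω => X M ω - Y ω) 1 μ ≤ ENNReal.ofReal (b M)) :
    Tendsto (fun M => eLpNorm (X M - Y) 1 μ) atTop (𝓝 0) := by
  have h0 : Tendsto (fun M => ENNReal.ofReal (b M)) atTop (𝓝 0) := by
    simpa using ENNReal.tendsto_ofReal hb
  exact tendsto_of_tendsto_of_tendsto_of_le_of_le tendsto_const_nhds h0 (fun _ => zero_le) h

/-- A linear functional of scalar signals with random values that is continuous from mean square,
uniformly in time, to `L¹`. -/
structure IsSignalFunctional (μ : Measure Ω) (K : ℝ) (Φ : (ℤ → Ω → ℝ) → Ω → ℝ) : Prop where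
  add : ∀ f g : ℤ → Ω → ℝ, (∀ t, MemLp (f t) 2 μ) → (∀ t, MemLp (g t) 2 μ) →
    Φ (fun t ω => f t ω + g t ω) = fun ω => Φ f ω + Φ g ω
  smul : ∀ (c : ℝ) (f : ℤ → Ω → ℝ), (∀ t, MemLp (f t) 2 μ) →
    Φ (fun t ω => c * f t ω) = fun ω => c * Φ f ω
  aestronglyMeasurable : ∀ f : ℤ → Ω → ℝ, (∀ t, MemLp (f t) 2 μ) → AEStronglyMeasurable (Φ f) μ
  bound : ∀ (f : ℤ → Ω → ℝ) (B : ℝ), 0 ≤ B → (∀ t, MemLp (f t) 2 μ) →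
    (∀ t, eLpNorm (f t) 2 μ ≤ ENNReal.ofReal B) → eLpNorm (Φ f) 1 μ ≤ ENNReal.ofReal (K * B)

theorem IsSignalFunctional.zero {K : ℝ} {Φ : (ℤ → Ω → ℝ) → Ω → ℝ} (hΦ : IsSignalFunctional μ K Φ) :
    Φ (fun _ _ => 0) = fun _ => 0 := by
  have h := hΦ.smul 0 (fun _ _ => 0) fun _ => MemLp.zero
  simpa using h

theorem IsSignalFunctional.sub {K : ℝ} {Φ : (ℤ → Ω → ℝ) → Ω → ℝ} (hΦ : IsSignalFunctional μ K Φ)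
    (hf : ∀ t, MemLp (f t) 2 μ) (hg : ∀ t, MemLp (g t) 2 μ) :
    Φ (fun t ω => f t ω - g t ω) = fun ω => Φ f ω - Φ g ω := by
  have h1 := hΦ.smul (-1) g hg
  have h2 := hΦ.add f (fun t ω => -1 * g t ω) hf fun t => (hg t).const_mul _
  rw [h1] at h2
  simpa [sub_eq_add_neg] using h2

variable [IsProbabilityMeasure μ]

/-- Filtering with an `ℓ¹` gain `G` increases mean squares at most by the factor `G ^ 2`. -/
theorem IsFiltered.memLp_and_eLpNorm_le {b0 : ℝ} (hw : ∀ t a, MemLp (fun ω => w t ω a) 2 μ)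
    (hb0 : 0 ≤ b0) (hwb : ∀ t a, eLpNorm (fun ω => w t ω a) 2 μ ≤ ENNReal.ofReal b0)
    (hf : IsFiltered μ w G f) (t : ℤ) :
    MemLp (f t) 2 μ ∧ eLpNorm (f t) 2 μ ≤ ENNReal.ofReal (G * b0) := by
  induction hf with
  | zero => exact ⟨MemLp.zero, by simp⟩
  | shift s a => exact ⟨hw _ a, by simpa using hwb _ a⟩
  | add hf hg ih1 ih2 =>
    refine ⟨ih1.1.add ih2.1, ?_⟩
    rw [add_mul]
    exact eLpNorm_add_le_ofReal (by norm_num) (mul_nonneg hf.gain_nonneg hb0)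
      (mul_nonneg hg.gain_nonneg hb0) ih1.1.1 ih2.1.1 ih1.2 ih2.2
  | smul c hf ih =>
    refine ⟨ih.1.const_mul c, ?_⟩
    rw [mul_assoc]
    exact eLpNorm_const_mul_le c ih.2
  | mono h hf ih =>
    exact ⟨ih.1, ih.2.trans (ENNReal.ofReal_le_ofReal (mul_le_mul_of_nonneg_right h hb0))⟩
  | limit g b hg hf hb0 hb hgf ih =>
    have h1 := eLpNorm_two_le_of_tendsto (fun M => (ih M).1.1) (hf t)
      (tendsto_eLpNorm_one_of_le hb fun M => (eLpNorm_le_eLpNorm_of_exponent_le (by norm_num)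
        ((ih M).1.1.sub (hf t))).trans (hgf M t)) (fun M => (ih M).2)
    exact ⟨memLp_of_eLpNorm_le (hf t) h1, h1⟩

/-- A mean square bound for a functional of the components of the driving signal carries over to
all filtered signals. -/
theorem IsFiltered.eLpNorm_functional_le {b0 : ℝ} (hw : ∀ t a, MemLp (fun ω => w t ω a) 2 μ)
    (hb0 : 0 ≤ b0) (hwb : ∀ t a, eLpNorm (fun ω => w t ω a) 2 μ ≤ ENNReal.ofReal b0)
    {K : ℝ} {Φ : (ℤ → Ω → ℝ) → Ω → ℝ} (hΦ : IsSignalFunctional μ K Φ) {D : ℝ} (hD : 0 ≤ D)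
    (hbase : ∀ s a, eLpNorm (Φ fun t ω => w (s + t) ω a) 2 μ ≤ ENNReal.ofReal D)
    (hf : IsFiltered μ w G f) : eLpNorm (Φ f) 2 μ ≤ ENNReal.ofReal (G * D) := by
  induction hf with
  | zero => rw [hΦ.zero]; simp
  | shift s a => simpa using hbase s a
  | add hf hg ih1 ih2 =>
    have h1 := fun t => (hf.memLp_and_eLpNorm_le hw hb0 hwb t).1
    have h2 := fun t => (hg.memLp_and_eLpNorm_le hw hb0 hwb t).1
    rw [hΦ.add _ _ h1 h2, add_mul]
    exact eLpNorm_add_le_ofReal (by norm_num) (mul_nonneg hf.gain_nonneg hD)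
      (mul_nonneg hg.gain_nonneg hD) (hΦ.aestronglyMeasurable _ h1)
      (hΦ.aestronglyMeasurable _ h2) ih1 ih2
  | smul c hf ih =>
    rw [hΦ.smul c _ fun t => (hf.memLp_and_eLpNorm_le hw hb0 hwb t).1, mul_assoc]
    exact eLpNorm_const_mul_le c ih
  | mono h hf ih => exact ih.trans (ENNReal.ofReal_le_ofReal (mul_le_mul_of_nonneg_right h hD))
  | limit g b hg hf hb1 hb hgf ih =>
    have h1 := fun M t => ((hg M).memLp_and_eLpNorm_le hw hb0 hwb t).1
    have h2 := fun t => ((IsFiltered.limit g b hg hf hb1 hb hgf).memLp_and_eLpNorm_le hw hb0 hwb t).1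
    refine eLpNorm_two_le_of_tendsto (fun M => hΦ.aestronglyMeasurable _ (h1 M))
      (hΦ.aestronglyMeasurable _ h2) (tendsto_eLpNorm_one_of_le (b := fun M => K * b M)
        (by simpa using hb.const_mul K) fun M => ?_) ih
    rw [← hΦ.sub (h1 M) h2]
    exact hΦ.bound _ (b M) (hb1 M) (fun t => (h1 M t).sub (h2 t)) (hgf M)

/-- Convergence in probability to zero of functionals of the components of the driving signal
carries over to all filtered signals. -/
theorem IsFiltered.isLittleOP_functional {b0 : ℝ} (hw : ∀ t a, MemLp (fun ω => w t ω a) 2 μ)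
    (hb0 : 0 ≤ b0) (hwb : ∀ t a, eLpNorm (fun ω => w t ω a) 2 μ ≤ ENNReal.ofReal b0)
    {K : ℝ} {Φ : ℕ → (ℤ → Ω → ℝ) → Ω → ℝ} (hΦ : ∀ N, IsSignalFunctional μ K (Φ N))
    (hbase : ∀ s a, IsLittleOP μ (fun N => Φ N fun t ω => w (s + t) ω a) fun _ => 1)
    (hf : IsFiltered μ w G f) : IsLittleOP μ (fun N => Φ N f) fun _ => 1 := by
  induction hf with
  | zero => simp only [fun N => (hΦ N).zero]; exact isLittleOP_zero _
  | shift s a => exact hbase s a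
  | add hf hg ih1 ih2 =>
    have h1 := fun t => (hf.memLp_and_eLpNorm_le hw hb0 hwb t).1
    have h2 := fun t => (hg.memLp_and_eLpNorm_le hw hb0 hwb t).1
    simp only [fun N => (hΦ N).add _ _ h1 h2]
    exact ih1.add ih2
  | smul c hf ih =>
    simp only [fun N => (hΦ N).smul c _ fun t => (hf.memLp_and_eLpNorm_le hw hb0 hwb t).1]
    exact ih.const_mul c
  | mono h hf ih => exact ih
  | limit g b hg hf hb1 hb hgf ih =>
    have h1 := fun M t => ((hg M).memLp_and_eLpNorm_le hw hb0 hwb t).1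
    have h2 := fun t => ((IsFiltered.limit g b hg hf hb1 hb hgf).memLp_and_eLpNorm_le hw hb0 hwb t).1
    refine IsLittleOP.of_approx fun ε hε => ?_
    have h3 : Tendsto (fun M => K * b M) atTop (𝓝 0) := by simpa using hb.const_mul K
    obtain ⟨M, hM⟩ := (h3.eventually_le_const hε).exists
    refine ⟨fun N => Φ N (g M), ih M, fun N => ((hΦ N).aestronglyMeasurable _ h2).sub
      ((hΦ N).aestronglyMeasurable _ (h1 M)), fun N => ?_⟩
    rw [← (hΦ N).sub h2 (h1 M)]
    refine ((hΦ N).bound _ (b M) (hb1 M) (fun t => (h2 t).sub (h1 M t)) fun t => ?_).trans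
      (ENNReal.ofReal_le_ofReal hM)
    refine le_trans (le_of_eq ?_) (hgf M t)
    exact eLpNorm_sub_comm _ _ _ _

theorem isSignalFunctional_centredMoment {B : ℝ} (hB : 0 ≤ B) (hg : ∀ t, MemLp (g t) 2 μ)
    (hgB : ∀ t, eLpNorm (g t) 2 μ ≤ ENNReal.ofReal B) (N : ℕ) :
    IsSignalFunctional μ (B + B) fun f => centredMoment μ f g N where
  add f f' hf hf' := by
    ext ω
    have h1 : Integrable (fun ω => f 0 ω * g 0 ω) μ := (hf 0).integrable_mul (hg 0)
    have h2 : Integrable (fun ω => f' 0 ω * g 0 ω) μ := (hf' 0).integrable_mul (hg 0)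
    simp only [centredMoment, add_mul, Finset.sum_add_distrib]
    rw [integral_add h1 h2]
    ring
  smul c f hf := by
    ext ω
    simp only [centredMoment, mul_assoc, ← Finset.mul_sum, integral_const_mul]
    ring
  aestronglyMeasurable f hf := by
    refine AEStronglyMeasurable.sub (AEStronglyMeasurable.const_mul ?_ _) aestronglyMeasurable_const
    exact Finset.aestronglyMeasurable_fun_sum _ fun k _ => (hf k).1.mul (hg k).1
  bound f R hR hf hfR := by
    have h1 : ∀ k, eLpNorm (fun ω => f k ω * g k ω) 1 μ ≤ ENNReal.ofReal (B * R) := fun k => by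
      rw [mul_comm B R]
      exact eLpNorm_mul_le_ofReal hR (hf k).1 (hg k).1 (hfR k) (hgB k)
    have h2 := abs_integral_le_of_eLpNorm (mul_nonneg hB hR) (h1 0)
    have h3 : eLpNorm (fun ω => (1 / (N : ℝ)) * ∑ k ∈ Finset.range N, f k ω * g k ω) 1 μ
        ≤ ENNReal.ofReal (B * R) := by
      refine (eLpNorm_const_mul_le _ (eLpNorm_sum_le_ofReal le_rfl (Finset.range N)
        (X := fun (k : ℕ) ω => f k ω * g k ω) (b := fun _ => B * R)
        (fun _ _ => by positivity) (fun k _ => (hf k).1.mul (hg k).1) fun k _ => h1 k)).trans ?_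
      apply ENNReal.ofReal_le_ofReal
      rw [Finset.sum_const, Finset.card_range, nsmul_eq_mul, abs_of_nonneg (by positivity),
        ← mul_assoc]
      rcases Nat.eq_zero_or_pos N with rfl | hN
      · simp; positivity
      · rw [one_div_mul_cancel (by positivity), one_mul]
    have h4 := eLpNorm_sub_le (p := 1)
      ((Finset.aestronglyMeasurable_fun_sum (Finset.range N) fun k _ =>
        (hf k).1.mul (hg k).1).const_mul (1 / (N : ℝ)))
      (aestronglyMeasurable_const (b := ∫ ω', f 0 ω' * g 0 ω' ∂μ)) le_rfl (μ := μ)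
    refine h4.trans ?_
    rw [add_mul, ENNReal.ofReal_add (by positivity) (by positivity)]
    refine add_le_add h3 ((eLpNorm_const_le _ one_ne_zero).trans (ENNReal.ofReal_le_ofReal h2))

theorem isSignalFunctional_integral_sub {B : ℝ} (hB : 0 ≤ B) (hg : ∀ t, MemLp (g t) 2 μ)
    (hgB : ∀ t, eLpNorm (g t) 2 μ ≤ ENNReal.ofReal B) (t : ℤ) :
    IsSignalFunctional μ (B + B) fun f _ => ∫ ω, f t ω * g t ω ∂μ - ∫ ω, f 0 ω * g 0 ω ∂μ where
  add f f' hf hf' := by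
    ext ω
    have h1 : ∀ s, Integrable (fun ω => f s ω * g s ω) μ := fun s => (hf s).integrable_mul (hg s)
    have h2 : ∀ s, Integrable (fun ω => f' s ω * g s ω) μ := fun s => (hf' s).integrable_mul (hg s)
    simp only [add_mul]
    rw [integral_add (h1 0) (h2 0), integral_add (h1 t) (h2 t)]
    ring
  smul c f hf := by
    ext ω
    simp only [mul_assoc, integral_const_mul]
    ring
  aestronglyMeasurable f hf := aestronglyMeasurable_const
  bound f R hR hf hfR := by
    have h1 : ∀ k, eLpNorm (fun ω => f k ω * g k ω) 1 μ ≤ ENNReal.ofReal (B * R) := fun k => by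
      rw [mul_comm B R]
      exact eLpNorm_mul_le_ofReal hR (hf k).1 (hg k).1 (hfR k) (hgB k)
    have h2 := fun k => abs_integral_le_of_eLpNorm (mul_nonneg hB hR) (h1 k)
    refine (eLpNorm_const_le _ one_ne_zero).trans (ENNReal.ofReal_le_ofReal ?_)
    rw [add_mul]
    exact (abs_sub _ _).trans (add_le_add (h2 t) (h2 0))

theorem isSignalFunctional_weighted (N : ℕ) (c : ℕ → ℝ) :
    IsSignalFunctional μ (∑ k ∈ Finset.range N, |c k| * 2) fun f ω =>
      ∑ k ∈ Finset.range N, c k * (f k ω - ∫ ω', f k ω' ∂μ) where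
  add f f' hf hf' := by
    ext ω
    rw [← Finset.sum_add_distrib]
    refine Finset.sum_congr rfl fun k _ => ?_
    rw [integral_add ((hf k).integrable (by norm_num)) ((hf' k).integrable (by norm_num))]
    ring
  smul r f hf := by
    ext ω
    rw [Finset.mul_sum]
    refine Finset.sum_congr rfl fun k _ => ?_
    rw [integral_const_mul]
    ring
  aestronglyMeasurable f hf := Finset.aestronglyMeasurable_fun_sum _ fun k _ =>
    ((hf k).1.sub aestronglyMeasurable_const).const_mul _
  bound f R hR hf hfR := by
    rw [Finset.sum_mul]
    refine eLpNorm_sum_le_ofReal le_rfl _ (X := fun (k : ℕ) ω => c k * (f k ω - ∫ ω', f k ω' ∂μ))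
      (fun k _ => by positivity) (fun k _ => ((hf k).1.sub aestronglyMeasurable_const).const_mul _)
      fun k _ => ?_
    rw [mul_assoc]
    refine eLpNorm_const_mul_le (c k) ?_
    have h1 : eLpNorm (f k) 1 μ ≤ ENNReal.ofReal R :=
      (eLpNorm_le_eLpNorm_of_exponent_le (by norm_num) (hf k).1).trans (hfR k)
    have h2 := abs_integral_le_of_eLpNorm hR h1
    refine (eLpNorm_sub_le (hf k).1 aestronglyMeasurable_const le_rfl).trans ?_
    rw [two_mul, ENNReal.ofReal_add hR hR]
    exact add_le_add h1 ((eLpNorm_const_le _ one_ne_zero).trans (ENNReal.ofReal_le_ofReal h2))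

end Filtered

section FilteredDrive

variable {Ω : Type*} {m0 : MeasurableSpace Ω} {μ : Measure Ω} [IsProbabilityMeasure μ] {m p : ℕ}
  {u : ℤ → Ω → Fin m → ℝ} {e : ℤ → Ω → Fin p → ℝ} {Λ : Matrix (Fin p) (Fin p) ℝ}
  {G G' : ℝ} {f g : ℤ → Ω → ℝ}

theorem IsFiltered.memLp (hu : IsWideSenseStationary μ u) (he : IsInnovation μ u e Λ)
    (hf : IsFiltered μ (drive u e) G f) (t : ℤ) : MemLp (f t) 2 μ := by
  obtain ⟨b0, hb0, hb⟩ := exists_eLpNorm_drive_le hu he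
  exact (hf.memLp_and_eLpNorm_le (memLp_drive hu he) hb0 hb t).1

theorem IsFiltered.exists_eLpNorm_le (hu : IsWideSenseStationary μ u) (he : IsInnovation μ u e Λ)
    (hf : IsFiltered μ (drive u e) G f) :
    ∃ B : ℝ, 0 ≤ B ∧ ∀ t, eLpNorm (f t) 2 μ ≤ ENNReal.ofReal B := by
  obtain ⟨b0, hb0, hb⟩ := exists_eLpNorm_drive_le hu he
  exact ⟨G * b0, mul_nonneg hf.gain_nonneg hb0, fun t =>
    (hf.memLp_and_eLpNorm_le (memLp_drive hu he) hb0 hb t).2⟩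

/-- Filtered signals have jointly stationary second moments. -/
theorem IsFiltered.integral_mul_eq (hu : IsWideSenseStationary μ u) (he : IsInnovation μ u e Λ)
    (hf : IsFiltered μ (drive u e) G f) (hg : IsFiltered μ (drive u e) G' g) (t : ℤ) :
    ∫ ω, f t ω * g t ω ∂μ = ∫ ω, f 0 ω * g 0 ω ∂μ := by
  obtain ⟨b0, hb0, hb⟩ := exists_eLpNorm_drive_le hu he
  have hw := memLp_drive hu he
  have key : ∀ {G : ℝ} {f g : ℤ → Ω → ℝ}, IsFiltered μ (drive u e) G f →
      (∃ B : ℝ, 0 ≤ B ∧ ∀ t, eLpNorm (g t) 2 μ ≤ ENNReal.ofReal B) → (∀ t, MemLp (g t) 2 μ) →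
      (∀ s a, ∫ ω, drive u e (s + t) ω a * g t ω ∂μ = ∫ ω, drive u e (s + 0) ω a * g 0 ω ∂μ) →
      ∫ ω, f t ω * g t ω ∂μ = ∫ ω, f 0 ω * g 0 ω ∂μ := by
    intro G f g hf ⟨B, hB, hgB⟩ hg hbase
    have h := hf.eLpNorm_functional_le hw hb0 hb (isSignalFunctional_integral_sub hB hg hgB t)
      (D := 0) le_rfl fun s a => by rw [hbase s a]; simp
    rw [mul_zero, ENNReal.ofReal_zero, nonpos_iff_eq_zero,
      eLpNorm_const _ two_ne_zero (IsProbabilityMeasure.ne_zero μ)] at h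
    simpa [sub_eq_zero] using h
  refine key hf (hg.exists_eLpNorm_le hu he) (hg.memLp hu he) fun s a => ?_
  simp only [mul_comm (drive u e _ _ a)]
  refine key hg ⟨b0, hb0, fun t => hb (s + t) a⟩ (fun t => hw (s + t) a) fun s' b => ?_
  rw [integral_drive_mul_drive hu he, add_zero, add_zero]

/-- The law of large numbers for second moments of filtered signals. -/
theorem IsFiltered.isLittleOP_centredMoment (hu : IsWideSenseStationary μ u)
    (huerg : IsSecondOrderErgodic μ u) (he : IsInnovation μ u e Λ)
    (hf : IsFiltered μ (drive u e) G f) (hg : IsFiltered μ (drive u e) G' g) :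
    IsLittleOP μ (centredMoment μ f g) fun _ => 1 := by
  obtain ⟨b0, hb0, hb⟩ := exists_eLpNorm_drive_le hu he
  have hw := memLp_drive hu he
  obtain ⟨B, hB, hgB⟩ := hg.exists_eLpNorm_le hu he
  refine hf.isLittleOP_functional hw hb0 hb (Φ := fun N f => centredMoment μ f g N)
    (fun N => isSignalFunctional_centredMoment hB (hg.memLp hu he) hgB N) fun s a => ?_
  have e1 : (fun N => centredMoment μ (fun t ω => drive u e (s + t) ω a) g N)
      = fun N => centredMoment μ g (fun t ω => drive u e (s + t) ω a) N := by
    ext N ω; rw [centredMoment_comm]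
  rw [e1]
  exact hg.isLittleOP_functional hw hb0 hb (Φ := fun N g => centredMoment μ g _ N)
    (fun N => isSignalFunctional_centredMoment hb0 (fun t => hw (s + t) a)
      (fun t => hb (s + t) a) N) fun s' b => isLittleOP_centredMoment_drive hu huerg he s' s b a

/-- The rate `1/√N` for second moments of filtered signals. -/
theorem IsFiltered.eLpNorm_centredMoment_le (hu : IsWideSenseStationary μ u)
    (he : IsInnovation μ u e Λ) {c : ℝ} (hc : 0 ≤ c) {N : ℕ}
    (h : ∀ (s s' : ℤ) (a b : Fin m ⊕ Fin p),
      eLpNorm (centredMoment μ (fun t ω => drive u e (s + t) ω a)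
        (fun t ω => drive u e (s' + t) ω b) N) 2 μ ≤ ENNReal.ofReal c)
    (hf : IsFiltered μ (drive u e) G f) (hg : IsFiltered μ (drive u e) G' g) :
    eLpNorm (centredMoment μ f g N) 2 μ ≤ ENNReal.ofReal (G * (G' * c)) := by
  obtain ⟨b0, hb0, hb⟩ := exists_eLpNorm_drive_le hu he
  have hw := memLp_drive hu he
  obtain ⟨B, hB, hgB⟩ := hg.exists_eLpNorm_le hu he
  refine hf.eLpNorm_functional_le hw hb0 hb (Φ := fun f => centredMoment μ f g N)
    (isSignalFunctional_centredMoment hB (hg.memLp hu he) hgB N)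
    (mul_nonneg hg.gain_nonneg hc) fun s a => ?_
  rw [centredMoment_comm]
  exact hg.eLpNorm_functional_le hw hb0 hb (Φ := fun g => centredMoment μ g _ N)
    (isSignalFunctional_centredMoment hb0 (fun t => hw (s + t) a) (fun t => hb (s + t) a) N)
    hc fun s' b => h s' s b a

theorem IsFiltered.eLpNorm_weighted_le (hu : IsWideSenseStationary μ u)
    (he : IsInnovation μ u e Λ) {D : ℝ} (hD : 0 ≤ D) {N : ℕ} {c : ℕ → ℝ}
    (h : ∀ (s : ℤ) (a : Fin m ⊕ Fin p), eLpNorm (fun ω => ∑ k ∈ Finset.range N,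
        c k * (drive u e (s + k) ω a - ∫ ω', drive u e (s + k) ω' a ∂μ)) 2 μ ≤ ENNReal.ofReal D)
    (hf : IsFiltered μ (drive u e) G f) :
    eLpNorm (fun ω => ∑ k ∈ Finset.range N, c k * (f k ω - ∫ ω', f k ω' ∂μ)) 2 μ
      ≤ ENNReal.ofReal (G * D) := by
  obtain ⟨b0, hb0, hb⟩ := exists_eLpNorm_drive_le hu he
  exact hf.eLpNorm_functional_le (memLp_drive hu he) hb0 hb (isSignalFunctional_weighted N c) hD h

end FilteredDrive

/-! ### The data equations -/

section DataEquations

variable {n m p : ℕ} (S : InnovationModel n m p)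

/-- The model from the innovations to the outputs; its matrix `H_d` is the block Toeplitz matrix of
the response of the outputs to the innovations. -/
def InnovationModel.noise : InnovationModel n p p where
  A := S.A
  B := S.K
  C := S.C
  D := 1
  K := S.K

theorem sum_fin_lower {T : ℕ} (i : Fin T) (X Y : ℕ → ℝ) :
    ∑ l : Fin T, (if i = l then X l else if l < i then Y l else 0)
      = X i + ∑ l ∈ Finset.range i, Y l := by
  have h1 : ∀ l : Fin T, (if i = l then X l else if l < i then Y l else 0)
      = (if i = l then X l else 0) + (fun l : ℕ => if l < (i : ℕ) then Y l else 0) (l : ℕ) := by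
    intro l
    rcases lt_trichotomy l i with h | h | h
    · have h' : (l : ℕ) < i := h
      simp [h.ne', h, h']
    · simp [h]
    · have h' : ¬ (l : ℕ) < i := not_lt.2 (le_of_lt h)
      simp [h.ne, not_lt.2 h.le]
  simp only [h1]
  rw [Finset.sum_add_distrib, Finset.sum_ite_eq, if_pos (Finset.mem_univ i),
    Fin.sum_univ_eq_sum_range (fun l : ℕ => if l < (i : ℕ) then Y l else 0) T, ← Finset.sum_filter]
  congr 1
  refine Finset.sum_congr ?_ fun _ _ => rfl
  ext l
  simp only [Finset.mem_filter, Finset.mem_range]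
  have := i.2
  omega

theorem Hd_mulVec_apply {T : ℕ} (w : ℕ → Fin m → ℝ) (i : Fin T) (a : Fin p) :
    (S.Hd T *ᵥ fun q => w q.1 q.2) (i, a)
      = (S.D *ᵥ w i) a
        + ∑ l ∈ Finset.range i, ((S.C * S.A ^ ((i : ℕ) - l - 1) * S.B) *ᵥ w l) a := by
  rw [← sum_fin_lower i (fun l => (S.D *ᵥ w l) a)
    fun l => ((S.C * S.A ^ ((i : ℕ) - l - 1) * S.B) *ᵥ w l) a]
  simp only [mulVec, dotProduct, Fintype.sum_prod_type, InnovationModel.Hd, Matrix.of_apply]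
  refine Finset.sum_congr rfl fun l _ => ?_
  split_ifs <;> simp

variable {S} {u : ℤ → Fin m → ℝ} {x : ℤ → Fin n → ℝ} {e y : ℤ → Fin p → ℝ}

/-- The future outputs in terms of the state, the future inputs and the future innovations. -/
theorem YF_eq (h : ∀ t : ℤ, x (t + 1) = S.A *ᵥ x t + S.B *ᵥ u t + S.K *ᵥ e t ∧
    y t = S.C *ᵥ x t + S.D *ᵥ u t + e t) (ρ T N : ℕ) :
    YF y ρ T N = S.Gam T * hankelRow x ρ N + S.Hd T * UF u ρ T N
      + S.noise.Hd T * hankel e ρ T N := by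
  ext ⟨i, a⟩ j
  obtain ⟨τ, hτ⟩ : ∃ τ : ℤ, τ = ρ + j := ⟨_, rfl⟩
  have hrow : ∀ {s : ℕ} (w : ℤ → Fin s → ℝ) (q : Fin T × Fin s),
      hankel w ρ T N q j = (1 / √(N : ℝ)) * w (τ + (q.1 : ℕ)) q.2 := fun w q => by
    simp only [hankel, Matrix.of_apply, hτ]
    congr 2
    ring
  have h1 := linear_recursion_eq S.A x (fun t => S.B *ᵥ u t + S.K *ᵥ e t)
    (fun t => by rw [(h t).1, add_assoc]) τ i
  have hG : (S.Gam T * hankelRow x ρ N) (i, a) j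
      = (1 / √(N : ℝ)) * (S.C *ᵥ (S.A ^ (i : ℕ) *ᵥ x τ)) a := by
    rw [Matrix.mulVec_mulVec, Matrix.mul_apply, mulVec, dotProduct, Finset.mul_sum]
    refine Finset.sum_congr rfl fun k _ => ?_
    simp only [InnovationModel.Gam, hankelRow, Matrix.of_apply, hτ]
    ring
  have hU : (S.Hd T * UF u ρ T N) (i, a) j = (1 / √(N : ℝ)) *
      ((S.D *ᵥ u (τ + i)) a + ∑ l ∈ Finset.range i,
        ((S.C * S.A ^ ((i : ℕ) - l - 1) * S.B) *ᵥ u (τ + l)) a) := by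
    rw [← Hd_mulVec_apply S (fun l => u (τ + (l : ℕ))), Matrix.mul_apply, mulVec, dotProduct,
      Finset.mul_sum]
    refine Finset.sum_congr rfl fun q _ => ?_
    rw [UF, hrow]
    ring
  have hE : (S.noise.Hd T * hankel e ρ T N) (i, a) j = (1 / √(N : ℝ)) *
      (e (τ + i) a + ∑ l ∈ Finset.range i,
        ((S.C * S.A ^ ((i : ℕ) - l - 1) * S.K) *ᵥ e (τ + l)) a) := by
    have h2 := Hd_mulVec_apply S.noise (fun l => e (τ + (l : ℕ))) i a
    simp only [InnovationModel.noise, Matrix.one_mulVec] at h2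
    rw [← h2, Matrix.mul_apply, mulVec, dotProduct, Finset.mul_sum]
    refine Finset.sum_congr rfl fun q _ => ?_
    rw [hrow]
    simp only [InnovationModel.noise]
    ring
  rw [Matrix.add_apply, Matrix.add_apply, hG, hU, hE, YF, hrow, (h _).2, h1]
  simp only [Matrix.mulVec_add, Matrix.mulVec_sum, Pi.add_apply, Finset.sum_apply,
    Matrix.mulVec_mulVec, Finset.sum_add_distrib, Matrix.mul_assoc]
  ring

/-- The state in terms of the past data and of the state at the beginning of the past window. -/
theorem hankelRow_eq (h : ∀ t : ℤ, x (t + 1) = S.A *ᵥ x t + S.B *ᵥ u t + S.K *ᵥ e t ∧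
    y t = S.C *ᵥ x t + S.D *ᵥ u t + e t) (ρ N : ℕ) :
    hankelRow x ρ N = S.predA ^ ρ * hankelRow x 0 N + S.Cal ρ * ZP u y ρ N := by
  have hpred : ∀ t, x (t + 1) = S.predA *ᵥ x t + ((S.B - S.K * S.D) *ᵥ u t + S.K *ᵥ y t) := by
    intro t
    rw [(h t).1, (h t).2, InnovationModel.predA]
    simp only [Matrix.sub_mulVec, Matrix.mulVec_add, Matrix.mulVec_mulVec]
    abel
  have hblock : ∀ {s : ℕ} (R : Matrix (Fin n) (Fin s) ℝ) (w : ℤ → Fin s → ℝ) (i : Fin n)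
      (j : Fin N), (Matrix.of (fun i (c : Fin ρ × Fin s) => (S.predA ^ (ρ - (c.1 : ℕ) - 1) * R) i c.2)
        * hankel w 0 ρ N) i j
      = (1 / √(N : ℝ)) * ∑ l ∈ Finset.range ρ,
        ((S.predA ^ (ρ - l - 1) * R) *ᵥ w ((j : ℕ) + (l : ℤ))) i := by
    intro s R w i j
    rw [Matrix.mul_apply, Fintype.sum_prod_type, ← Fin.sum_univ_eq_sum_range
      (fun l => ((S.predA ^ (ρ - l - 1) * R) *ᵥ w ((j : ℕ) + (l : ℤ))) i) ρ, Finset.mul_sum]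
    refine Finset.sum_congr rfl fun l _ => ?_
    rw [mulVec, dotProduct, Finset.mul_sum]
    refine Finset.sum_congr rfl fun b _ => ?_
    simp only [hankel, Matrix.of_apply]
    rw [show (0 : ℤ) + ((l : ℕ) : ℤ) + ((j : ℕ) : ℤ) = ((j : ℕ) : ℤ) + ((l : ℕ) : ℤ) by ring]
    ring
  ext i j
  have h1 := linear_recursion_eq S.predA x _ hpred (j : ℕ) ρ
  rw [Matrix.add_apply, InnovationModel.Cal, ZP, Matrix.fromCols_mul_fromRows, Matrix.add_apply,
    InnovationModel.Cu, InnovationModel.Cy, hblock, hblock]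
  have h2 : (S.predA ^ ρ * hankelRow x 0 N) i j
      = (1 / √(N : ℝ)) * (S.predA ^ ρ *ᵥ x ((j : ℕ) : ℤ)) i := by
    rw [Matrix.mul_apply, mulVec, dotProduct, Finset.mul_sum]
    refine Finset.sum_congr rfl fun k _ => ?_
    simp only [hankelRow, Matrix.of_apply, zero_add]
    ring
  rw [h2]
  simp only [hankelRow, Matrix.of_apply]
  rw [show (ρ : ℤ) + ((j : ℕ) : ℤ) = ((j : ℕ) : ℤ) + (ρ : ℤ) by ring, h1]
  simp only [Matrix.mulVec_add, Pi.add_apply, Finset.sum_apply, Matrix.mulVec_mulVec,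
    Finset.sum_add_distrib]
  ring

/-- The error in the output relation is a fixed combination of projected innovations. -/
theorem output_error_eq (h : ∀ t : ℤ, x (t + 1) = S.A *ᵥ x t + S.B *ᵥ u t + S.K *ᵥ e t ∧
    y t = S.C *ᵥ x t + S.D *ᵥ u t + e t) (ρ T N : ℕ) (α : Fin N → ℝ) :
    YFhat u y ρ T N *ᵥ α - (S.Gam T *ᵥ (Xhat u y x ρ T N *ᵥ α) + S.Hd T *ᵥ (UF u ρ T N *ᵥ α))
      = S.noise.Hd T *ᵥ (hankel e ρ T N *ᵥ (rowProjector (ZU u y ρ T N) *ᵥ α)) := by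
  have hUF : UF u ρ T N * rowProjector (ZU u y ρ T N) = UF u ρ T N := by
    have h1 := mul_rowProjector (ZU u y ρ T N)
    have h2 := congrArg Matrix.toRows₂ h1
    rw [show ZU u y ρ T N = Matrix.fromRows (ZP u y ρ N) (UF u ρ T N) from rfl,
      Matrix.fromRows_mul, Matrix.toRows₂_fromRows, Matrix.toRows₂_fromRows] at h2
    exact h2
  rw [YFhat, Xhat, rowProj_eq, rowProj_eq, YF_eq h, Matrix.add_mul, Matrix.add_mul,
    Matrix.mul_assoc (S.Hd T), hUF]
  simp only [Matrix.add_mulVec, Matrix.mulVec_mulVec, Matrix.mul_assoc]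
  abel

/-- The error in the state relation is the projected state at the beginning of the past window,
damped by the predictor. -/
theorem state_error_eq (h : ∀ t : ℤ, x (t + 1) = S.A *ᵥ x t + S.B *ᵥ u t + S.K *ᵥ e t ∧
    y t = S.C *ᵥ x t + S.D *ᵥ u t + e t) (ρ T N : ℕ) (α : Fin N → ℝ) :
    Xhat u y x ρ T N *ᵥ α - S.Cal ρ *ᵥ (ZP u y ρ N *ᵥ α)
      = S.predA ^ ρ *ᵥ (hankelRow x 0 N *ᵥ (rowProjector (ZU u y ρ T N) *ᵥ α)) := by
  have hZP : ZP u y ρ N * rowProjector (ZU u y ρ T N) = ZP u y ρ N := by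
    have h1 := mul_rowProjector (ZU u y ρ T N)
    have h2 := congrArg Matrix.toRows₁ h1
    rw [show ZU u y ρ T N = Matrix.fromRows (ZP u y ρ N) (UF u ρ T N) from rfl,
      Matrix.fromRows_mul, Matrix.toRows₁_fromRows, Matrix.toRows₁_fromRows] at h2
    exact h2
  rw [Xhat, rowProj_eq, hankelRow_eq h, Matrix.add_mul, Matrix.mul_assoc (S.Cal ρ), hZP]
  simp only [Matrix.add_mulVec, Matrix.mulVec_mulVec, Matrix.mul_assoc]
  abel

end DataEquations

/-! ### States and outputs as filtered signals -/

section FilteredState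

variable {Ω : Type*} {m0 : MeasurableSpace Ω} {μ : Measure Ω}

theorem IsFiltered.congr_ae {ι : Type*} {w : ℤ → Ω → ι → ℝ} {G : ℝ} {f g : ℤ → Ω → ℝ}
    (hf : IsFiltered μ w G f) (hfm : ∀ t, AEStronglyMeasurable (f t) μ)
    (h : ∀ t, f t =ᵐ[μ] g t) : IsFiltered μ w G g := by
  refine .limit (fun _ => f) (fun _ => 0) (fun _ => hf) (fun t => (hfm t).congr (h t))
    (fun _ => le_rfl) tendsto_const_nhds fun _ t => ?_
  have h0 : (fun ω => f t ω - g t ω) =ᵐ[μ] fun _ => (0 : ℝ) := by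
    filter_upwards [h t] with ω hω
    rw [hω, sub_self]
  rw [eLpNorm_congr_ae h0]
  simp

theorem IsFiltered.comp_add {ι : Type*} {w : ℤ → Ω → ι → ℝ} {G : ℝ} {f : ℤ → Ω → ℝ}
    (hf : IsFiltered μ w G f) (s : ℤ) : IsFiltered μ w G fun t => f (s + t) := by
  induction hf with
  | zero => exact .zero
  | shift r a =>
    have := IsFiltered.shift (μ := μ) (w := w) (r + s) a
    simpa only [add_assoc] using this
  | add _ _ ih1 ih2 => exact ih1.add ih2
  | smul c _ ih => exact ih.smul c
  | mono h _ ih => exact ih.mono h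
  | limit g b _ hf hb0 hb hgf ih =>
    exact .limit (fun M t => g M (s + t)) b ih (fun t => hf _) hb0 hb fun M t => hgf M _

/-- A mean square limit of variables that are measurable with respect to a sub-σ-algebra. -/
theorem aestronglyMeasurable_of_tendsto_eLpNorm {m : MeasurableSpace Ω} (hm : m ≤ m0)
    {X : ℕ → Ω → ℝ} {Y : Ω → ℝ} (hX : ∀ M, Measurable[m] (X M))
    (hY : AEStronglyMeasurable[m0] Y μ)
    (h : Tendsto (fun M => eLpNorm (X M - Y) 2 μ) atTop (𝓝 0)) : AEStronglyMeasurable[m] Y μ := by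
  obtain ⟨ns, -, hns⟩ := (tendstoInMeasure_of_tendsto_eLpNorm two_ne_zero
    (fun M => ((hX M).mono hm le_rfl).aestronglyMeasurable) hY h).exists_seq_tendsto_ae
  refine ⟨fun ω => liminf (fun i => X (ns i) ω) atTop,
    (Measurable.liminf fun i => hX (ns i)).stronglyMeasurable, ?_⟩
  filter_upwards [hns] with ω hω
  exact hω.liminf_eq.symm

variable {n m p : ℕ} {S : InnovationModel n m p}
  {u : ℤ → Ω → Fin m → ℝ} {x : ℤ → Ω → Fin n → ℝ} {e y : ℤ → Ω → Fin p → ℝ}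
  {Λ : Matrix (Fin p) (Fin p) ℝ}

theorem IsL2Bounded.exists_eLpNorm_le {s : ℕ} {x : ℤ → Ω → Fin s → ℝ} (hx : IsL2Bounded μ x) :
    ∃ c : ℝ, 0 ≤ c ∧ ∀ t j, eLpNorm (fun ω => x t ω j) 2 μ ≤ ENNReal.ofReal c := by
  obtain ⟨hL, c, hc⟩ := hx
  refine ⟨√|c|, Real.sqrt_nonneg _, fun t j => ?_⟩
  rw [eLpNorm_two_le_iff_integral (memLp_coord (hL t) j) (Real.sqrt_nonneg _),
    Real.sq_sqrt (abs_nonneg c)]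
  refine le_trans ?_ ((hc t).trans (le_abs_self c))
  refine integral_mono (memLp_coord (hL t) j).integrable_sq (hL t).norm.integrable_sq fun ω => ?_
  have := norm_le_pi_norm (x t ω) j
  rw [Real.norm_eq_abs] at this
  simp only
  rw [← sq_abs]
  exact pow_le_pow_left₀ (abs_nonneg _) this 2

/-- `F ^ M` applied to a mean square bounded vector is geometrically small. -/
theorem eLpNorm_pow_mulVec_le {F : Matrix (Fin n) (Fin n) ℝ} {c r b : ℝ} (hc : 0 ≤ c) (hr : 0 ≤ r)
    (hF : ∀ (k : ℕ) (i j : Fin n), |(F ^ k) i j| ≤ c * r ^ k) (hb : 0 ≤ b) {X : Ω → Fin n → ℝ}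
    (hX : ∀ j, AEStronglyMeasurable (fun ω => X ω j) μ)
    (hXb : ∀ j, eLpNorm (fun ω => X ω j) 2 μ ≤ ENNReal.ofReal b) (M : ℕ) (j : Fin n) :
    eLpNorm (fun ω => (F ^ M *ᵥ X ω) j) 2 μ ≤ ENNReal.ofReal (n * c * b * r ^ M) := by
  refine (eLpNorm_sum_le_ofReal (by norm_num) Finset.univ (X := fun i ω => (F ^ M) j i * X ω i)
    (b := fun _ => c * r ^ M * b) (fun _ _ => by positivity) (fun i _ => (hX i).const_mul _)
    fun i _ => ?_).trans (ENNReal.ofReal_le_ofReal (le_of_eq ?_))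
  · exact (eLpNorm_const_mul_le _ (hXb i)).trans
      (ENNReal.ofReal_le_ofReal (mul_le_mul_of_nonneg_right (hF M j i) hb))
  · simp
    ring

theorem output_ae_eq (hsys : IsTrajectory μ S u x e y) (t : ℤ) (a : Fin p) :
    (fun ω => ∑ j, S.C a j * x t ω j + ∑ b, S.D a b * u t ω b + e t ω a)
      =ᵐ[μ] fun ω => y t ω a := by
  filter_upwards [hsys] with ω hω
  rw [(hω t).2]
  simp [mulVec, dotProduct]

theorem drive_recursion {ω : Ω} (h : ∀ t : ℤ,
    x (t + 1) ω = S.A *ᵥ x t ω + S.B *ᵥ u t ω + S.K *ᵥ e t ω ∧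
      y t ω = S.C *ᵥ x t ω + S.D *ᵥ u t ω + e t ω) (t : ℤ) :
    x (t + 1) ω = S.A *ᵥ x t ω + Matrix.fromCols S.B S.K *ᵥ drive u e t ω := by
  rw [(h t).1, drive, Matrix.fromCols_mulVec_sumElim, add_assoc]

/-- The response of the state at time `t` to the last `M` inputs and innovations. -/
noncomputable def recentState (S : InnovationModel n m p) (u : ℤ → Ω → Fin m → ℝ)
    (e : ℤ → Ω → Fin p → ℝ) (M : ℕ) (j : Fin n) (t : ℤ) (ω : Ω) : ℝ :=
  ∑ l ∈ Finset.range M, ∑ a, (S.A ^ (M - l - 1) * Matrix.fromCols S.B S.K) j a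
    * drive u e ((-M + l : ℤ) + t) ω a

theorem state_sub_recentState {ω : Ω} (h : ∀ t : ℤ,
    x (t + 1) ω = S.A *ᵥ x t ω + S.B *ᵥ u t ω + S.K *ᵥ e t ω ∧
      y t ω = S.C *ᵥ x t ω + S.D *ᵥ u t ω + e t ω) (M : ℕ) (j : Fin n) (t : ℤ) :
    recentState S u e M j t ω - x t ω j = -(S.A ^ M *ᵥ x (-M + t) ω) j := by
  have h1 := linear_recursion_eq S.A (fun t => x t ω)
    (fun t => Matrix.fromCols S.B S.K *ᵥ drive u e t ω) (drive_recursion h) (-M + t) M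
  rw [show (-M + t : ℤ) + M = t by ring] at h1
  rw [h1]
  simp only [Pi.add_apply, Finset.sum_apply, Matrix.mulVec_mulVec, recentState]
  have h2 : ∀ l : ℕ, ((S.A ^ (M - l - 1) * Matrix.fromCols S.B S.K)
      *ᵥ drive u e (-M + t + l) ω) j = ∑ a, (S.A ^ (M - l - 1) * Matrix.fromCols S.B S.K) j a
    * drive u e ((-M + l : ℤ) + t) ω a := fun l => by
    rw [mulVec, dotProduct, show (-M + t + l : ℤ) = (-M + l : ℤ) + t by ring]
  simp only [h2]
  ring

theorem isFiltered_recentState {c r : ℝ} (hr0 : 0 ≤ r) (hr : r < 1)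
    (hA : ∀ (k : ℕ) (i j : Fin n), |(S.A ^ k) i j| ≤ c * r ^ k) (M : ℕ) (j : Fin n) :
    IsFiltered μ (drive u e)
      ((∑ a, ∑ i, c * |Matrix.fromCols S.B S.K i a|) * (1 - r)⁻¹) (recentState S u e M j) := by
  have h1 : ∀ (k : ℕ) (a), |(S.A ^ k * Matrix.fromCols S.B S.K) j a|
      ≤ r ^ k * ∑ i, c * |Matrix.fromCols S.B S.K i a| := fun k a => by
    rw [Matrix.mul_apply, Finset.mul_sum]
    refine (Finset.abs_sum_le_sum_abs _ _).trans (Finset.sum_le_sum fun i _ => ?_)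
    rw [abs_mul]
    calc _ ≤ c * r ^ k * |Matrix.fromCols S.B S.K i a| :=
          mul_le_mul_of_nonneg_right (hA k j i) (abs_nonneg _)
      _ = _ := by ring
  have h2 : IsFiltered μ (drive u e)
      (∑ l ∈ Finset.range M, ∑ a, |(S.A ^ (M - l - 1) * Matrix.fromCols S.B S.K) j a| * 1)
      (recentState S u e M j) :=
    IsFiltered.sum _ fun l _ => IsFiltered.sum _ fun a _ => (IsFiltered.shift _ a).smul _
  refine h2.mono ?_
  have hc0 : 0 ≤ ∑ a, ∑ i, c * |Matrix.fromCols S.B S.K i a| := by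
    have : 0 ≤ c := by simpa using (abs_nonneg _).trans (hA 0 j j)
    positivity
  calc _ ≤ ∑ l ∈ Finset.range M, r ^ (M - 1 - l)
        * ∑ a, ∑ i, c * |Matrix.fromCols S.B S.K i a| := by
        refine Finset.sum_le_sum fun l _ => ?_
        rw [Finset.mul_sum, Nat.sub_right_comm]
        exact Finset.sum_le_sum fun a _ => by rw [mul_one]; exact h1 _ a
    _ = (∑ l ∈ Finset.range M, r ^ l) * ∑ a, ∑ i, c * |Matrix.fromCols S.B S.K i a| := by
        rw [← Finset.sum_mul, Finset.sum_range_reflect (fun l => r ^ l) M]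
    _ ≤ _ := by
        rw [mul_comm]
        refine mul_le_mul_of_nonneg_left ?_ hc0
        have := (summable_geometric_of_lt_one hr0 hr).sum_le_tsum (Finset.range M)
          (fun _ _ => by positivity)
        rwa [tsum_geometric_of_lt_one hr0 hr] at this

/-- The state is the mean square limit of its response to the recent inputs and innovations. -/
theorem eLpNorm_recentState_sub_le (hsys : IsTrajectory μ S u x e y) {c r b : ℝ} (hc : 0 ≤ c)
    (hr : 0 ≤ r) (hA : ∀ (k : ℕ) (i j : Fin n), |(S.A ^ k) i j| ≤ c * r ^ k) (hb : 0 ≤ b)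
    (hx : ∀ t, MemLp (x t) 2 μ)
    (hxb : ∀ t j, eLpNorm (fun ω => x t ω j) 2 μ ≤ ENNReal.ofReal b) (M : ℕ) (j : Fin n) (t : ℤ) :
    eLpNorm (fun ω => recentState S u e M j t ω - x t ω j) 2 μ
      ≤ ENNReal.ofReal (n * c * b * r ^ M) := by
  have h1 : (fun ω => recentState S u e M j t ω - x t ω j)
      =ᵐ[μ] -fun ω => (S.A ^ M *ᵥ x (-M + t) ω) j := by
    filter_upwards [hsys] with ω hω
    exact state_sub_recentState hω M j t
  rw [eLpNorm_congr_ae h1, eLpNorm_neg]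
  exact eLpNorm_pow_mulVec_le hc hr hA hb (fun j => (memLp_coord (hx _) j).1) (hxb _) M j

theorem tendsto_const_mul_pow {r : ℝ} (hr0 : 0 ≤ r) (hr : r < 1) (c : ℝ) :
    Tendsto (fun M : ℕ => c * r ^ M) atTop (𝓝 0) := by
  simpa using (tendsto_pow_atTop_nhds_zero_of_lt_one hr0 hr).const_mul c

theorem exists_isFiltered_state (hA : IsSchurStable S.A) (hx : IsL2Bounded μ x)
    (hsys : IsTrajectory μ S u x e y) :
    ∃ G : ℝ, ∀ j, IsFiltered μ (drive u e) G fun t ω => x t ω j := by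
  obtain ⟨c, r, hc, hr0, hr, hAk⟩ := hA.exists_pow_le
  obtain ⟨b, hb, hxb⟩ := hx.exists_eLpNorm_le
  refine ⟨_, fun j => .limit (fun M => recentState S u e M j) (fun M => n * c * b * r ^ M)
    (fun M => isFiltered_recentState hr0.le hr hAk M j) (fun t => (memLp_coord (hx.1 t) j).1)
    (fun M => by positivity) (tendsto_const_mul_pow hr0.le hr _) fun M t => ?_⟩
  exact eLpNorm_recentState_sub_le hsys hc.le hr0.le hAk hb hx.1 hxb M j t

theorem aestronglyMeasurable_state (hA : IsSchurStable S.A) (he : IsInnovation μ u e Λ)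
    (hx : IsL2Bounded μ x) (hsys : IsTrajectory μ S u x e y) (t : ℤ) (j : Fin n) :
    AEStronglyMeasurable[innovPast u e t] (fun ω => x t ω j) μ := by
  obtain ⟨c, r, hc, hr0, hr, hAk⟩ := hA.exists_pow_le
  obtain ⟨b, hb, hxb⟩ := hx.exists_eLpNorm_le
  refine aestronglyMeasurable_of_tendsto_eLpNorm (he.innovPast_le t)
    (X := fun M => recentState S u e M j t) (fun M => ?_) (memLp_coord (hx.1 t) j).1 ?_
  · refine Finset.measurable_fun_sum _ fun l hl => Finset.measurable_fun_sum _ fun a _ =>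
      Measurable.const_mul ?_ _
    have hl' : (l : ℤ) < M := by exact_mod_cast Finset.mem_range.1 hl
    cases a with
    | inl a => exact measurable_input_innovPast t _ a
    | inr a => exact measurable_innov_innovPast (by linarith) a
  · have h0 : Tendsto (fun M : ℕ => ENNReal.ofReal (n * c * b * r ^ M)) atTop (𝓝 0) := by
      simpa using ENNReal.tendsto_ofReal (tendsto_const_mul_pow hr0.le hr (n * c * b))
    exact tendsto_of_tendsto_of_tendsto_of_le_of_le tendsto_const_nhds h0 (fun _ => zero_le)
      fun M => eLpNorm_recentState_sub_le hsys hc.le hr0.le hAk hb hx.1 hxb M j t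

theorem exists_isFiltered_output (hA : IsSchurStable S.A) (he : IsInnovation μ u e Λ)
    (hx : IsL2Bounded μ x) (hsys : IsTrajectory μ S u x e y) :
    ∃ G : ℝ, ∀ a, IsFiltered μ (drive u e) G fun t ω => y t ω a := by
  obtain ⟨G, hG⟩ := exists_isFiltered_state hA hx hsys
  have h1 : ∀ a, IsFiltered μ (drive u e)
      (∑ j, |S.C a j| * G + ∑ b, |S.D a b| * 1 + 1) fun t ω => y t ω a := fun a => by
    have hu1 : ∀ b, IsFiltered μ (drive u e) 1 fun t ω => u t ω b := fun b => by
      simpa [drive] using IsFiltered.shift (μ := μ) (w := drive u e) 0 (.inl b)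
    have he1 : IsFiltered μ (drive u e) 1 fun t ω => e t ω a := by
      simpa [drive] using IsFiltered.shift (μ := μ) (w := drive u e) 0 (.inr a)
    refine IsFiltered.congr_ae (((IsFiltered.sum Finset.univ fun j _ => (hG j).smul (S.C a j)).add
      (IsFiltered.sum Finset.univ fun b _ => (hu1 b).smul (S.D a b))).add he1) (fun t => ?_)
      fun t => output_ae_eq hsys t a
    refine AEStronglyMeasurable.add (AEStronglyMeasurable.add ?_ ?_)
      (he.measurable_coord t a).aestronglyMeasurable
    · exact Finset.aestronglyMeasurable_fun_sum _ fun j _ => (memLp_coord (hx.1 t) j).1.const_mul _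
    · exact Finset.aestronglyMeasurable_fun_sum _ fun b _ =>
        (((measurable_pi_apply b).comp (he.measurable_input t)).const_mul _).aestronglyMeasurable
  refine ⟨∑ a, (∑ j, |S.C a j| * G + ∑ b, |S.D a b| * 1 + 1), fun a => (h1 a).mono ?_⟩
  exact Finset.single_le_sum (f := fun a => ∑ j, |S.C a j| * G + ∑ b, |S.D a b| * 1 + 1)
    (fun a _ => (h1 a).gain_nonneg) (Finset.mem_univ a)

theorem aestronglyMeasurable_output (hA : IsSchurStable S.A) (he : IsInnovation μ u e Λ)
    (hx : IsL2Bounded μ x) (hsys : IsTrajectory μ S u x e y) {s t : ℤ} (h : s < t) (a : Fin p) :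
    AEStronglyMeasurable[innovPast u e t] (fun ω => y s ω a) μ := by
  have h1 := fun j => aestronglyMeasurable_state hA he hx hsys s j
  choose x' hx' hxx' using h1
  refine ⟨fun ω => ∑ j, S.C a j * x' j ω + ∑ b, S.D a b * u s ω b + e s ω a,
    Measurable.stronglyMeasurable ?_, ?_⟩
  · refine Measurable.add (Measurable.add ?_ ?_) (measurable_innov_innovPast h a)
    · exact Finset.measurable_fun_sum _ fun j _ =>
        ((hx' j).measurable.mono (innovPast_mono h.le) le_rfl).const_mul _
    · exact Finset.measurable_fun_sum _ fun b _ => (measurable_input_innovPast t s b).const_mul _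
  · filter_upwards [output_ae_eq hsys s a, ae_all_iff.2 hxx'] with ω h1 h2
    rw [← h1]
    simp only [h2]

end FilteredState

/-! ### The rows of the data matrix -/

section DataRows

variable {Ω : Type*} {m0 : MeasurableSpace Ω} {μ : Measure Ω} {n m p : ℕ}

/-- The index set of the rows of `[Z_P; U_F]`. -/
abbrev RowIndex (m p ρ T : ℕ) : Type := ((Fin ρ × Fin m) ⊕ (Fin ρ × Fin p)) ⊕ (Fin T × Fin m)

/-- The scalar signal in a row of `[Z_P; U_F]`: column `k` of that row holds its value at time `k`,
divided by `√N`. -/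
def rowSignal (u : ℤ → Ω → Fin m → ℝ) (y : ℤ → Ω → Fin p → ℝ) (ρ T : ℕ) :
    RowIndex m p ρ T → ℤ → Ω → ℝ
  | .inl (.inl q) => fun t ω => u ((q.1 : ℕ) + t) ω q.2
  | .inl (.inr q) => fun t ω => y ((q.1 : ℕ) + t) ω q.2
  | .inr q => fun t ω => u (ρ + (q.1 : ℕ) + t) ω q.2

variable {S : InnovationModel n m p} {u : ℤ → Ω → Fin m → ℝ} {x : ℤ → Ω → Fin n → ℝ}
  {e y : ℤ → Ω → Fin p → ℝ} {Λ : Matrix (Fin p) (Fin p) ℝ}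

theorem ZU_apply (ρ T N : ℕ) (ω : Ω) (r : RowIndex m p ρ T) (k : Fin N) :
    ZU (fun t => u t ω) (fun t => y t ω) ρ T N r k
      = (1 / √(N : ℝ)) * rowSignal u y ρ T r (k : ℕ) ω := by
  rcases r with (q | q) | q <;> simp [ZU, ZP, UF, hankel, rowSignal]

/-- The matrix of second moments of the rows of `[Z_P; U_F]`. -/
noncomputable def rowMoment (μ : Measure Ω) (u : ℤ → Ω → Fin m → ℝ) (y : ℤ → Ω → Fin p → ℝ)
    (ρ T : ℕ) : Matrix (RowIndex m p ρ T) (RowIndex m p ρ T) ℝ :=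
  Matrix.of fun r r' => ∫ ω, rowSignal u y ρ T r 0 ω * rowSignal u y ρ T r' 0 ω ∂μ

theorem rowMoment_transpose (ρ T : ℕ) : (rowMoment μ u y ρ T)ᵀ = rowMoment μ u y ρ T := by
  ext r r'
  simp only [Matrix.transpose_apply, rowMoment, Matrix.of_apply, mul_comm]

theorem gram_sub_rowMoment_apply (ρ T N : ℕ) (ω : Ω) (r r' : RowIndex m p ρ T) :
    (ZU (fun t => u t ω) (fun t => y t ω) ρ T N * (ZU (fun t => u t ω) (fun t => y t ω) ρ T N)ᵀ
      - rowMoment μ u y ρ T) r r'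
      = centredMoment μ (rowSignal u y ρ T r) (rowSignal u y ρ T r') N ω := by
  rw [Matrix.sub_apply, Matrix.mul_apply, centredMoment, rowMoment, Matrix.of_apply]
  congr 1
  rw [← Fin.sum_univ_eq_sum_range
    (fun k => rowSignal u y ρ T r (k : ℕ) ω * rowSignal u y ρ T r' (k : ℕ) ω) N, Finset.mul_sum]
  refine Finset.sum_congr rfl fun k _ => ?_
  rw [Matrix.transpose_apply, ZU_apply, ZU_apply]
  have h : 1 / (N : ℝ) = (1 / √(N : ℝ)) * (1 / √(N : ℝ)) := by
    rw [div_mul_div_comm, one_mul, Real.mul_self_sqrt (by positivity)]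
  rw [h]
  ring

theorem exists_isFiltered_rowSignal (hA : IsSchurStable S.A) (he : IsInnovation μ u e Λ)
    (hx : IsL2Bounded μ x) (hsys : IsTrajectory μ S u x e y) :
    ∃ G : ℝ, 0 ≤ G ∧ ∀ (ρ T : ℕ) (r : RowIndex m p ρ T),
      IsFiltered μ (drive u e) G (rowSignal u y ρ T r) := by
  obtain ⟨G, hG⟩ := exists_isFiltered_output hA he hx hsys
  refine ⟨max G 1, by positivity, fun ρ T r => ?_⟩
  rcases r with (q | q) | q
  · exact (IsFiltered.shift _ (Sum.inl q.2)).mono (le_max_right _ _)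
  · exact ((hG q.2).comp_add _).mono (le_max_left _ _)
  · exact (IsFiltered.shift _ (Sum.inl q.2)).mono (le_max_right _ _)

theorem aestronglyMeasurable_rowSignal (hA : IsSchurStable S.A) (he : IsInnovation μ u e Λ)
    (hx : IsL2Bounded μ x) (hsys : IsTrajectory μ S u x e y) (ρ T : ℕ) (r : RowIndex m p ρ T)
    (k : ℤ) : AEStronglyMeasurable[innovPast u e (ρ + k)] (rowSignal u y ρ T r k) μ := by
  rcases r with (q | q) | q
  · exact (measurable_input_innovPast _ _ q.2).stronglyMeasurable.aestronglyMeasurable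
  · refine aestronglyMeasurable_output hA he hx hsys ?_ q.2
    have : ((q.1 : ℕ) : ℤ) < ρ := by exact_mod_cast q.1.2
    linarith
  · exact (measurable_input_innovPast _ _ q.2).stronglyMeasurable.aestronglyMeasurable

theorem sum_mul_rowSignal_sq (ρ T : ℕ) (c : RowIndex m p ρ T → ℝ) (k : ℤ) (ω : Ω) :
    (∑ r, c r * rowSignal u y ρ T r k ω) ^ 2
      = ∑ r, ∑ r', c r * c r' * (rowSignal u y ρ T r k ω * rowSignal u y ρ T r' k ω) := by
  rw [sq, Finset.sum_mul_sum]
  exact Finset.sum_congr rfl fun r _ => Finset.sum_congr rfl fun r' _ => by ring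

variable [IsProbabilityMeasure μ]

/-- The quadratic form of the second moment matrix, at any time. -/
theorem integral_sq_sum_rowSignal (hu : IsWideSenseStationary μ u) (he : IsInnovation μ u e Λ)
    {G : ℝ} {ρ T : ℕ} (hG : ∀ r, IsFiltered μ (drive u e) G (rowSignal u y ρ T r))
    (c : RowIndex m p ρ T → ℝ) (k : ℤ) :
    ∫ ω, (∑ r, c r * rowSignal u y ρ T r k ω) ^ 2 ∂μ = c ⬝ᵥ rowMoment μ u y ρ T *ᵥ c := by
  simp only [sum_mul_rowSignal_sq]
  have hi : ∀ r r', Integrable (fun ω => c r * c r' *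
      (rowSignal u y ρ T r k ω * rowSignal u y ρ T r' k ω)) μ := fun r r' =>
    (((hG r).memLp hu he k).integrable_mul ((hG r').memLp hu he k)).const_mul _
  rw [integral_finsetSum _ fun r _ => integrable_finsetSum _ fun r' _ => hi r r']
  simp only [dotProduct, mulVec, Finset.mul_sum]
  refine Finset.sum_congr rfl fun r _ => ?_
  rw [integral_finsetSum _ fun r' _ => hi r r']
  refine Finset.sum_congr rfl fun r' _ => ?_
  rw [integral_const_mul, (hG r).integral_mul_eq hu he (hG r') k]
  simp only [rowMoment, Matrix.of_apply]
  ring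

theorem memLp_sum_rowSignal (hu : IsWideSenseStationary μ u) (he : IsInnovation μ u e Λ)
    {G : ℝ} {ρ T : ℕ} (hG : ∀ r, IsFiltered μ (drive u e) G (rowSignal u y ρ T r))
    (c : RowIndex m p ρ T → ℝ) (k : ℤ) :
    MemLp (fun ω => ∑ r, c r * rowSignal u y ρ T r k ω) 2 μ :=
  memLp_finsetSum _ fun r _ => ((hG r).memLp hu he k).const_mul _

end DataRows

/-! ### Persistency of excitation -/

section Costate

variable {n m p : ℕ} (S : InnovationModel n m p)

/-- The costate of the linear functional with weights `wU`, `wY` on the inputs and outputs; the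
weights are listed backwards in time. -/
noncomputable def costate (wY : ℕ → Fin p → ℝ) : ℕ → Fin n → ℝ
  | 0 => 0
  | j + 1 => S.Aᵀ *ᵥ costate wY j + S.Cᵀ *ᵥ wY j

/-- The weight of the inputs after elimination of the outputs. -/
noncomputable def inputWeight (wU : ℕ → Fin m → ℝ) (wY : ℕ → Fin p → ℝ) (j : ℕ) : Fin m → ℝ :=
  wU j + S.Dᵀ *ᵥ wY j + S.Bᵀ *ᵥ costate S wY j

/-- The weight of the innovations after elimination of the outputs. -/
noncomputable def innovWeight (wY : ℕ → Fin p → ℝ) (j : ℕ) : Fin p → ℝ :=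
  wY j + S.Kᵀ *ᵥ costate S wY j

/-- Elimination of the outputs, backwards in time from time `τ`. -/
theorem sum_input_output_eq {u : ℤ → Fin m → ℝ} {x : ℤ → Fin n → ℝ} {e y : ℤ → Fin p → ℝ}
    (h : ∀ t : ℤ, x (t + 1) = S.A *ᵥ x t + S.B *ᵥ u t + S.K *ᵥ e t ∧
      y t = S.C *ᵥ x t + S.D *ᵥ u t + e t)
    (wU : ℕ → Fin m → ℝ) (wY : ℕ → Fin p → ℝ) (τ : ℤ) (j : ℕ) :
    ∑ i ∈ Finset.range j, (wU i ⬝ᵥ u (τ - i) + wY i ⬝ᵥ y (τ - i))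
      = costate S wY j ⬝ᵥ x (τ - j + 1) + ∑ i ∈ Finset.range j,
        (inputWeight S wU wY i ⬝ᵥ u (τ - i) + innovWeight S wY i ⬝ᵥ e (τ - i)) := by
  induction j with
  | zero => simp [costate]
  | succ j ih =>
    rw [Finset.sum_range_succ, Finset.sum_range_succ, ih, (h (τ - j)).1, (h (τ - j)).2,
      show τ - ((j + 1 : ℕ) : ℤ) + 1 = τ - j by push_cast; ring]
    simp only [costate, inputWeight, innovWeight, add_dotProduct, dotProduct_add,
      transpose_mulVec_dotProduct]
    ring

theorem costate_succ_eq (wY : ℕ → Fin p → ℝ) (j : ℕ) :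
    costate S wY (j + 1) = S.predAᵀ *ᵥ costate S wY j + S.Cᵀ *ᵥ innovWeight S wY j := by
  simp only [costate, innovWeight, InnovationModel.predA, Matrix.transpose_sub,
    Matrix.transpose_mul, Matrix.sub_mulVec, Matrix.mulVec_add, Matrix.mulVec_mulVec]
  abel

theorem costate_add_eq {wY : ℕ → Fin p → ℝ} {L : ℕ} (h : ∀ i, L ≤ i → wY i = 0) (M : ℕ) :
    costate S wY (L + M) = (S.A ^ M)ᵀ *ᵥ costate S wY L := by
  induction M with
  | zero => simp
  | succ M ih =>
    rw [← add_assoc, costate, ih, h (L + M) (by omega), Matrix.mulVec_zero, add_zero,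
      Matrix.mulVec_mulVec, ← Matrix.transpose_mul, pow_succ]

/-- The output of the scalar filter `s (j + 1) = r s j + g j`. -/
noncomputable def expSum (r : ℝ) (g : ℕ → ℝ) : ℕ → ℝ
  | 0 => 0
  | j + 1 => r * expSum r g j + g j

theorem expSum_nonneg {r : ℝ} (hr : 0 ≤ r) {g : ℕ → ℝ} (hg : ∀ j, 0 ≤ g j) (j : ℕ) :
    0 ≤ expSum r g j := by
  induction j with
  | zero => exact le_rfl
  | succ j ih => exact add_nonneg (mul_nonneg hr ih) (hg j)

/-- The scalar filter is bounded in the `ℓ²` sense, with gain `1 / (1 - r)`. -/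
theorem sum_sq_expSum_le {r : ℝ} (hr0 : 0 ≤ r) (hr : r < 1) (g : ℕ → ℝ) (j : ℕ) :
    ∑ i ∈ Finset.range j, expSum r g i ^ 2 ≤ (1 - r)⁻¹ ^ 2 * ∑ i ∈ Finset.range j, g i ^ 2 := by
  have h1 : 0 < 1 - r := by linarith
  have h2 : ∀ j, (1 - r) * ∑ i ∈ Finset.range j, expSum r g i ^ 2 + expSum r g j ^ 2
      ≤ (1 - r)⁻¹ * ∑ i ∈ Finset.range j, g i ^ 2 := fun j => by
    induction j with
    | zero => simp [expSum]
    | succ j ih =>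
      rw [Finset.sum_range_succ, Finset.sum_range_succ, mul_add, mul_add, expSum]
      -- convexity of the square, for the weights `r` and `1 - r`
      have h3 : (r * expSum r g j + g j) ^ 2 ≤ r * expSum r g j ^ 2 + (1 - r)⁻¹ * g j ^ 2 := by
        have h4 : r * expSum r g j ^ 2 + (1 - r)⁻¹ * g j ^ 2 - (r * expSum r g j + g j) ^ 2
            = r * (1 - r) * (expSum r g j - (1 - r)⁻¹ * g j) ^ 2 := by
          field_simp
          ring
        have : 0 ≤ r * (1 - r) * (expSum r g j - (1 - r)⁻¹ * g j) ^ 2 := by positivity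
        linarith
      linarith
  have h5 := h2 j
  have h6 : (1 - r) * ∑ i ∈ Finset.range j, expSum r g i ^ 2
      ≤ (1 - r)⁻¹ * ∑ i ∈ Finset.range j, g i ^ 2 := by
    linarith [sq_nonneg (expSum r g j)]
  calc _ = (1 - r)⁻¹ * ((1 - r) * ∑ i ∈ Finset.range j, expSum r g i ^ 2) := by
        field_simp
    _ ≤ (1 - r)⁻¹ * ((1 - r)⁻¹ * ∑ i ∈ Finset.range j, g i ^ 2) := by gcongr
    _ = _ := by ring

theorem abs_mulVec_le_of_abs_le {q : ℕ} {F : Matrix (Fin n) (Fin q) ℝ} {b : ℝ}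
    (h : ∀ i j, |F i j| ≤ b) (v : Fin q → ℝ) (i : Fin n) : |(F *ᵥ v) i| ≤ b * ∑ j, |v j| := by
  rw [mulVec, dotProduct, Finset.mul_sum]
  refine (Finset.abs_sum_le_sum_abs _ _).trans (Finset.sum_le_sum fun j _ => ?_)
  rw [abs_mul]
  exact mul_le_mul_of_nonneg_right (h i j) (abs_nonneg _)

/-- The costate is controlled by the innovation weights, because `A - K C` is stable. -/
theorem abs_predA_pow_mulVec_costate_le {c r : ℝ}
    (hF : ∀ (k : ℕ) (i j : Fin n), |(S.predA ^ k) i j| ≤ c * r ^ k) (wY : ℕ → Fin p → ℝ)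
    (j k : ℕ) (i : Fin n) :
    |((S.predA ^ k)ᵀ *ᵥ costate S wY j) i|
      ≤ c * r ^ k * expSum r (fun i => ∑ b, |(S.Cᵀ *ᵥ innovWeight S wY i) b|) j := by
  induction j generalizing k with
  | zero => simp [costate, expSum]
  | succ j ih =>
    rw [costate_succ_eq, Matrix.mulVec_add, Matrix.mulVec_mulVec, ← Matrix.transpose_mul,
      ← pow_succ', expSum, Pi.add_apply]
    refine (abs_add_le _ _).trans ?_
    have h1 := abs_mulVec_le_of_abs_le (F := (S.predA ^ k)ᵀ) (b := c * r ^ k)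
      (fun a b => hF k b a) (S.Cᵀ *ᵥ innovWeight S wY j) i
    have h2 := ih (k + 1)
    rw [pow_succ r k] at h2
    linarith

/-- The map from the weights of inputs and outputs to those of inputs and innovations is bounded
below in the `ℓ²` sense, uniformly in the horizon. -/
theorem exists_sum_weights_le (hF : IsSchurStable S.predA) :
    ∃ Q : ℝ, 0 < Q ∧ ∀ (wU : ℕ → Fin m → ℝ) (wY : ℕ → Fin p → ℝ) (j : ℕ),
      ∑ i ∈ Finset.range j, (euclNorm (wU i) ^ 2 + euclNorm (wY i) ^ 2)
        ≤ Q * ∑ i ∈ Finset.range j,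
          (euclNorm (inputWeight S wU wY i) ^ 2 + euclNorm (innovWeight S wY i) ^ 2) := by
  obtain ⟨c, r, hc, hr0, hr, hFk⟩ := hF.exists_pow_le
  have hg : ∀ wY i, ∑ b, |(S.Cᵀ *ᵥ innovWeight S wY i) b|
      ≤ n * frob S.Cᵀ * euclNorm (innovWeight S wY i) := fun wY i => by
    calc _ ≤ ∑ _b : Fin n, frob S.Cᵀ * euclNorm (innovWeight S wY i) :=
          Finset.sum_le_sum fun b _ => (abs_le_euclNorm _ b).trans (euclNorm_mulVec_le _ _)
      _ = _ := by simp [mul_assoc]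
  have hlam : ∀ wY j, euclNorm (costate S wY j)
      ≤ n * c * expSum r (fun i => ∑ b, |(S.Cᵀ *ᵥ innovWeight S wY i) b|) j := fun wY j => by
    refine (euclNorm_le_sum_abs _).trans ?_
    calc _ ≤ ∑ _i : Fin n, c * expSum r (fun i => ∑ b, |(S.Cᵀ *ᵥ innovWeight S wY i) b|) j :=
          Finset.sum_le_sum fun i _ => by
            simpa using abs_predA_pow_mulVec_costate_le S hFk wY j 0 i
      _ = _ := by simp [mul_assoc]
  -- `R` bounds every coefficient when `wY` and `wU` are expressed by the new weights and the
  -- costate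
  obtain ⟨R, hR⟩ : ∃ R : ℝ, R = 1 + frob S.Dᵀ + frob S.Kᵀ * (n * c)
    + frob S.Dᵀ * (frob S.Kᵀ * (n * c)) + frob S.Bᵀ * (n * c) := ⟨_, rfl⟩
  have hD := frob_nonneg S.Dᵀ
  have hK := frob_nonneg S.Kᵀ
  have hB := frob_nonneg S.Bᵀ
  have hnc : 0 ≤ n * c := by positivity
  have hR1 : 1 ≤ R := by
    have := mul_nonneg hK hnc
    have := mul_nonneg hD this
    have := mul_nonneg hB hnc
    rw [hR]
    linarith
  refine ⟨6 * R ^ 2 * (1 + (1 - r)⁻¹ ^ 2 * (n * frob S.Cᵀ) ^ 2), by positivity,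
    fun wU wY j => ?_⟩
  obtain ⟨s, hs⟩ : ∃ s : ℕ → ℝ,
      s = expSum r (fun i => ∑ b, |(S.Cᵀ *ᵥ innovWeight S wY i) b|) := ⟨_, rfl⟩
  have hs0 : ∀ i, 0 ≤ s i := fun i => by
    rw [hs]
    exact expSum_nonneg hr0.le (fun _ => Finset.sum_nonneg fun _ _ => abs_nonneg _) i
  have hsum : ∑ i ∈ Finset.range j, s i ^ 2 ≤ (1 - r)⁻¹ ^ 2 * (n * frob S.Cᵀ) ^ 2 *
      ∑ i ∈ Finset.range j, euclNorm (innovWeight S wY i) ^ 2 := by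
    rw [hs]
    refine (sum_sq_expSum_le hr0.le hr _ j).trans ?_
    rw [mul_assoc, Finset.mul_sum (a := (n * frob S.Cᵀ) ^ 2)]
    refine mul_le_mul_of_nonneg_left (Finset.sum_le_sum fun i _ => ?_) (by positivity)
    rw [← mul_pow]
    exact pow_le_pow_left₀ (Finset.sum_nonneg fun _ _ => abs_nonneg _) (hg wY i) 2
  have hstep : ∀ i, euclNorm (wU i) ^ 2 + euclNorm (wY i) ^ 2
      ≤ 6 * R ^ 2 * (euclNorm (inputWeight S wU wY i) ^ 2
        + euclNorm (innovWeight S wY i) ^ 2 + s i ^ 2) := fun i => by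
    have hl : euclNorm (costate S wY i) ≤ n * c * s i := by rw [hs]; exact hlam wY i
    have hb := euclNorm_nonneg (inputWeight S wU wY i)
    have hd := euclNorm_nonneg (innovWeight S wY i)
    have hsi := hs0 i
    have h1 : euclNorm (wY i)
        ≤ euclNorm (innovWeight S wY i) + frob S.Kᵀ * (n * c * s i) := by
      calc euclNorm (wY i) = euclNorm (innovWeight S wY i + -(S.Kᵀ *ᵥ costate S wY i)) := by
            rw [innovWeight]; congr 1; abel
        _ ≤ _ := (euclNorm_add_le _ _).trans (add_le_add_right (by
            rw [euclNorm_neg]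
            exact (euclNorm_mulVec_le _ _).trans (mul_le_mul_of_nonneg_left hl hK)) _)
    have h2 : euclNorm (wU i) ≤ euclNorm (inputWeight S wU wY i)
        + frob S.Dᵀ * euclNorm (wY i) + frob S.Bᵀ * (n * c * s i) := by
      calc euclNorm (wU i) = euclNorm (inputWeight S wU wY i + -(S.Dᵀ *ᵥ wY i)
            + -(S.Bᵀ *ᵥ costate S wY i)) := by rw [inputWeight]; congr 1; abel
        _ ≤ _ := (euclNorm_add_le _ _).trans (add_le_add ((euclNorm_add_le _ _).trans
            (add_le_add_right (by rw [euclNorm_neg]; exact euclNorm_mulVec_le _ _) _)) (by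
            rw [euclNorm_neg]
            exact (euclNorm_mulVec_le _ _).trans (mul_le_mul_of_nonneg_left hl hB)))
    generalize euclNorm (inputWeight S wU wY i) = b at *
    generalize euclNorm (innovWeight S wY i) = d at *
    have h3 : euclNorm (wY i) ≤ R * (b + d + s i) := by
      have : d + frob S.Kᵀ * (n * c * s i) ≤ R * (b + d + s i) := by
        rw [hR]
        have e1 := mul_nonneg hK hnc
        have e2 := mul_nonneg hD e1
        have e3 := mul_nonneg hB hnc
        have e4 : 0 ≤ b + d + s i := by positivity
        nlinarith [mul_nonneg hD e4, mul_nonneg e1 hb, mul_nonneg e1 hd, mul_nonneg e2 e4,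
          mul_nonneg e3 e4]
      linarith
    have h4 : euclNorm (wU i) ≤ R * (b + d + s i) := by
      have e0 := mul_le_mul_of_nonneg_left h1 hD
      have : b + frob S.Dᵀ * (d + frob S.Kᵀ * (n * c * s i)) + frob S.Bᵀ * (n * c * s i)
          ≤ R * (b + d + s i) := by
        rw [hR]
        have e1 := mul_nonneg hK hnc
        have e2 := mul_nonneg hD e1
        have e3 := mul_nonneg hB hnc
        have e4 : 0 ≤ b + d + s i := by positivity
        have e5 : 0 ≤ b + d := by positivity
        have e6 : 0 ≤ b + s i := by positivity
        nlinarith [mul_nonneg hD e6, mul_nonneg e1 e4, mul_nonneg e2 e5, mul_nonneg e3 e5]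
      linarith
    have h5 := pow_le_pow_left₀ (euclNorm_nonneg _) h3 2
    have h6 := pow_le_pow_left₀ (euclNorm_nonneg _) h4 2
    have h7 : (b + d + s i) ^ 2 ≤ 3 * (b ^ 2 + d ^ 2 + s i ^ 2) := by
      nlinarith [sq_nonneg (b - d), sq_nonneg (b - s i), sq_nonneg (d - s i)]
    have h8 := mul_le_mul_of_nonneg_left h7 (sq_nonneg R)
    rw [mul_pow] at h5 h6
    linarith
  refine (Finset.sum_le_sum fun i _ => hstep i).trans ?_
  rw [← Finset.mul_sum, mul_assoc (6 * R ^ 2)]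
  refine mul_le_mul_of_nonneg_left ?_ (by positivity)
  rw [Finset.sum_add_distrib, add_mul, one_mul]
  refine add_le_add_right (hsum.trans (mul_le_mul_of_nonneg_left ?_ (by positivity))) _
  exact Finset.sum_le_sum fun i _ => le_add_of_nonneg_left (sq_nonneg _)

end Costate

section Excitation

variable {Ω : Type*} {m0 : MeasurableSpace Ω} {μ : Measure Ω} {n m p : ℕ}
  {S : InnovationModel n m p} {u : ℤ → Ω → Fin m → ℝ} {x : ℤ → Ω → Fin n → ℝ}
  {e y : ℤ → Ω → Fin p → ℝ} {Λ : Matrix (Fin p) (Fin p) ℝ}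

theorem memLp_dotProduct {s : ℕ} {X : Ω → Fin s → ℝ} (hX : ∀ a, MemLp (fun ω => X ω a) 2 μ)
    (w : Fin s → ℝ) : MemLp (fun ω => w ⬝ᵥ X ω) 2 μ :=
  memLp_finsetSum _ fun a _ => (hX a).const_mul _

/-- A sequence on `0, …, L - 1`, read backwards and continued by zero. -/
noncomputable def reversed {s : ℕ} (w : ℕ → Fin s → ℝ) (L i : ℕ) : Fin s → ℝ :=
  if i < L then w (L - 1 - i) else 0

theorem sum_reversed_dotProduct {s : ℕ} (w : ℕ → Fin s → ℝ) (z : ℤ → Fin s → ℝ) (L M : ℕ) :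
    ∑ i ∈ Finset.range (L + M), reversed w L i ⬝ᵥ z ((L : ℤ) - 1 - i)
      = ∑ t ∈ Finset.range L, w t ⬝ᵥ z t := by
  rw [Finset.sum_range_add, ← Finset.sum_range_reflect (fun t => w t ⬝ᵥ z t) L]
  have h2 : ∑ i ∈ Finset.range M, reversed w L (L + i) ⬝ᵥ z ((L : ℤ) - 1 - ((L + i : ℕ) : ℤ)) = 0 :=
    Finset.sum_eq_zero fun i _ => by simp [reversed]
  rw [h2, add_zero]
  refine Finset.sum_congr rfl fun i hi => ?_
  have hi' := Finset.mem_range.1 hi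
  rw [reversed, if_pos hi', show ((L - 1 - i : ℕ) : ℤ) = (L : ℤ) - 1 - i by omega]

theorem sum_euclNorm_reversed {s : ℕ} (w : ℕ → Fin s → ℝ) (L : ℕ) :
    ∑ i ∈ Finset.range L, euclNorm (reversed w L i) ^ 2
      = ∑ t ∈ Finset.range L, euclNorm (w t) ^ 2 := by
  rw [← Finset.sum_range_reflect (fun t => euclNorm (w t) ^ 2) L]
  refine Finset.sum_congr rfl fun i hi => ?_
  rw [reversed, if_pos (Finset.mem_range.1 hi)]

variable [IsProbabilityMeasure μ]

/-- Inputs and outputs over a finite horizon have covariance bounded below, uniformly in the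
horizon. -/
theorem exists_le_integral_sq_input_output (hA : IsSchurStable S.A) (hF : IsSchurStable S.predA)
    (hu : IsWideSenseStationary μ u) (he : IsInnovation μ u e Λ) (hx : IsL2Bounded μ x)
    (hsys : IsTrajectory μ S u x e y) (hs : HasBoundedFullRankSpectrum μ u) (hΛ : Λ.PosDef) :
    ∃ κ : ℝ, 0 < κ ∧ ∀ (L : ℕ) (wU : ℕ → Fin m → ℝ) (wY : ℕ → Fin p → ℝ),
      κ * ∑ t ∈ Finset.range L, (euclNorm (wU t) ^ 2 + euclNorm (wY t) ^ 2)
        ≤ ∫ ω, (∑ t ∈ Finset.range L, (wU t ⬝ᵥ u t ω + wY t ⬝ᵥ y t ω)) ^ 2 ∂μ := by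
  obtain ⟨c0, hc0, h0⟩ := exists_le_integral_sq_drive (fun t => hu.memLp t) he hs hΛ
  obtain ⟨Q, hQ, hQw⟩ := exists_sum_weights_le S hF
  obtain ⟨c, r, hc, hr0, hr, hAk⟩ := hA.exists_pow_le
  obtain ⟨b, hb, hxb⟩ := hx.exists_eLpNorm_le
  obtain ⟨G, hG⟩ := exists_isFiltered_output hA he hx hsys
  refine ⟨c0 / Q, by positivity, fun L wU wY => ?_⟩
  obtain ⟨X, hX⟩ : ∃ X : Ω → ℝ,
      X = fun ω => ∑ t ∈ Finset.range L, (wU t ⬝ᵥ u t ω + wY t ⬝ᵥ y t ω) := ⟨_, rfl⟩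
  have hXm : MemLp X 2 μ := by
    rw [hX]
    exact memLp_finsetSum _ fun t _ => (memLp_dotProduct (memLp_coord (hu.memLp t)) _).add
      (memLp_dotProduct (fun a => (hG a).memLp hu he t) _)
  obtain ⟨vU, hvU⟩ : ∃ vU, vU = reversed wU L := ⟨_, rfl⟩
  obtain ⟨vY, hvY⟩ : ∃ vY, vY = reversed wY L := ⟨_, rfl⟩
  obtain ⟨R, hR⟩ : ∃ R : ℝ, R = ∑ j, |costate S vY L j| * (n * c * b) := ⟨_, rfl⟩
  have hR0 : 0 ≤ R := by rw [hR]; positivity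
  have hlim : Tendsto (fun M : ℕ => (√(∫ ω, X ω ^ 2 ∂μ) + R * r ^ M) ^ 2) atTop
      (𝓝 (∫ ω, X ω ^ 2 ∂μ)) := by
    have h1 := ((tendsto_const_mul_pow hr0.le hr R).const_add √(∫ ω, X ω ^ 2 ∂μ)).pow 2
    rwa [add_zero, Real.sq_sqrt (integral_nonneg fun ω => sq_nonneg _)] at h1
  -- With the weights continued by zero for `M` further steps, the costate at the end is
  -- `(A ^ M)ᵀ` times a fixed vector, so that the remaining state term vanishes as `M → ∞`.
  have hkey : ∀ M : ℕ, c0 / Q * ∑ t ∈ Finset.range L, (euclNorm (wU t) ^ 2 + euclNorm (wY t) ^ 2)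
      ≤ (√(∫ ω, X ω ^ 2 ∂μ) + R * r ^ M) ^ 2 := fun M => by
    obtain ⟨ε, hε⟩ : ∃ ε : Ω → ℝ,
      ε = fun ω => costate S vY L ⬝ᵥ (S.A ^ M *ᵥ x ((L : ℤ) - 1 - ((L + M : ℕ) : ℤ) + 1) ω) :=
      ⟨_, rfl⟩
    have hxm : ∀ j, AEStronglyMeasurable (fun ω =>
        (S.A ^ M *ᵥ x ((L : ℤ) - 1 - ((L + M : ℕ) : ℤ) + 1) ω) j) μ := fun j =>
      (memLp_dotProduct (memLp_coord (hx.1 _)) _).1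
    have hεb : eLpNorm ε 2 μ ≤ ENNReal.ofReal (R * r ^ M) := by
      rw [hε]
      refine (eLpNorm_sum_le_ofReal (by norm_num) Finset.univ
        (X := fun j ω => costate S vY L j
          * (S.A ^ M *ᵥ x ((L : ℤ) - 1 - ((L + M : ℕ) : ℤ) + 1) ω) j)
        (b := fun j => |costate S vY L j| * (n * c * b * r ^ M)) (fun _ _ => by positivity)
        (fun j _ => (hxm j).const_mul _) fun j _ => eLpNorm_const_mul_le _
        (eLpNorm_pow_mulVec_le hc.le hr0.le hAk hb (fun j => (memLp_coord (hx.1 _) j).1)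
          (hxb _) M j)).trans (ENNReal.ofReal_le_ofReal (le_of_eq ?_))
      rw [hR, Finset.sum_mul]
      exact Finset.sum_congr rfl fun j _ => by ring
    have hεm : MemLp ε 2 μ := by
      refine memLp_of_eLpNorm_le ?_ hεb
      rw [hε]
      exact Finset.aestronglyMeasurable_fun_sum _ fun j _ => (hxm j).const_mul _
    have hV : (fun ω => ∑ i ∈ Finset.range (L + M),
        (inputWeight S vU vY i ⬝ᵥ u ((L : ℤ) - 1 - i) ω
          + innovWeight S vY i ⬝ᵥ e ((L : ℤ) - 1 - i) ω)) =ᵐ[μ] fun ω => X ω + (-1) * ε ω := by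
      filter_upwards [hsys] with ω hω
      have h1 := sum_input_output_eq S (u := fun t => u t ω) (x := fun t => x t ω)
        (e := fun t => e t ω) (y := fun t => y t ω) hω vU vY ((L : ℤ) - 1) (L + M)
      rw [Finset.sum_add_distrib, hvU, hvY, sum_reversed_dotProduct wU (fun t => u t ω),
        sum_reversed_dotProduct wY (fun t => y t ω), ← Finset.sum_add_distrib, ← hvU, ← hvY,
        costate_add_eq S (fun i hi => by rw [hvY, reversed, if_neg (by omega)]),
        transpose_mulVec_dotProduct] at h1
      rw [hX, hε]
      simp only
      rw [h1]
      ring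
    have hVm := (hXm.add (hεm.const_mul (-1))).ae_eq hV.symm
    have hVb : ∫ ω, (∑ i ∈ Finset.range (L + M),
        (inputWeight S vU vY i ⬝ᵥ u ((L : ℤ) - 1 - i) ω
          + innovWeight S vY i ⬝ᵥ e ((L : ℤ) - 1 - i) ω)) ^ 2 ∂μ
        ≤ (√(∫ ω, X ω ^ 2 ∂μ) + R * r ^ M) ^ 2 := by
      rw [← eLpNorm_two_le_iff_integral hVm (by positivity), eLpNorm_congr_ae hV]
      refine eLpNorm_add_le_ofReal (by norm_num) (Real.sqrt_nonneg _) (by positivity) hXm.1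
        (hεm.1.const_mul _) ?_ ?_
      · rw [eLpNorm_two_le_iff_integral hXm (Real.sqrt_nonneg _),
          Real.sq_sqrt (integral_nonneg fun ω => sq_nonneg _)]
      · simpa using eLpNorm_const_mul_le (-1) hεb
    have h2 := h0 (L + M) (fun i => (L : ℤ) - 1 - i) (fun i j hij => by simpa using hij)
      (inputWeight S vU vY) (innovWeight S vY)
    simp only [← euclNorm_sq] at h2
    refine le_trans ?_ (h2.trans hVb)
    have h3 := hQw vU vY (L + M)
    have h4 : ∑ t ∈ Finset.range L, (euclNorm (wU t) ^ 2 + euclNorm (wY t) ^ 2)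
        ≤ ∑ i ∈ Finset.range (L + M), (euclNorm (vU i) ^ 2 + euclNorm (vY i) ^ 2) := by
      rw [Finset.sum_range_add, Finset.sum_add_distrib, Finset.sum_add_distrib, hvU, hvY,
        sum_euclNorm_reversed, sum_euclNorm_reversed]
      exact le_add_of_nonneg_right (by positivity)
    rw [div_mul_eq_mul_div, div_le_iff₀ hQ, mul_assoc]
    refine mul_le_mul_of_nonneg_left ((h4.trans h3).trans (le_of_eq (mul_comm _ _))) hc0.le
  have := ge_of_tendsto' hlim hkey
  rwa [hX] at this

/-- The inputs' weight at time `t` for a linear combination of the rows of `[Z_P; U_F]`. -/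
noncomputable def rowInput {ρ T : ℕ} (c : RowIndex m p ρ T → ℝ) (t : ℕ) (a : Fin m) : ℝ :=
  if h : t < ρ then c (.inl (.inl (⟨t, h⟩, a)))
  else if h : t - ρ < T then c (.inr (⟨t - ρ, h⟩, a)) else 0

/-- The outputs' weight at time `t` for a linear combination of the rows of `[Z_P; U_F]`. -/
noncomputable def rowOutput {ρ T : ℕ} (c : RowIndex m p ρ T → ℝ) (t : ℕ) (a : Fin p) : ℝ :=
  if h : t < ρ then c (.inl (.inr (⟨t, h⟩, a))) else 0

/-- A sum over the rows of `[Z_P; U_F]` as a sum over time. -/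
theorem sum_rowIndex {ρ T : ℕ} (f : RowIndex m p ρ T → ℝ) (gU : ℕ → ℝ) (gY : ℕ → ℝ)
    (h1 : ∀ t : Fin ρ, gU t = ∑ a, f (.inl (.inl (t, a))))
    (h2 : ∀ t : Fin ρ, gY t = ∑ a, f (.inl (.inr (t, a))))
    (h3 : ∀ t : Fin T, gU (ρ + t) = ∑ a, f (.inr (t, a))) (h4 : ∀ t : ℕ, gY (ρ + t) = 0) :
    ∑ t ∈ Finset.range (ρ + T), (gU t + gY t) = ∑ r, f r := by
  rw [Finset.sum_range_add, ← Fin.sum_univ_eq_sum_range (fun t => gU t + gY t),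
    ← Fin.sum_univ_eq_sum_range (fun t => gU (ρ + t) + gY (ρ + t))]
  simp only [h1, h2, h3, h4, add_zero, Fintype.sum_sum_type, Fintype.sum_prod_type,
    Finset.sum_add_distrib]

theorem sum_rowInput_rowOutput {ρ T : ℕ} (c : RowIndex m p ρ T → ℝ) (ω : Ω) :
    ∑ t ∈ Finset.range (ρ + T), (rowInput c t ⬝ᵥ u t ω + rowOutput c t ⬝ᵥ y t ω)
      = ∑ r, c r * rowSignal u y ρ T r 0 ω := by
  refine sum_rowIndex (fun r => c r * rowSignal u y ρ T r 0 ω) (fun t => rowInput c t ⬝ᵥ u t ω)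
    (fun t => rowOutput c t ⬝ᵥ y t ω) ?_ ?_ ?_ ?_ <;> intro t <;>
    simp [rowInput, rowOutput, rowSignal, dotProduct]

theorem sum_euclNorm_rowInput_rowOutput {ρ T : ℕ} (c : RowIndex m p ρ T → ℝ) :
    ∑ t ∈ Finset.range (ρ + T), (euclNorm (rowInput c t) ^ 2 + euclNorm (rowOutput c t) ^ 2)
      = euclNorm c ^ 2 := by
  rw [euclNorm_sq]
  refine sum_rowIndex (fun r => c r ^ 2) (fun t => euclNorm (rowInput c t) ^ 2)
    (fun t => euclNorm (rowOutput c t) ^ 2) ?_ ?_ ?_ ?_ <;> intro t <;>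
    simp [rowInput, rowOutput, euclNorm_sq]

/-- The second moment matrix of the data is bounded below, uniformly in the past horizon. -/
theorem exists_le_quadraticForm_rowMoment (hA : IsSchurStable S.A) (hF : IsSchurStable S.predA)
    (hu : IsWideSenseStationary μ u) (he : IsInnovation μ u e Λ) (hx : IsL2Bounded μ x)
    (hsys : IsTrajectory μ S u x e y) (hs : HasBoundedFullRankSpectrum μ u) (hΛ : Λ.PosDef) :
    ∃ κ : ℝ, 0 < κ ∧ ∀ (ρ T : ℕ) (c : RowIndex m p ρ T → ℝ),
      κ * euclNorm c ^ 2 ≤ c ⬝ᵥ rowMoment μ u y ρ T *ᵥ c := by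
  obtain ⟨κ, hκ, h⟩ := exists_le_integral_sq_input_output hA hF hu he hx hsys hs hΛ
  obtain ⟨G, -, hG⟩ := exists_isFiltered_rowSignal hA he hx hsys
  refine ⟨κ, hκ, fun ρ T c => ?_⟩
  have h1 := h (ρ + T) (rowInput c) (rowOutput c)
  simp only [sum_rowInput_rowOutput] at h1
  rwa [sum_euclNorm_rowInput_rowOutput, integral_sq_sum_rowSignal hu he (hG ρ T)] at h1

end Excitation

/-! ### Reduction of the relations to the projected innovations and states -/

section Reduction

variable {Ω : Type*} {m0 : MeasurableSpace Ω} {μ : Measure Ω} {n m p : ℕ}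
  {S : InnovationModel n m p} {u : ℤ → Ω → Fin m → ℝ} {x : ℤ → Ω → Fin n → ℝ}
  {e y : ℤ → Ω → Fin p → ℝ} {Λ : Matrix (Fin p) (Fin p) ℝ} {T : ℕ}

/-- The orthogonal projector on the row span of `[Z_P; U_F]`. -/
noncomputable def dataProjector (u : ℤ → Ω → Fin m → ℝ) (y : ℤ → Ω → Fin p → ℝ) (ρ T N : ℕ)
    (ω : Ω) : Matrix (Fin N) (Fin N) ℝ :=
  rowProjector (ZU (fun t => u t ω) (fun t => y t ω) ρ T N)

/-- The output relation holds if the future innovations, projected on the data, act on `α` as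
`O_P(1/√N)`. -/
theorem outputRelation_of_innov (hsys : IsTrajectory μ S u x e y) {ρ : ℕ → Ω → ℕ}
    {α : (N : ℕ) → Ω → Fin N → ℝ}
    (h : ∀ q : Fin T × Fin p, IsBigOP μ (fun N ω => hankel (fun t => e t ω) (ρ N ω) T N q ⬝ᵥ
      dataProjector u y (ρ N ω) T N ω *ᵥ α N ω) rootRate) :
    OutputRelation μ S u x y T ρ α := by
  refine IsBigOP.mono_ae ((IsBigOP.sum Finset.univ fun q _ => h q).const_mul
    (frob (S.noise.Hd T))) ?_
  filter_upwards [hsys] with ω hω N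
  rw [yfHat, xdHat, uf, output_error_eq hω, abs_of_nonneg (euclNorm_nonneg _)]
  refine ((euclNorm_mulVec_le _ _).trans ?_).trans (le_abs_self _)
  exact mul_le_mul_of_nonneg_left (euclNorm_le_sum_abs _) (frob_nonneg _)

theorem isBigOP_frob_hankelRow (hx : IsL2Bounded μ x) :
    IsBigOP μ (fun N ω => frob (hankelRow (fun t => x t ω) 0 N)) fun _ => 1 := by
  obtain ⟨b, hb, hxb⟩ := hx.exists_eLpNorm_le
  simp only [frob]
  refine (isBigOP_euclNorm (ι := fun N => Fin n × Fin N) (b := fun N => 1 / √(N : ℝ) * b)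
    (fun N ω q => hankelRow (fun t => x t ω) 0 N q.1 q.2) (fun N q => ?_) (fun N => by positivity)
    (Eventually.of_forall fun N q => ?_)).rate (√n * b) ?_
  · exact (memLp_coord (hx.1 _) q.1).1.const_mul _
  · have := eLpNorm_const_mul_le (1 / √(N : ℝ)) (hxb (0 + (q.2 : ℕ)) q.1)
    rwa [abs_of_nonneg (by positivity)] at this
  · filter_upwards [eventually_ge_atTop 1] with N hN
    have hN' : (0 : ℝ) < √N := Real.sqrt_pos.2 (by exact_mod_cast hN)
    rw [abs_of_nonneg (by positivity), abs_one, mul_one, Fintype.card_prod, Fintype.card_fin,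
      Fintype.card_fin, Nat.cast_mul, Real.sqrt_mul (by positivity)]
    refine le_of_eq ?_
    field_simp

/-- The state relation holds if the projection of `α` on the data is bounded in probability. -/
theorem stateRelation_of_projection (hx : IsL2Bounded μ x) (hsys : IsTrajectory μ S u x e y)
    {ρ : ℕ → Ω → ℕ} {α : (N : ℕ) → Ω → Fin N → ℝ}
    (h : IsBigOP μ (fun N ω => euclNorm (dataProjector u y (ρ N ω) T N ω *ᵥ α N ω)) fun _ => 1)
    (hρ : LongHorizon μ S ρ) : StateRelation μ S u x y T ρ α := by
  have h1 := (isBigOP_frob_hankelRow hx).mul h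
  simp only [mul_one] at h1
  refine IsLittleOP.mono_ae (IsLittleOP.mul_isBigOP hρ h1) ?_
  filter_upwards [hsys] with ω hω N
  rw [xdHat, zInit, state_error_eq hω, abs_of_nonneg (euclNorm_nonneg _)]
  refine ((euclNorm_mulVec_le_opNorm _ _).trans ?_).trans (le_abs_self _)
  exact mul_le_mul_of_nonneg_left (euclNorm_mulVec_le _ _) (norm_nonneg _)

/-- The state relation for a long past horizon: a projection does not increase `‖α‖`. -/
theorem stateRelation_longHorizon (hx : IsL2Bounded μ x) (hsys : IsTrajectory μ S u x e y) (T : ℕ)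
    (ρ : ℕ → Ω → ℕ) (α : (N : ℕ) → Ω → Fin N → ℝ)
    (hα : IsBigOP μ (fun N ω => euclNorm (α N ω)) fun _ => 1) (hρ : LongHorizon μ S ρ) :
    StateRelation μ S u x y T ρ α := by
  refine stateRelation_of_projection hx hsys (hα.mono fun N ω => ?_) hρ
  rw [abs_of_nonneg (euclNorm_nonneg _), abs_of_nonneg (euclNorm_nonneg _)]
  exact euclNorm_rowProjector_le _ _

theorem outputDataRelation_of_relations {ρ : ℕ → Ω → ℕ} {α : (N : ℕ) → Ω → Fin N → ℝ}
    (h1 : OutputRelation μ S u x y T ρ α) (h2 : StateRelation μ S u x y T ρ α) :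
    OutputDataRelation μ S u y T ρ α := by
  refine (IsBigOP.add h1 (IsLittleOP.isBigOP h2 |>.const_mul (frob (S.Gam T)))).mono fun N ω => ?_
  have h3 : yfHat u y T ρ α N ω
      - (S.Gam T *ᵥ (S.Cal (ρ N ω) *ᵥ zInit u y ρ α N ω) + S.Hd T *ᵥ uf u T ρ α N ω)
      = (yfHat u y T ρ α N ω
        - (S.Gam T *ᵥ xdHat u x y T ρ α N ω + S.Hd T *ᵥ uf u T ρ α N ω))
        + S.Gam T *ᵥ (xdHat u x y T ρ α N ω - S.Cal (ρ N ω) *ᵥ zInit u y ρ α N ω) := by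
    rw [Matrix.mulVec_sub]
    abel
  rw [h3, abs_of_nonneg (euclNorm_nonneg _)]
  refine ((euclNorm_add_le _ _).trans (add_le_add (le_abs_self _) ?_)).trans (le_abs_self _)
  exact (euclNorm_mulVec_le _ _).trans (le_abs_self _)

end Reduction

/-! ### Correlation of the data with the future innovations -/

section Correlation

variable {Ω : Type*} {m0 : MeasurableSpace Ω} {μ : Measure Ω} {n m p : ℕ}
  {S : InnovationModel n m p} {u : ℤ → Ω → Fin m → ℝ} {x : ℤ → Ω → Fin n → ℝ}
  {e y : ℤ → Ω → Fin p → ℝ} {Λ : Matrix (Fin p) (Fin p) ℝ} {G : ℝ}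

theorem single_dotProduct_rowMoment (ρ T : ℕ) (r : RowIndex m p ρ T) :
    Pi.single r 1 ⬝ᵥ rowMoment μ u y ρ T *ᵥ Pi.single r 1
      = ∫ ω, rowSignal u y ρ T r 0 ω ^ 2 ∂μ := by
  simp [rowMoment, sq]

variable [IsProbabilityMeasure μ]

theorem exists_eLpNorm_rowSignal_le (hu : IsWideSenseStationary μ u) (he : IsInnovation μ u e Λ)
    (hG0 : 0 ≤ G)
    (hG : ∀ (ρ T : ℕ) (r : RowIndex m p ρ T), IsFiltered μ (drive u e) G (rowSignal u y ρ T r)) :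
    ∃ B : ℝ, 0 ≤ B ∧ ∀ (ρ T : ℕ) (r : RowIndex m p ρ T) (k : ℤ),
      eLpNorm (rowSignal u y ρ T r k) 2 μ ≤ ENNReal.ofReal B := by
  obtain ⟨b, hb0, hb⟩ := exists_eLpNorm_drive_le hu he
  exact ⟨G * b, by positivity, fun ρ T r k =>
    ((hG ρ T r).memLp_and_eLpNorm_le (memLp_drive hu he) hb0 hb k).2⟩

theorem dotProduct_ZU_mulVec_hankel (ρ T N : ℕ) (h : RowIndex m p ρ T → ℝ) (q : Fin T × Fin p)
    (ω : Ω) : h ⬝ᵥ ZU (fun t => u t ω) (fun t => y t ω) ρ T N *ᵥ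
        hankel (fun t => e t ω) ρ T N q
      = (1 / (N : ℝ)) * ∑ k ∈ Finset.range N, (∑ r, h r * rowSignal u y ρ T r k ω)
        * e (ρ + (q.1 : ℕ) + (k : ℤ)) ω q.2 := by
  have hN : 1 / (N : ℝ) = (1 / √(N : ℝ)) * (1 / √(N : ℝ)) := by
    rw [div_mul_div_comm, one_mul, Real.mul_self_sqrt (by positivity)]
  rw [Matrix.dotProduct_mulVec, ← Fin.sum_univ_eq_sum_range (fun k =>
    (∑ r, h r * rowSignal u y ρ T r (k : ℕ) ω) * e (ρ + (q.1 : ℕ) + (k : ℤ)) ω q.2) N,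
    Finset.mul_sum]
  refine Finset.sum_congr rfl fun k _ => ?_
  simp only [Matrix.vecMul, dotProduct, ZU_apply, hankel, Matrix.of_apply, hN]
  have : ∑ r, h r * ((1 / √(N : ℝ)) * rowSignal u y ρ T r (k : ℕ) ω)
      = (1 / √(N : ℝ)) * ∑ r, h r * rowSignal u y ρ T r (k : ℕ) ω := by
    rw [Finset.mul_sum]
    exact Finset.sum_congr rfl fun r _ => by ring
  rw [this]
  ring

/-- A fixed linear combination of the data rows is nearly orthogonal to the future innovations. -/
theorem eLpNorm_dotProduct_ZU_hankel_le (hA : IsSchurStable S.A) (hu : IsWideSenseStationary μ u)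
    (he : IsInnovation μ u e Λ) (hx : IsL2Bounded μ x) (hsys : IsTrajectory μ S u x e y)
    {ρ T : ℕ} (hG : ∀ r : RowIndex m p ρ T, IsFiltered μ (drive u e) G (rowSignal u y ρ T r))
    (h : RowIndex m p ρ T → ℝ) (q : Fin T × Fin p) (N : ℕ) :
    eLpNorm (fun ω => h ⬝ᵥ ZU (fun t => u t ω) (fun t => y t ω) ρ T N *ᵥ
        hankel (fun t => e t ω) ρ T N q) 2 μ
      ≤ ENNReal.ofReal (√(Λ q.2 q.2) * √(h ⬝ᵥ rowMoment μ u y ρ T *ᵥ h) / √N) := by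
  simp only [dotProduct_ZU_mulVec_hankel]
  refine he.eLpNorm_average_le (ρ + (q.1 : ℕ)) q.2 (Real.sqrt_nonneg _) (fun k => ?_)
    (fun k => ?_) N
  · have h1 : innovPast u e (ρ + k) ≤ innovPast u e (ρ + (q.1 : ℕ) + k) :=
      innovPast_mono (by linarith [Int.natCast_nonneg (q.1 : ℕ)])
    choose g hg hgr using fun r => (aestronglyMeasurable_rowSignal hA he hx hsys ρ T r k).mono h1
    refine ⟨fun ω => ∑ r, h r * g r ω, Measurable.stronglyMeasurable
      (Finset.measurable_fun_sum _ fun r _ => (hg r).measurable.const_mul _), ?_⟩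
    filter_upwards [ae_all_iff.2 hgr] with ω hω
    simp only [hω]
  · rw [eLpNorm_two_le_iff_integral (memLp_sum_rowSignal hu he hG h k) (Real.sqrt_nonneg _),
      ← integral_sq_sum_rowSignal hu he hG h k, Real.sq_sqrt (integral_nonneg fun _ => sq_nonneg _)]

theorem aestronglyMeasurable_dotProduct_ZU_hankel (hu : IsWideSenseStationary μ u)
    (he : IsInnovation μ u e Λ)
    {ρ T : ℕ} (hG : ∀ r : RowIndex m p ρ T, IsFiltered μ (drive u e) G (rowSignal u y ρ T r))
    (h : RowIndex m p ρ T → ℝ) (q : Fin T × Fin p) (N : ℕ) :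
    AEStronglyMeasurable (fun ω => h ⬝ᵥ ZU (fun t => u t ω) (fun t => y t ω) ρ T N *ᵥ
        hankel (fun t => e t ω) ρ T N q) μ := by
  simp only [dotProduct_ZU_mulVec_hankel]
  have hk : ∀ k ∈ Finset.range N, AEStronglyMeasurable (fun ω =>
      (∑ r, h r * rowSignal u y ρ T r k ω) * e (ρ + (q.1 : ℕ) + (k : ℤ)) ω q.2) μ := fun k _ =>
    (memLp_sum_rowSignal hu he hG h k).1.mul (he.measurable_coord _ _).aestronglyMeasurable
  exact (Finset.aestronglyMeasurable_fun_sum _ hk).const_mul _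

/-- The data rows are jointly nearly orthogonal to the future innovations. -/
theorem isBigOP_ZU_mulVec_hankel (hA : IsSchurStable S.A) (hu : IsWideSenseStationary μ u)
    (he : IsInnovation μ u e Λ) (hx : IsL2Bounded μ x) (hsys : IsTrajectory μ S u x e y)
    {T : ℕ} (q : Fin T × Fin p) (ρ : ℕ → ℕ) :
    IsBigOP μ (fun N ω => euclNorm (ZU (fun t => u t ω) (fun t => y t ω) (ρ N) T N *ᵥ
        hankel (fun t => e t ω) (ρ N) T N q))
      fun N => √(Fintype.card (RowIndex m p (ρ N) T) : ℝ) / √N := by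
  obtain ⟨G, hG0, hG⟩ := exists_isFiltered_rowSignal hA he hx hsys
  obtain ⟨B, hB0, hB⟩ := exists_eLpNorm_rowSignal_le hu he hG0 hG
  have h1 : ∀ (ω : Ω) N (r : RowIndex m p (ρ N) T), (ZU (fun t => u t ω) (fun t => y t ω) (ρ N) T N
      *ᵥ hankel (fun t => e t ω) (ρ N) T N q) r = Pi.single r 1 ⬝ᵥ
      ZU (fun t => u t ω) (fun t => y t ω) (ρ N) T N *ᵥ hankel (fun t => e t ω) (ρ N) T N q :=
    fun ω N r => by rw [single_one_dotProduct]
  refine (isBigOP_euclNorm (ι := fun N => RowIndex m p (ρ N) T)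
    (b := fun N => √(Λ q.2 q.2) * B / √N) (fun N ω => ZU (fun t => u t ω) (fun t => y t ω) (ρ N) T N
      *ᵥ hankel (fun t => e t ω) (ρ N) T N q) (fun N r => ?_) (fun N => by positivity)
    (Eventually.of_forall fun N r => ?_)).rate (√(Λ q.2 q.2) * B) ?_
  · simp only [h1]
    exact aestronglyMeasurable_dotProduct_ZU_hankel hu he (hG _ _) _ _ _
  · simp only [h1]
    refine (eLpNorm_dotProduct_ZU_hankel_le hA hu he hx hsys (hG _ _) _ q N).trans
      (ENNReal.ofReal_le_ofReal ?_)
    gcongr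
    rw [single_dotProduct_rowMoment]
    refine Real.sqrt_le_iff.2 ⟨hB0, ?_⟩
    exact (eLpNorm_two_le_iff_integral ((hG _ _ r).memLp hu he 0) hB0).1 (hB _ _ r 0)
  · refine Eventually.of_forall fun N => le_of_eq ?_
    rw [abs_of_nonneg (by positivity), abs_of_nonneg (by positivity)]
    ring

end Correlation

/-! ### Fixed past horizon -/

section FixedHorizon

variable {Ω : Type*} {m0 : MeasurableSpace Ω} {μ : Measure Ω} [IsProbabilityMeasure μ] {n m p : ℕ}
  {S : InnovationModel n m p} {u : ℤ → Ω → Fin m → ℝ} {x : ℤ → Ω → Fin n → ℝ}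
  {e y : ℤ → Ω → Fin p → ℝ} {Λ : Matrix (Fin p) (Fin p) ℝ} {G : ℝ}

/-- A linear relation between the data rows that holds in mean square holds in every data matrix. -/
theorem ae_rowMoment_mul_pinv_mul_ZU (hu : IsWideSenseStationary μ u) (he : IsInnovation μ u e Λ)
    {ρ T : ℕ} (hG : ∀ r : RowIndex m p ρ T, IsFiltered μ (drive u e) G (rowSignal u y ρ T r)) :
    ∀ᵐ ω ∂μ, ∀ N, rowMoment μ u y ρ T * pinv (rowMoment μ u y ρ T)
      * ZU (fun t => u t ω) (fun t => y t ω) ρ T N = ZU (fun t => u t ω) (fun t => y t ω) ρ T N := by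
  obtain ⟨Q, hQ⟩ : ∃ Q, Q = rowMoment μ u y ρ T * pinv (rowMoment μ u y ρ T) - 1 := ⟨_, rfl⟩
  have hQ0 : Q * rowMoment μ u y ρ T = 0 := by
    rw [hQ, Matrix.sub_mul, (pinv_spec _).mul_mul_self, Matrix.one_mul, sub_self]
  have h1 : ∀ᵐ ω ∂μ, ∀ (r : RowIndex m p ρ T) (k : ℕ),
      ∑ r', Q r r' * rowSignal u y ρ T r' k ω = 0 := by
    refine ae_all_iff.2 fun r => ae_all_iff.2 fun k => ?_
    have h2 : ∫ ω, (∑ r', Q r r' * rowSignal u y ρ T r' k ω) ^ 2 ∂μ = 0 := by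
      rw [integral_sq_sum_rowSignal hu he hG (Q r) k, Matrix.dotProduct_mulVec]
      have : Q r ᵥ* rowMoment μ u y ρ T = 0 := by
        funext r'
        exact congrFun (congrFun hQ0 r) r'
      rw [this, zero_dotProduct]
    have h3 := (integral_eq_zero_iff_of_nonneg (fun ω => sq_nonneg _)
      (memLp_sum_rowSignal hu he hG (Q r) k).integrable_sq).1 h2
    filter_upwards [h3] with ω hω
    simpa using hω
  filter_upwards [h1] with ω hω N
  rw [← sub_eq_zero]
  have h4 : rowMoment μ u y ρ T * pinv (rowMoment μ u y ρ T)
      * ZU (fun t => u t ω) (fun t => y t ω) ρ T N - ZU (fun t => u t ω) (fun t => y t ω) ρ T N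
      = Q * ZU (fun t => u t ω) (fun t => y t ω) ρ T N := by
    rw [hQ, Matrix.sub_mul, Matrix.one_mul]
  rw [h4]
  ext r k
  rw [Matrix.mul_apply, Matrix.zero_apply]
  simp only [ZU_apply]
  rw [← mul_zero (1 / √(N : ℝ)), ← hω r k, Finset.mul_sum]
  exact Finset.sum_congr rfl fun r' _ => by ring

theorem isLittleOP_frob_gram_sub (hu : IsWideSenseStationary μ u)
    (huerg : IsSecondOrderErgodic μ u) (he : IsInnovation μ u e Λ)
    {ρ T : ℕ} (hG : ∀ r : RowIndex m p ρ T, IsFiltered μ (drive u e) G (rowSignal u y ρ T r)) :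
    IsLittleOP μ (fun N ω => frob (ZU (fun t => u t ω) (fun t => y t ω) ρ T N *
      (ZU (fun t => u t ω) (fun t => y t ω) ρ T N)ᵀ - rowMoment μ u y ρ T)) fun _ => 1 := by
  have h1 : ∀ q : RowIndex m p ρ T × RowIndex m p ρ T, IsLittleOP μ (fun N ω =>
      |centredMoment μ (rowSignal u y ρ T q.1) (rowSignal u y ρ T q.2) N ω|) fun _ => 1 :=
    fun q => ((hG q.1).isLittleOP_centredMoment hu huerg he (hG q.2)).mono_ae
      (Eventually.of_forall fun ω N => by rw [abs_abs])
  refine (IsLittleOP.sum Finset.univ fun q _ => h1 q).mono_ae (Eventually.of_forall fun ω N => ?_)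
  rw [abs_of_nonneg (frob_nonneg _), frob]
  refine ((euclNorm_le_sum_abs _).trans (le_of_eq ?_)).trans (le_abs_self _)
  simp only [gram_sub_rowMoment_apply]

/-- The output relation for a fixed past horizon. No excitation is needed: the second moment matrix
of the data may be singular, but its kernel annihilates the data themselves. -/
theorem outputRelation_fixedHorizon (hA : IsSchurStable S.A) (hu : IsWideSenseStationary μ u)
    (huerg : IsSecondOrderErgodic μ u) (he : IsInnovation μ u e Λ) (hx : IsL2Bounded μ x)
    (hsys : IsTrajectory μ S u x e y) (T ρ : ℕ) (α : (N : ℕ) → Ω → Fin N → ℝ)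
    (hα : IsBigOP μ (fun N ω => euclNorm (α N ω)) fun _ => 1) :
    OutputRelation μ S u x y T (fun _ _ => ρ) α := by
  obtain ⟨G, -, hG⟩ := exists_isFiltered_rowSignal hA he hx hsys
  obtain ⟨r, hr⟩ : ∃ r : ℝ, r = frob (pinv (rowMoment μ u y ρ T)) := ⟨_, rfl⟩
  have hr0 : 0 ≤ r := hr ▸ frob_nonneg _
  refine outputRelation_of_innov hsys fun q => ?_
  have h1 := ((isBigOP_ZU_mulVec_hankel hA hu he hx hsys q fun _ => ρ).mul hα).const_mul √(2 * r)
  have h2 := (isLittleOP_frob_gram_sub hu huerg he (hG ρ T)).const_mul r (1 / 2) (by norm_num)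
  have h3 := ae_rowMoment_mul_pinv_mul_ZU hu he (hG ρ T)
  refine ((h1.mono_off (Y := fun N ω => hankel (fun t => e t ω) ρ T N q ⬝ᵥ
    dataProjector u y ρ T N ω *ᵥ α N ω) (fun N => {ω | 1 / 2 * |(1 : ℝ)| <
      |r * frob (ZU (fun t => u t ω) (fun t => y t ω) ρ T N
        * (ZU (fun t => u t ω) (fun t => y t ω) ρ T N)ᵀ - rowMoment μ u y ρ T)|} ∪ {ω | ¬ ∀ N, rowMoment μ u y ρ T * pinv (rowMoment μ u y ρ T)
      * ZU (fun t => u t ω) (fun t => y t ω) ρ T N = ZU (fun t => u t ω) (fun t => y t ω) ρ T N})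
      ?_ (Eventually.of_forall fun N ω hω => ?_)).rate √(Fintype.card (RowIndex m p ρ T)) ?_)
  · refine tendsto_of_tendsto_of_tendsto_of_le_of_le tendsto_const_nhds h2 (fun _ => zero_le)
      fun N => (measure_union_le _ _).trans ?_
    rw [ae_iff.1 h3, add_zero]
  · simp only [Set.mem_union, Set.mem_ofPred_eq, not_or, not_lt, not_not, abs_one, mul_one] at hω
    obtain ⟨hω1, hω2⟩ := hω
    have h0 := euclNorm_le_of_mem_range (rowMoment_transpose (μ := μ) (u := u) (y := y) ρ T)
    rw [← hr] at h0
    have h4 := euclNorm_rowProjector_sq_le hr0 h0 (hω2 N) ((le_abs_self _).trans hω1)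
      (hankel (fun t => e t ω) ρ T N q)
    have h5 : euclNorm (dataProjector u y ρ T N ω *ᵥ hankel (fun t => e t ω) ρ T N q)
        ≤ √(2 * r) * euclNorm (ZU (fun t => u t ω) (fun t => y t ω) ρ T N *ᵥ
          hankel (fun t => e t ω) ρ T N q) := by
      refine le_of_sq_le_sq ?_ (mul_nonneg (Real.sqrt_nonneg _) (euclNorm_nonneg _))
      rw [mul_pow, Real.sq_sqrt (by positivity)]
      exact h4
    rw [dataProjector, dotProduct_rowProjector, ← mul_assoc]
    refine ((abs_dotProduct_le _ _).trans ?_).trans (le_abs_self _)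
    exact mul_le_mul_of_nonneg_right h5 (euclNorm_nonneg _)
  · refine Eventually.of_forall fun N => le_of_eq ?_
    rw [mul_one, abs_of_nonneg (by positivity), rootRate, abs_of_nonneg (by positivity)]
    ring

end FixedHorizon

/-! ### Growing past horizon -/

section PositiveDefinite

variable {ι : Type*} [Fintype ι] {S : Matrix ι ι ℝ} {κ : ℝ}

theorem euclNorm_le_of_quadraticForm (hκ : 0 < κ)
    (h : ∀ c : ι → ℝ, κ * euclNorm c ^ 2 ≤ c ⬝ᵥ S *ᵥ c) (c : ι → ℝ) :
    euclNorm c ≤ κ⁻¹ * euclNorm (S *ᵥ c) := by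
  have h1 := ((h c).trans (le_abs_self _)).trans (abs_dotProduct_le _ _)
  rw [inv_mul_eq_div, le_div_iff₀ hκ]
  rcases (euclNorm_nonneg c).eq_or_lt with h0 | h0
  · rw [← h0, zero_mul]
    exact euclNorm_nonneg _
  · refine le_of_mul_le_mul_left ?_ h0
    linarith

theorem exists_mulVec_eq_of_quadraticForm (hκ : 0 < κ)
    (h : ∀ c : ι → ℝ, κ * euclNorm c ^ 2 ≤ c ⬝ᵥ S *ᵥ c) (q : ι → ℝ) : ∃ c, S *ᵥ c = q := by
  classical
  have h1 : Function.Injective S.mulVec := by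
    refine (injective_iff_map_eq_zero S.mulVecLin).2 fun c hc => ?_
    have h2 := euclNorm_le_of_quadraticForm hκ h c
    rw [show S *ᵥ c = 0 from hc] at h2
    funext i
    have h3 := (abs_le_euclNorm c i).trans h2
    simpa [euclNorm] using h3
  exact Matrix.mulVec_surjective_iff_isUnit.2 (Matrix.mulVec_injective_iff_isUnit.1 h1) q

end PositiveDefinite

section GrowingHorizon

variable {Ω : Type*} {m0 : MeasurableSpace Ω} {μ : Measure Ω} {n m p : ℕ}
  {S : InnovationModel n m p} {u : ℤ → Ω → Fin m → ℝ} {x : ℤ → Ω → Fin n → ℝ}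
  {e y : ℤ → Ω → Fin p → ℝ} {Λ : Matrix (Fin p) (Fin p) ℝ} {G : ℝ}

/-- The expectation of `[Z_P; U_F] a`. -/
noncomputable def meanData (μ : Measure Ω) (u : ℤ → Ω → Fin m → ℝ) (y : ℤ → Ω → Fin p → ℝ)
    (ρ T N : ℕ) (a : Fin N → ℝ) (r : RowIndex m p ρ T) : ℝ :=
  ∑ k : Fin N, (1 / √(N : ℝ) * a k) * ∫ ω, rowSignal u y ρ T r (k : ℕ) ω ∂μ

variable [IsProbabilityMeasure μ]

theorem abs_dotProduct_meanData_le (hu : IsWideSenseStationary μ u) (he : IsInnovation μ u e Λ)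
    {ρ T : ℕ} (hG : ∀ r : RowIndex m p ρ T, IsFiltered μ (drive u e) G (rowSignal u y ρ T r))
    (h : RowIndex m p ρ T → ℝ) (N : ℕ) (a : Fin N → ℝ) :
    |h ⬝ᵥ meanData μ u y ρ T N a| ≤ √(h ⬝ᵥ rowMoment μ u y ρ T *ᵥ h) * euclNorm a := by
  have h0 : 0 ≤ h ⬝ᵥ rowMoment μ u y ρ T *ᵥ h := by
    rw [← integral_sq_sum_rowSignal hu he hG h 0]
    exact integral_nonneg fun _ => sq_nonneg _
  have h1 : h ⬝ᵥ meanData μ u y ρ T N a = (fun k : Fin N => 1 / √(N : ℝ)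
      * ∫ ω, ∑ r, h r * rowSignal u y ρ T r (k : ℕ) ω ∂μ) ⬝ᵥ a := by
    simp only [dotProduct, meanData, Finset.mul_sum]
    rw [Finset.sum_comm]
    refine Finset.sum_congr rfl fun k _ => ?_
    rw [integral_finsetSum _ fun r _ =>
      (((hG r).memLp hu he (k : ℕ)).integrable one_le_two).const_mul _, Finset.mul_sum,
      Finset.sum_mul]
    refine Finset.sum_congr rfl fun r _ => ?_
    rw [integral_const_mul]
    ring
  rw [h1]
  refine (abs_dotProduct_le _ _).trans (mul_le_mul_of_nonneg_right ?_ (euclNorm_nonneg _))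
  refine Real.le_sqrt_of_sq_le ?_
  rw [euclNorm_sq]
  have h2 : ∀ k : Fin N, (1 / √(N : ℝ) * ∫ ω, ∑ r, h r * rowSignal u y ρ T r (k : ℕ) ω ∂μ) ^ 2
      ≤ 1 / (N : ℝ) * (h ⬝ᵥ rowMoment μ u y ρ T *ᵥ h) := fun k => by
    rw [mul_pow, div_pow, one_pow, Real.sq_sqrt (by positivity)]
    refine mul_le_mul_of_nonneg_left ?_ (by positivity)
    have hX := memLp_sum_rowSignal hu he hG h (k : ℕ)
    have h3 : eLpNorm (fun ω => ∑ r, h r * rowSignal u y ρ T r (k : ℕ) ω) 1 μ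
        ≤ ENNReal.ofReal √(h ⬝ᵥ rowMoment μ u y ρ T *ᵥ h) := by
      refine (eLpNorm_le_eLpNorm_of_exponent_le (by norm_num) hX.1).trans
        ((eLpNorm_two_le_iff_integral hX (Real.sqrt_nonneg _)).2 ?_)
      rw [Real.sq_sqrt h0, integral_sq_sum_rowSignal hu he hG h]
    have h4 := pow_le_pow_left₀ (abs_nonneg _)
      (abs_integral_le_of_eLpNorm (Real.sqrt_nonneg _) h3) 2
    rwa [sq_abs, Real.sq_sqrt h0] at h4
  refine (Finset.sum_le_sum fun k _ => h2 k).trans ?_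
  rw [Finset.sum_const, Finset.card_univ, Fintype.card_fin, nsmul_eq_mul, ← mul_assoc]
  rcases Nat.eq_zero_or_pos N with rfl | hN
  · simpa using h0
  · rw [mul_one_div_cancel (by positivity), one_mul]

/-- The solution of `S h = E[Z a] + v`, for the second moment matrix `S`, is bounded uniformly in
the past horizon. -/
theorem exists_coeff_of_meanData (hu : IsWideSenseStationary μ u) (he : IsInnovation μ u e Λ)
    {κ : ℝ} (hκ : 0 < κ) {ρ T : ℕ}
    (hG : ∀ r : RowIndex m p ρ T, IsFiltered μ (drive u e) G (rowSignal u y ρ T r))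
    (hS : ∀ c, κ * euclNorm c ^ 2 ≤ c ⬝ᵥ rowMoment μ u y ρ T *ᵥ c) (N : ℕ) (a : Fin N → ℝ)
    (v : RowIndex m p ρ T → ℝ) :
    ∃ h, rowMoment μ u y ρ T *ᵥ h = meanData μ u y ρ T N a + v ∧
      √(h ⬝ᵥ rowMoment μ u y ρ T *ᵥ h) ≤ euclNorm a + euclNorm v / √κ ∧
      euclNorm h ≤ (euclNorm a + euclNorm v / √κ) / √κ := by
  obtain ⟨h, hh⟩ := exists_mulVec_eq_of_quadraticForm hκ hS (meanData μ u y ρ T N a + v)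
  obtain ⟨s, hs⟩ : ∃ s, s = √(h ⬝ᵥ rowMoment μ u y ρ T *ᵥ h) := ⟨_, rfl⟩
  have hκ' : 0 < √κ := Real.sqrt_pos.2 hκ
  have hs0 : 0 ≤ s := hs ▸ Real.sqrt_nonneg _
  have h1 : euclNorm h ≤ s / √κ := by
    rw [le_div_iff₀ hκ', hs]
    refine Real.le_sqrt_of_sq_le ?_
    rw [mul_pow, Real.sq_sqrt hκ.le, mul_comm]
    exact hS h
  have h2 : s ^ 2 ≤ s * (euclNorm a + euclNorm v / √κ) := by
    rw [hs, Real.sq_sqrt ((by positivity : 0 ≤ κ * euclNorm h ^ 2).trans (hS h))]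
    nth_rewrite 1 [hh]
    rw [dotProduct_add]
    have h3 := (le_abs_self _).trans (abs_dotProduct_meanData_le hu he hG h N a)
    have h4 := (le_abs_self _).trans (abs_dotProduct_le h v)
    have h5 := mul_le_mul_of_nonneg_right h1 (euclNorm_nonneg v)
    rw [← hs] at h3 ⊢
    calc _ ≤ s * euclNorm a + s / √κ * euclNorm v := by linarith
      _ = _ := by ring
  have h6 : s ≤ euclNorm a + euclNorm v / √κ := by
    rcases hs0.eq_or_lt with h0 | h0
    · rw [← h0]
      have := euclNorm_nonneg a
      have := euclNorm_nonneg v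
      positivity
    · rw [sq] at h2
      exact le_of_mul_le_mul_left h2 h0
  exact ⟨h, hh, hs ▸ h6, h1.trans (div_le_div_of_nonneg_right h6 hκ'.le)⟩

/-- The sample second moments of the data rows converge at the rate `(number of rows) / √N`. -/
theorem isBigOP_frob_gram_sub (hA : IsSchurStable S.A) (hu : IsWideSenseStationary μ u)
    (he : IsInnovation μ u e Λ) (hx : IsL2Bounded μ x) (hsys : IsTrajectory μ S u x e y)
    (hrate : HasRootRateMoments μ u) (h4 : MemLp (e 0) 4 μ) (T : ℕ) (ρ : ℕ → ℕ) :
    IsBigOP μ (fun N ω => frob (ZU (fun t => u t ω) (fun t => y t ω) (ρ N) T N *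
      (ZU (fun t => u t ω) (fun t => y t ω) (ρ N) T N)ᵀ - rowMoment μ u y (ρ N) T))
      fun N => (Fintype.card (RowIndex m p (ρ N) T) : ℝ) / √N := by
  obtain ⟨G, hG0, hG⟩ := exists_isFiltered_rowSignal hA he hx hsys
  obtain ⟨c, hc0, hc⟩ := exists_eLpNorm_centredMoment_drive_le_of_rate hu hrate he h4
  simp only [frob, gram_sub_rowMoment_apply]
  refine (isBigOP_euclNorm (ι := fun N => RowIndex m p (ρ N) T × RowIndex m p (ρ N) T)
    (b := fun N => G * (G * (c / √N)))
    (fun N ω q => centredMoment μ (rowSignal u y (ρ N) T q.1) (rowSignal u y (ρ N) T q.2) N ω)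
    (fun N q => ?_) (fun N => by positivity) ?_).rate (G * (G * c)) ?_
  · have hk : ∀ k ∈ Finset.range N, AEStronglyMeasurable (fun ω =>
        rowSignal u y (ρ N) T q.1 k ω * rowSignal u y (ρ N) T q.2 k ω) μ := fun k _ =>
      ((hG _ _ q.1).memLp hu he k).1.mul ((hG _ _ q.2).memLp hu he k).1
    exact ((Finset.aestronglyMeasurable_fun_sum _ hk).const_mul _).sub
      aestronglyMeasurable_const
  · filter_upwards [eventually_ge_atTop 1] with N hN q
    exact (hG _ _ q.1).eLpNorm_centredMoment_le hu he (by positivity)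
      (fun s s' a b => hc s s' a b N hN) (hG _ _ q.2)
  · refine Eventually.of_forall fun N => le_of_eq ?_
    rw [abs_of_nonneg (by positivity), abs_of_nonneg (by positivity), Fintype.card_prod,
      Nat.cast_mul, Real.sqrt_mul_self (by positivity)]
    ring

/-- For a deterministic vector `a`, the data vector `[Z_P; U_F] a` is close to its mean. -/
theorem isBigOP_ZU_mulVec_sub_meanData (hA : IsSchurStable S.A) (hu : IsWideSenseStationary μ u)
    (he : IsInnovation μ u e Λ) (hx : IsL2Bounded μ x) (hsys : IsTrajectory μ S u x e y)
    (hs : HasBoundedFullRankSpectrum μ u) (T : ℕ) (ρ : ℕ → ℕ) (a : (N : ℕ) → Fin N → ℝ) {ca : ℝ}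
    (ha : ∀ N, euclNorm (a N) ≤ ca) :
    IsBigOP μ (fun N ω => euclNorm (ZU (fun t => u t ω) (fun t => y t ω) (ρ N) T N *ᵥ a N
      - meanData μ u y (ρ N) T N (a N)))
      fun N => √(Fintype.card (RowIndex m p (ρ N) T) : ℝ) / √N := by
  obtain ⟨G, hG0, hG⟩ := exists_isFiltered_rowSignal hA he hx hsys
  obtain ⟨C, hC0, hC⟩ := exists_eLpNorm_weighted_drive_le hu.memLp he hs
  have hca : 0 ≤ ca := (euclNorm_nonneg _).trans (ha 0)
  obtain ⟨w, hw⟩ : ∃ w : ℕ → ℕ → ℝ,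
      w = fun (N k : ℕ) => 1 / √(N : ℝ) * if h : k < N then a N ⟨k, h⟩ else 0 := ⟨_, rfl⟩
  have h1 : ∀ N ω r, (ZU (fun t => u t ω) (fun t => y t ω) (ρ N) T N *ᵥ a N
      - meanData μ u y (ρ N) T N (a N)) r = ∑ k ∈ Finset.range N, w N k
        * (rowSignal u y (ρ N) T r k ω - ∫ ω', rowSignal u y (ρ N) T r k ω' ∂μ) := fun N ω r => by
    rw [← Fin.sum_univ_eq_sum_range (fun k => w N k
      * (rowSignal u y (ρ N) T r k ω - ∫ ω', rowSignal u y (ρ N) T r k ω' ∂μ)), Pi.sub_apply,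
      mulVec, dotProduct, meanData, ← Finset.sum_sub_distrib]
    refine Finset.sum_congr rfl fun k _ => ?_
    rw [ZU_apply, hw]
    simp only [k.2, dite_true, Fin.eta]
    ring
  have h2 : ∀ N, √(∑ k ∈ Finset.range N, w N k ^ 2) ≤ ca / √N := fun N => by
    refine Real.sqrt_le_iff.2 ⟨by positivity, ?_⟩
    rw [← Fin.sum_univ_eq_sum_range (fun k => w N k ^ 2), hw]
    simp only [Fin.is_lt, dite_true, Fin.eta, mul_pow]
    rw [← Finset.mul_sum, ← euclNorm_sq, ← mul_pow, one_div_mul_eq_div]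
    exact pow_le_pow_left₀ (div_nonneg (euclNorm_nonneg _) (Real.sqrt_nonneg _))
      (div_le_div_of_nonneg_right (ha N) (Real.sqrt_nonneg _)) 2
  refine (isBigOP_euclNorm (ι := fun N => RowIndex m p (ρ N) T)
    (b := fun N => G * (C * (ca / √N))) (fun N ω => ZU (fun t => u t ω) (fun t => y t ω) (ρ N) T N
      *ᵥ a N - meanData μ u y (ρ N) T N (a N)) (fun N r => ?_) (fun N => by positivity)
    (Eventually.of_forall fun N r => ?_)).rate (G * (C * ca)) ?_
  · simp only [h1]
    have hk : ∀ k ∈ Finset.range N, AEStronglyMeasurable (fun ω => w N k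
        * (rowSignal u y (ρ N) T r k ω - ∫ ω', rowSignal u y (ρ N) T r k ω' ∂μ)) μ := fun k _ =>
      (((hG _ _ r).memLp hu he k).1.sub aestronglyMeasurable_const).const_mul _
    exact Finset.aestronglyMeasurable_fun_sum _ hk
  · simp only [h1]
    refine ((hG _ _ r).eLpNorm_weighted_le hu he (D := C * √(∑ k ∈ Finset.range N, w N k ^ 2))
      (by positivity) fun s b => hC s b N (w N)).trans (ENNReal.ofReal_le_ofReal ?_)
    gcongr
    exact h2 N
  · refine Eventually.of_forall fun N => le_of_eq ?_
    rw [abs_of_nonneg (by positivity), abs_of_nonneg (by positivity)]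
    ring

end GrowingHorizon

theorem exists_card_rowIndex_cube_le {m p T : ℕ} {ρ : ℕ → ℕ}
    (hρ : (fun N => (ρ N : ℝ) ^ 3) =O[atTop] (fun N => (N : ℝ))) :
    ∃ K : ℝ, 0 ≤ K ∧ ∀ᶠ N in atTop, (Fintype.card (RowIndex m p (ρ N) T) : ℝ) ^ 3 ≤ K * N := by
  obtain ⟨c, hc⟩ := hρ.bound
  refine ⟨((m + p + T * m : ℕ) : ℝ) ^ 3 * (4 * (|c| + 1)), by positivity, ?_⟩
  filter_upwards [hc, eventually_ge_atTop 1] with N hN hN1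
  have h1 : (ρ N : ℝ) ^ 3 ≤ |c| * N := by
    rw [Real.norm_of_nonneg (by positivity), Real.norm_of_nonneg (by positivity)] at hN
    exact hN.trans (mul_le_mul_of_nonneg_right (le_abs_self c) (by positivity))
  have h2 : (Fintype.card (RowIndex m p (ρ N) T) : ℝ) ≤ (m + p + T * m : ℕ) * ((ρ N : ℝ) + 1) := by
    simp only [RowIndex, Fintype.card_sum, Fintype.card_prod, Fintype.card_fin]
    push_cast
    have : 0 ≤ (m : ℝ) + p + ρ N * (T * m) := by positivity
    linarith
  have h3 : ((ρ N : ℝ) + 1) ^ 3 ≤ 4 * ((ρ N : ℝ) ^ 3 + 1) := by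
    have : 0 ≤ ((ρ N : ℝ) + 1) * ((ρ N : ℝ) - 1) ^ 2 := by positivity
    nlinarith
  have hN1' : (1 : ℝ) ≤ N := by exact_mod_cast hN1
  calc _ ≤ ((m + p + T * m : ℕ) * ((ρ N : ℝ) + 1)) ^ 3 := pow_le_pow_left₀ (by positivity) h2 3
    _ = ((m + p + T * m : ℕ) : ℝ) ^ 3 * ((ρ N : ℝ) + 1) ^ 3 := mul_pow _ _ _
    _ ≤ ((m + p + T * m : ℕ) : ℝ) ^ 3 * (4 * ((|c| + 1) * N)) :=
        mul_le_mul_of_nonneg_left (by linarith) (by positivity)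
    _ = _ := by ring

/-- A product of two estimates of orders `√d / √N` and `d / √N` is of order `1 / √N` if
`d ^ 3 = O(N)`. -/
theorem sqrt_mul_self_le_of_cube_le {d K N : ℝ} (hd : 0 ≤ d) (hK : 0 ≤ K) (h : d ^ 3 ≤ K * N) :
    √d * d ≤ √K * √N := by
  rw [← Real.sqrt_mul hK]
  refine Real.le_sqrt_of_sq_le ?_
  rw [mul_pow, Real.sq_sqrt hd]
  linarith

theorem tendsto_div_sqrt_of_cube_le {d : ℕ → ℝ} {K : ℝ} (hd : ∀ N, 0 ≤ d N)
    (h : ∀ᶠ N : ℕ in atTop, d N ^ 3 ≤ K * N) :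
    Tendsto (fun N : ℕ => d N / √(N : ℝ)) atTop (𝓝 0) := by
  have h1 : Tendsto (fun N : ℕ => (d N / √(N : ℝ)) ^ 3) atTop (𝓝 0) := by
    refine tendsto_of_tendsto_of_tendsto_of_le_of_le' tendsto_const_nhds (tendsto_const_div_sqrt K)
      (Eventually.of_forall fun N => pow_nonneg (div_nonneg (hd N) (Real.sqrt_nonneg _)) 3) ?_
    filter_upwards [h, eventually_ge_atTop 1] with N hN hN1
    have hN' : (0 : ℝ) < √N := Real.sqrt_pos.2 (by exact_mod_cast hN1)
    rw [div_pow, div_le_div_iff₀ (by positivity) hN']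
    calc d N ^ 3 * √N ≤ K * N * √N := mul_le_mul_of_nonneg_right hN hN'.le
      _ = K * √N ^ 3 := by rw [pow_succ, Real.sq_sqrt (by positivity), mul_assoc]
  have h2 := h1.rpow_const (p := ((3 : ℕ) : ℝ)⁻¹) (Or.inr (by positivity))
  rw [Real.zero_rpow (by norm_num)] at h2
  refine h2.congr fun N => ?_
  exact Real.pow_rpow_inv_natCast (div_nonneg (hd N) (Real.sqrt_nonneg _)) (by norm_num)

section GrowingHorizonRelations

variable {Ω : Type*} {m0 : MeasurableSpace Ω} {μ : Measure Ω} {n m p : ℕ}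
  {S : InnovationModel n m p} {u : ℤ → Ω → Fin m → ℝ} {x : ℤ → Ω → Fin n → ℝ}
  {e y : ℤ → Ω → Fin p → ℝ} {Λ : Matrix (Fin p) (Fin p) ℝ} {T : ℕ} {ρ : ℕ → ℕ} {κ : ℝ}
  {α : (N : ℕ) → Ω → Fin N → ℝ} {a : (N : ℕ) → Fin N → ℝ}
  {v : (N : ℕ) → RowIndex m p (ρ N) T → ℝ}

/-- The event that the prescribed data vector is not attained, or that the sample second moments
are too far from the expectations for the sample moment matrix to be well conditioned. -/
def badEvent (μ : Measure Ω) (u : ℤ → Ω → Fin m → ℝ) (y : ℤ → Ω → Fin p → ℝ) (T : ℕ) (ρ : ℕ → ℕ)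
    (κ : ℝ) (α : (N : ℕ) → Ω → Fin N → ℝ) (a : (N : ℕ) → Fin N → ℝ)
    (v : (N : ℕ) → RowIndex m p (ρ N) T → ℝ) (N : ℕ) : Set Ω :=
  {ω | ZU (fun t => u t ω) (fun t => y t ω) (ρ N) T N *ᵥ α N ω
    ≠ ZU (fun t => u t ω) (fun t => y t ω) (ρ N) T N *ᵥ a N + v N} ∪
  {ω | κ / 2 < |frob (ZU (fun t => u t ω) (fun t => y t ω) (ρ N) T N *
      (ZU (fun t => u t ω) (fun t => y t ω) (ρ N) T N)ᵀ - rowMoment μ u y (ρ N) T)|}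

/-- The vector `α` itself may be unbounded; only its projection on the data enters. -/
theorem isBigOP_dataProjector_mulVec (hκ : 0 < κ)
    (hS : ∀ N c, κ * euclNorm c ^ 2 ≤ c ⬝ᵥ rowMoment μ u y (ρ N) T *ᵥ c) {ca cv : ℝ}
    (ha : ∀ N, euclNorm (a N) ≤ ca) (hv : ∀ N, euclNorm (v N) ≤ cv)
    (hbad : Tendsto (fun N => μ (badEvent μ u y T ρ κ α a v N)) atTop (𝓝 0)) :
    IsBigOP μ (fun N ω => euclNorm (dataProjector u y (ρ N) T N ω *ᵥ α N ω)) fun _ => 1 := by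
  refine (isBigOP_const (ca + √(2 * κ⁻¹) * cv)).mono_off _ hbad
    (Eventually.of_forall fun N ω hω => ?_)
  simp only [badEvent, Set.mem_union, Set.mem_ofPred_eq, not_or, not_lt, not_not] at hω
  have hG : κ⁻¹ * frob (ZU (fun t => u t ω) (fun t => y t ω) (ρ N) T N *
      (ZU (fun t => u t ω) (fun t => y t ω) (ρ N) T N)ᵀ - rowMoment μ u y (ρ N) T) ≤ 1 / 2 := by
    rw [inv_mul_le_iff₀ hκ]
    linarith [(le_abs_self _).trans hω.2]
  rw [abs_of_nonneg (euclNorm_nonneg _)]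
  refine le_trans ?_ (le_abs_self _)
  refine (euclNorm_rowProjector_le_of_mulVec_eq (inv_nonneg.2 hκ.le)
    (euclNorm_le_of_quadraticForm hκ (hS N)) hG hω.1).trans ?_
  exact add_le_add (ha N) (mul_le_mul_of_nonneg_left (hv N) (Real.sqrt_nonneg _))

variable [IsProbabilityMeasure μ]

theorem tendsto_measure_badEvent (hA : IsSchurStable S.A) (hu : IsWideSenseStationary μ u)
    (he : IsInnovation μ u e Λ) (hx : IsL2Bounded μ x) (hsys : IsTrajectory μ S u x e y)
    (hrate : HasRootRateMoments μ u) (h4 : MemLp (e 0) 4 μ) (hκ : 0 < κ)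
    (hρ : (fun N => (ρ N : ℝ) ^ 3) =O[atTop] (fun N => (N : ℝ)))
    (hα : Tendsto (fun N => μ {ω | ZU (fun t => u t ω) (fun t => y t ω) (ρ N) T N *ᵥ α N ω
      ≠ ZU (fun t => u t ω) (fun t => y t ω) (ρ N) T N *ᵥ a N + v N}) atTop (𝓝 0)) :
    Tendsto (fun N => μ (badEvent μ u y T ρ κ α a v N)) atTop (𝓝 0) := by
  obtain ⟨K, -, hK⟩ := exists_card_rowIndex_cube_le (m := m) (p := p) (T := T) hρ
  have h1 := (isBigOP_frob_gram_sub hA hu he hx hsys hrate h4 T ρ).tendsto_measure_lt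
    (tendsto_div_sqrt_of_cube_le (fun _ => Nat.cast_nonneg _) hK) (half_pos hκ)
  have h2 := hα.add h1
  rw [add_zero] at h2
  exact tendsto_of_tendsto_of_tendsto_of_le_of_le tendsto_const_nhds h2 (fun _ => zero_le)
    fun N => measure_union_le _ _

/-- The output relation for a growing past horizon. Outside the bad event, the projected
innovations act on `α` as on the deterministic vector `a`, up to products of two estimates over the
data rows; these products are negligible because `ρ³ = O(N)`. -/
theorem outputRelation_growingHorizon (hA : IsSchurStable S.A) (hu : IsWideSenseStationary μ u)
    (he : IsInnovation μ u e Λ) (hx : IsL2Bounded μ x) (hsys : IsTrajectory μ S u x e y)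
    (hs : HasBoundedFullRankSpectrum μ u) (hrate : HasRootRateMoments μ u) (h4 : MemLp (e 0) 4 μ)
    (hκ : 0 < κ) (hS : ∀ N c, κ * euclNorm c ^ 2 ≤ c ⬝ᵥ rowMoment μ u y (ρ N) T *ᵥ c)
    (hρ : (fun N => (ρ N : ℝ) ^ 3) =O[atTop] (fun N => (N : ℝ))) {ca cv : ℝ}
    (ha : ∀ N, euclNorm (a N) ≤ ca) (hv : ∀ N, euclNorm (v N) ≤ cv)
    (hbad : Tendsto (fun N => μ (badEvent μ u y T ρ κ α a v N)) atTop (𝓝 0)) :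
    OutputRelation μ S u x y T (fun N _ => ρ N) α := by
  obtain ⟨G, hG0, hG⟩ := exists_isFiltered_rowSignal hA he hx hsys
  obtain ⟨K, hK0, hK⟩ := exists_card_rowIndex_cube_le (m := m) (p := p) (T := T) hρ
  choose h hh hhS hhn using fun N => exists_coeff_of_meanData hu he hκ (hG (ρ N) T) (hS N) N (a N)
    (v N)
  obtain ⟨M, hM⟩ : ∃ M : ℝ, M = ca + cv / √κ := ⟨_, rfl⟩
  have hMN : ∀ N, euclNorm (a N) + euclNorm (v N) / √κ ≤ M := fun N => by
    rw [hM]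
    exact add_le_add (ha N) (div_le_div_of_nonneg_right (hv N) (Real.sqrt_nonneg _))
  have hM0 : 0 ≤ M := (add_nonneg (euclNorm_nonneg _) (div_nonneg (euclNorm_nonneg _)
    (Real.sqrt_nonneg _))).trans (hMN 0)
  have hκ0 : 0 ≤ κ⁻¹ := inv_nonneg.2 hκ.le
  refine outputRelation_of_innov hsys fun q => ?_
  have hE := isBigOP_ZU_mulVec_hankel hA hu he hx hsys q ρ
  have h1 : IsBigOP μ (fun N ω => h N ⬝ᵥ ZU (fun t => u t ω) (fun t => y t ω) (ρ N) T N *ᵥ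
      hankel (fun t => e t ω) (ρ N) T N q) rootRate := by
    refine (isBigOP_of_eLpNorm (b := fun N => √(Λ q.2 q.2) * M / √N)
      (fun N => aestronglyMeasurable_dotProduct_ZU_hankel hu he (hG _ _) _ _ _)
      (fun N => by positivity) (Eventually.of_forall fun N =>
        (eLpNorm_dotProduct_ZU_hankel_le hA hu he hx hsys (hG _ _) _ q N).trans
          (ENNReal.ofReal_le_ofReal ?_))).rate (√(Λ q.2 q.2) * M) (Eventually.of_forall fun N => ?_)
    · gcongr
      exact (hhS N).trans (hMN N)
    · rw [rootRate, abs_of_nonneg (by positivity), abs_of_nonneg (by positivity)]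
      exact le_of_eq (by ring)
  have h2 : IsBigOP μ (fun N ω => 2 * κ⁻¹ * (M / √κ) *
      (euclNorm (ZU (fun t => u t ω) (fun t => y t ω) (ρ N) T N *ᵥ
        hankel (fun t => e t ω) (ρ N) T N q) *
      frob (ZU (fun t => u t ω) (fun t => y t ω) (ρ N) T N *
        (ZU (fun t => u t ω) (fun t => y t ω) (ρ N) T N)ᵀ - rowMoment μ u y (ρ N) T))) rootRate := by
    refine ((hE.mul (isBigOP_frob_gram_sub hA hu he hx hsys hrate h4 T ρ)).const_mul _).rate √K ?_
    filter_upwards [hK, eventually_ge_atTop 1] with N hN hN1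
    have hN' : (0 : ℝ) < √N := Real.sqrt_pos.2 (by exact_mod_cast hN1)
    rw [rootRate, abs_of_nonneg (by positivity), abs_of_nonneg (by positivity), div_mul_div_comm,
      mul_one_div, div_le_div_iff₀ (by positivity) hN', ← mul_assoc]
    exact mul_le_mul_of_nonneg_right
      (sqrt_mul_self_le_of_cube_le (Nat.cast_nonneg _) hK0 hN) hN'.le
  have h3 : IsBigOP μ (fun N ω => 2 * κ⁻¹ *
      (euclNorm (ZU (fun t => u t ω) (fun t => y t ω) (ρ N) T N *ᵥ
        hankel (fun t => e t ω) (ρ N) T N q) *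
      euclNorm (ZU (fun t => u t ω) (fun t => y t ω) (ρ N) T N *ᵥ a N
        - meanData μ u y (ρ N) T N (a N)))) rootRate := by
    refine ((hE.mul (isBigOP_ZU_mulVec_sub_meanData hA hu he hx hsys hs T ρ a ha)).const_mul
      _).rate √K ?_
    filter_upwards [hK, eventually_ge_atTop 1] with N hN hN1
    have hN' : (0 : ℝ) < √N := Real.sqrt_pos.2 (by exact_mod_cast hN1)
    obtain ⟨d, hd⟩ : ∃ d : ℕ, d = Fintype.card (RowIndex m p (ρ N) T) := ⟨_, rfl⟩
    rw [← hd] at hN ⊢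
    have hd1 : √(d : ℝ) * √(d : ℝ) ≤ √(d : ℝ) * d := by
      rcases Nat.eq_zero_or_pos d with h0 | h0
      · simp [h0]
      · have : (1 : ℝ) ≤ d := by exact_mod_cast h0
        exact mul_le_mul_of_nonneg_left (Real.sqrt_le_iff.2 ⟨by positivity, by nlinarith⟩) (Real.sqrt_nonneg _)
    rw [rootRate, abs_of_nonneg (by positivity), abs_of_nonneg (by positivity), div_mul_div_comm,
      mul_one_div, div_le_div_iff₀ (by positivity) hN', ← mul_assoc]
    exact mul_le_mul_of_nonneg_right
      (hd1.trans (sqrt_mul_self_le_of_cube_le (Nat.cast_nonneg _) hK0 hN)) hN'.le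
  refine ((h1.add h2).add h3).mono_off _ hbad (Eventually.of_forall fun N ω hω => ?_)
  simp only [badEvent, Set.mem_union, Set.mem_ofPred_eq, not_or, not_lt, not_not] at hω
  have hF : κ⁻¹ * frob (ZU (fun t => u t ω) (fun t => y t ω) (ρ N) T N *
      (ZU (fun t => u t ω) (fun t => y t ω) (ρ N) T N)ᵀ - rowMoment μ u y (ρ N) T) ≤ 1 / 2 := by
    rw [inv_mul_le_iff₀ hκ]
    linarith [(le_abs_self _).trans hω.2]
  have h5 := abs_dotProduct_rowProjector_le hκ0 (euclNorm_le_of_quadraticForm hκ (hS N)) hF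
    (hankel (fun t => e t ω) (ρ N) T N q) (α N ω) (hh N)
  rw [hω.1, add_sub_add_right_eq_sub, dotProduct_comm _ (h N)] at h5
  have h6 : 2 * κ⁻¹ * euclNorm (ZU (fun t => u t ω) (fun t => y t ω) (ρ N) T N *ᵥ
        hankel (fun t => e t ω) (ρ N) T N q) *
      (frob (ZU (fun t => u t ω) (fun t => y t ω) (ρ N) T N *
        (ZU (fun t => u t ω) (fun t => y t ω) (ρ N) T N)ᵀ - rowMoment μ u y (ρ N) T)
        * euclNorm (h N))
      ≤ 2 * κ⁻¹ * euclNorm (ZU (fun t => u t ω) (fun t => y t ω) (ρ N) T N *ᵥ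
        hankel (fun t => e t ω) (ρ N) T N q) *
      (frob (ZU (fun t => u t ω) (fun t => y t ω) (ρ N) T N *
        (ZU (fun t => u t ω) (fun t => y t ω) (ρ N) T N)ᵀ - rowMoment μ u y (ρ N) T)
        * (M / √κ)) :=
    mul_le_mul_of_nonneg_left (mul_le_mul_of_nonneg_left ((hhn N).trans
      (div_le_div_of_nonneg_right (hMN N) (Real.sqrt_nonneg _))) (frob_nonneg _))
      (mul_nonneg (by positivity) (euclNorm_nonneg _))
  refine (h5.trans ?_).trans (le_abs_self _)
  refine add_le_add ((add_le_add le_rfl (h6.trans (le_trans (le_of_eq ?_) (le_abs_self _)))).trans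
    (le_abs_self _)) ((le_of_eq (mul_assoc _ _ _)).trans (le_abs_self _))
  ring

end GrowingHorizonRelations

end DDPC

theorem theorem1 {Ω : Type*} [MeasurableSpace Ω] (μ : Measure Ω) [IsProbabilityMeasure μ]
    {n m p : ℕ} (S : InnovationModel n m p)
    (u : ℤ → Ω → Fin m → ℝ) (x : ℤ → Ω → Fin n → ℝ) (e y : ℤ → Ω → Fin p → ℝ)
    (Λ : Matrix (Fin p) (Fin p) ℝ)
    (hA : IsSchurStable S.A) (hAKC : IsSchurStable S.predA)
    (hu : IsWideSenseStationary μ u) (huerg : IsSecondOrderErgodic μ u)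
    (he : IsInnovation μ u e Λ)
    (hx : IsL2Bounded μ x) (hsys : IsTrajectory μ S u x e y) (T : ℕ) :
    -- fixed past horizon, arbitrary (data-dependent) `α`
    (∀ (ρ : ℕ) (α : (N : ℕ) → Ω → Fin N → ℝ),
      IsBigOP μ (fun N ω => euclNorm (α N ω)) (fun _ => 1) →
      OutputRelation μ S u x y T (fun _ _ => ρ) α) ∧
    -- long (data-dependent) past horizon, arbitrary (data-dependent) `α`
    (∀ (ρ : ℕ → Ω → ℕ) (α : (N : ℕ) → Ω → Fin N → ℝ),
      IsBigOP μ (fun N ω => euclNorm (α N ω)) (fun _ => 1) →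
      LongHorizon μ S ρ →
      StateRelation μ S u x y T ρ α) ∧
    -- growing past horizon, with persistency of excitation; `α` acts on the past data and future
    -- inputs as the nonrandom vector `a N`, up to a prescribed nonrandom vector `v N`
    (HasBoundedFullRankSpectrum μ u → Λ.PosDef → HasRootRateMoments μ u → MemLp (e 0) 4 μ →
      ∀ (ρ : ℕ → ℕ),
      (fun N => (ρ N : ℝ) ^ 3) =O[atTop] (fun N => (N : ℝ)) →
      ∀ (α : (N : ℕ) → Ω → Fin N → ℝ) (a : (N : ℕ) → Fin N → ℝ)
        (v : (N : ℕ) → ((Fin (ρ N) × Fin m) ⊕ (Fin (ρ N) × Fin p)) ⊕ (Fin T × Fin m) → ℝ),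
      (∃ c, ∀ N, euclNorm (a N) ≤ c) → (∃ c, ∀ N, euclNorm (v N) ≤ c) →
      Tendsto (fun N => μ {ω | ZU (fun t => u t ω) (fun t => y t ω) (ρ N) T N *ᵥ α N ω
        ≠ ZU (fun t => u t ω) (fun t => y t ω) (ρ N) T N *ᵥ a N + v N}) atTop (𝓝 0) →
      OutputRelation μ S u x y T (fun N _ => ρ N) α ∧
      (LongHorizon μ S (fun N _ => ρ N) →
        StateRelation μ S u x y T (fun N _ => ρ N) α ∧
        OutputDataRelation μ S u y T (fun N _ => ρ N) α)) := by
  refine ⟨fun ρ α hα => outputRelation_fixedHorizon hA hu huerg he hx hsys T ρ α hα,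
    fun ρ α hα hρ => stateRelation_longHorizon hx hsys T ρ α hα hρ, ?_⟩
  rintro hs hΛ hrate h4 ρ hρ α a v ⟨ca, ha⟩ ⟨cv, hv⟩ hα
  obtain ⟨κ, hκ, hS⟩ := exists_le_quadraticForm_rowMoment hA hAKC hu he hx hsys hs hΛ
  have hbad := tendsto_measure_badEvent hA hu he hx hsys hrate h4 hκ hρ hα
  have h1 : OutputRelation μ S u x y T (fun N _ => ρ N) α :=
    outputRelation_growingHorizon hA hu he hx hsys hs hrate h4 hκ (fun N c => hS (ρ N) T c) hρ
      ha hv hbad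
  refine ⟨h1, fun hlong => ?_⟩
  have h2 : StateRelation μ S u x y T (fun N _ => ρ N) α :=
    stateRelation_of_projection hx hsys
      (isBigOP_dataProjector_mulVec hκ (fun N c => hS (ρ N) T c) ha hv hbad) hlong
  exact ⟨h2, outputDataRelation_of_relations h1 h2⟩
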